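/- Let $\mathcal F=\{f_k\}$ be a family of keyed functions $f_k:\{0,1\}^n\to\{0,1\}^n$ with keys $k\in\{0,1\}^n$ (for every security parameter $n$). Assume that $\mathcal F$ is a family of quantum-secure pseudorandom functions: $f_k(x)$ is computable by a deterministic algorithm from $1^n,k,x$ in time polynomial in $n$, and for every quantum polynomial-time (QPT) distinguisher $\mathcal D$ with quantum oracle access $|x\rangle|y\rangle\mapsto|x\rangle|y\oplus\varphi(x)\rangle$ to a function $\varphi$ there is a negligible function $\mathrm{negl}$ such that for all $n$ $$\Bigl|\Pr_{k\leftarrow\{0,1\}^n}[\mathcal D^{f_k}(1^n)=1]-\Pr_{\varphi\leftarrow\{\{0,1\}^n\to\{0,1\}^n\}}[\mathcal D^{\varphi}(1^n)=1]\Bigr|\le \mathrm{negl}(n).$$ Let $\Pi[\mathcal F]$ be the symmetric-key encryption scheme whose key $k$ is uniform in $\{0,1\}^n$, with $\mathsf{Enc}_k(m;r)=(r,f_k(r)\oplus m)$ for $m\in\{0,1\}^n$ and uniform $r\in\{0,1\}^n$, and $\mathsf{Dec}_k(r,c)=c\oplus f_k(r)$. Then $\Pi[\mathcal F]$ is semantically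 secure under non-adaptive quantum chosen-ciphertext attack (SEM-QCCA1), in the following sense. In the game with bit $b\in\{0,1\}$, a key $k$ is generated; a QPT algorithm $\mathcal A$ with input $1^n$ has quantum access to $\mathsf{Enc}_k$ (each query is answered with fresh classical coins $r$ by $|m\rangle|c\rangle\mapsto|m\rangle|c\oplus\mathsf{Enc}_k(m;r)\rangle$) and to $\mathsf{Dec}_k$ ($|c\rangle|s\rangle\mapsto|c\rangle|s\oplus\mathsf{Dec}_k(c)\rangle$), and outputs a classical challenge template: a triple $(\mathsf{Samp},h,f)$ of classical circuits. A plaintext $m\leftarrow\mathsf{Samp}$ is generated, using uniform coins. Then $\mathcal A$ continues, keeping its classical and quantum memory, with quantum access to $\mathsf{Enc}_k$ only; it receives $1^n$, $h(m)$ and, if $b=1$, a fresh ciphertext $\mathsf{Enc}_k(m)$, or, if $b=0$, only the length $|m|$ in place of the ciphertext. It outputs a string and wins if this string equals $f(m)$. For every QPT algorithm $\mathcal A$ for the game with $b=1$ there is a QPT algorithm $\mathcal S$ for the game with $b=0$ such that, for every $n$, the challenge templates output by $\mathcal A$ and $\mathcal S$ are identically distributed, and there is a negligible function $\mathrm{negl}$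 such that for all $n$ $$\bigl|\Pr[\mathcal A\text{ wins the game with }b=1]-\Pr[\mathcal S\text{ wins the game with }b=0]\bigr|\le\mathrm{negl}(n).$$ Here a QPT algorithm is uniform: a fixed program with classical control, classical memory and qubits, using the gates $H$, $T=\mathrm{diag}(1,e^{i\pi/4})$, NOT, CNOT, Toffoli (more generally NOT with a fixed number of controls), computational-basis measurements and unit-cost oracle queries, that halts within polynomially many steps (in $n$ and the input length) for every sequence of measurement outcomes. A function is negligible if it is eventually smaller than $1/p(n)$ for every positive polynomial $p$. -/

import Mathlib

open scoped BigOperators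

namespace QCrypto

/-- Bit strings of length `n`. -/
abbrev Bits (n : ℕ) : Type := Fin n → Bool

/-- Negligible functions: eventually smaller than the inverse of every (nonzero, hence eventually
positive) polynomial. -/
def Negligible (ε : ℕ → ℝ) : Prop :=
  ∀ p : Polynomial ℕ, p ≠ 0 → ∃ N : ℕ, ∀ n > N, ε n < 1 / ((p.eval n : ℕ) : ℝ)

/-! ### Quantum states

The machines below work on quantum tapes, indexed by `ℕ`, with cells (qubits) indexed by `ℕ`.
All but finitely many qubits are always in state `|0⟩`, so a (possibly unnormalised) pure state is a
finitely supported combination of basis states. -/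

/-- A cell: the number of a tape and a position on that tape. -/
abbrev Cell : Type := ℕ × ℕ

/-- Computational basis states. -/
abbrev Basis : Type := Cell → Bool

/-- Unnormalised pure states. -/
abbrev Vec : Type := Basis →₀ ℂ

/-- The squared norm of a state. -/
noncomputable def normSq (v : Vec) : ℝ := v.sum fun _ a => ‖a‖ ^ 2

/-- The all-zero state `|00…⟩`. -/
noncomputable def vacuum : Vec := Finsupp.single (fun _ => false) 1

/-- The Hadamard gate on qubit `q`. -/
noncomputable def hGate (q : Cell) : Vec →ₗ[ℂ] Vec :=
  Finsupp.linearCombination ℂ fun e : Basis =>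
    Finsupp.single (Function.update e q false) (((Real.sqrt 2)⁻¹ : ℝ) : ℂ) +
      Finsupp.single (Function.update e q true)
        ((if e q then -1 else 1) * (((Real.sqrt 2)⁻¹ : ℝ) : ℂ))

/-- The phase gate `T = diag(1, exp(iπ/4))` on qubit `q`. -/
noncomputable def tGate (q : Cell) : Vec →ₗ[ℂ] Vec :=
  Finsupp.linearCombination ℂ fun e : Basis =>
    Finsupp.single e (if e q then Complex.exp (Complex.I * (Real.pi / 4)) else 1)

/-- The multiply controlled NOT gate with controls `cs` and target `q`: the NOT, CNOT and Toffoli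
gates for zero, one and two controls. If the target is among the controls, nothing happens. -/
noncomputable def flipGate (cs : List Cell) (q : Cell) : Vec →ₗ[ℂ] Vec :=
  Finsupp.lmapDomain ℂ ℂ fun e : Basis =>
    if q ∉ cs ∧ (∀ c ∈ cs, e c = true) then Function.update e q (!(e q)) else e

/-- The unnormalised state after measuring qubit `q` with outcome `b`. -/
noncomputable def project (q : Cell) (b : Bool) (v : Vec) : Vec := v.filter fun e => e q = b

/-- The unitary `|x⟩|y⟩ ↦ |x⟩|y ⊕ F x⟩`, where `x` is held in the first `a` cells of the quantum
tape `r` and `y` in the first `b` cells of the quantum tape `s`. If `r = s`, nothing happens. -/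
noncomputable def xorOracle {a b : ℕ} (F : Bits a → Bits b) (r s : ℕ) : Vec →ₗ[ℂ] Vec :=
  Finsupp.lmapDomain ℂ ℂ fun e : Basis => fun q : Cell =>
    if h : r ≠ s ∧ q.1 = s ∧ q.2 < b then xor (e q) (F (fun j => e (r, j)) ⟨q.2, h.2.2⟩) else e q

/-! ### Quantum oracle machines

Programs with classical control. The classical memory has counters (natural numbers) and classical
bit tapes; the quantum memory has quantum tapes. A cell is addressed by a fixed tape and the current
value of a fixed counter, which acts as a head. -/

/-- An address: the cell of tape `tape` at the position stored in counter `head`. -/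
structure Addr where
  tape : ℕ
  head : ℕ

/-- Classical memory. -/
structure Mem where
  ctr : ℕ → ℕ
  bit : Cell → Bool

/-- The cell that an address denotes. -/
def Addr.cell (a : Addr) (μ : Mem) : Cell := (a.tape, μ.ctr a.head)

/-- Tests for branching and loops. -/
inductive Test where
  /-- is counter `x` zero? -/
  | isZero (x : ℕ)
  /-- are the counters `x` and `y` equal? -/
  | eq (x y : ℕ)
  /-- is the classical bit at address `a` equal to `1`? -/
  | bit (a : Addr)

/-- The outcome of a test. -/
def Test.eval (μ : Mem) : Test → Bool
  | .isZero x => decide (μ.ctr x = 0)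
  | .eq x y => decide (μ.ctr x = μ.ctr y)
  | .bit a => μ.bit (a.cell μ)

/-- Programs with oracle names in `Q`. -/
inductive Prog (Q : Type) where
  | skip
  /-- increment counter `x` -/
  | inc (x : ℕ)
  /-- decrement counter `x` (if it is positive) -/
  | dec (x : ℕ)
  /-- set counter `x` to zero -/
  | clear (x : ℕ)
  /-- set counter `x` to the value of counter `y` -/
  | copy (x y : ℕ)
  /-- write the classical bit `b` at address `a` -/
  | write (a : Addr) (b : Bool)
  /-- apply the Hadamard gate to the qubit at `a` -/
  | hadamard (a : Addr)
  /-- apply the phase gate `T` to the qubit at `a` -/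
  | phase (a : Addr)
  /-- flip the qubit at `a` controlled by the qubits at `cs` -/
  | flip (cs : List Addr) (a : Addr)
  /-- measure the qubit at `a` in the computational basis; write the outcome to the classical
  bit at `d` -/
  | measure (a d : Addr)
  /-- query oracle `o` with input register on quantum tape `r`, output register on tape `s` -/
  | query (o : Q) (r s : ℕ)
  | seq (P R : Prog Q)
  | ite (t : Test) (P R : Prog Q)
  /-- repeat `P` as long as `t` holds -/
  | loop (t : Test) (P : Prog Q)

/-- Programs without quantum instructions and oracle queries: deterministic classical programs. -/
def Prog.IsClassical {Q : Type} : Prog Q → Prop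
  | .hadamard _ | .phase _ | .flip _ _ | .measure _ _ | .query _ _ _ => False
  | .seq P R | .ite _ P R => P.IsClassical ∧ R.IsClassical
  | .loop _ P => P.IsClassical
  | _ => True

/-- A configuration: the code still to be executed, the classical memory and the quantum state. In
the course of a computation, a configuration stands for one possible history of random outcomes, and
the squared norm of its unnormalised state is the probability of this history. -/
structure Config (Q : Type) where
  code : List (Prog Q)
  mem : Mem
  vec : Vec

/-- Semantics of oracles: the (unnormalised) states that can result from a query with input tape `r`
and output tape `s`. -/
abbrev Oracle (Q : Type) : Type := Q → ℕ → ℕ → Vec → Multiset Vec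

/-- One computation step. Each instruction, test and oracle query costs one step. -/
noncomputable def step {Q : Type} (O : Oracle Q) (c : Config Q) : Multiset (Config Q) :=
  match c.code with
  | [] => {c}
  | .skip :: l => {⟨l, c.mem, c.vec⟩}
  | .inc x :: l => {⟨l, ⟨Function.update c.mem.ctr x (c.mem.ctr x + 1), c.mem.bit⟩, c.vec⟩}
  | .dec x :: l => {⟨l, ⟨Function.update c.mem.ctr x (c.mem.ctr x - 1), c.mem.bit⟩, c.vec⟩}
  | .clear x :: l => {⟨l, ⟨Function.update c.mem.ctr x 0, c.mem.bit⟩, c.vec⟩}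
  | .copy x y :: l => {⟨l, ⟨Function.update c.mem.ctr x (c.mem.ctr y), c.mem.bit⟩, c.vec⟩}
  | .write a b :: l => {⟨l, ⟨c.mem.ctr, Function.update c.mem.bit (a.cell c.mem) b⟩, c.vec⟩}
  | .hadamard a :: l => {⟨l, c.mem, hGate (a.cell c.mem) c.vec⟩}
  | .phase a :: l => {⟨l, c.mem, tGate (a.cell c.mem) c.vec⟩}
  | .flip cs a :: l =>
      {⟨l, c.mem, flipGate (cs.map fun d => d.cell c.mem) (a.cell c.mem) c.vec⟩}
  | .measure a d :: l =>
      (Finset.univ : Finset Bool).val.map fun b =>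
        ⟨l, ⟨c.mem.ctr, Function.update c.mem.bit (d.cell c.mem) b⟩,
          project (a.cell c.mem) b c.vec⟩
  | .query o r s :: l => (O o r s c.vec).map fun v => ⟨l, c.mem, v⟩
  | .seq P R :: l => {⟨P :: R :: l, c.mem, c.vec⟩}
  | .ite t P R :: l => {⟨(if t.eval c.mem then P else R) :: l, c.mem, c.vec⟩}
  | .loop t P :: l =>
      {⟨if t.eval c.mem then P :: .loop t P :: l else l, c.mem, c.vec⟩}

/-- All histories of `T` steps (halted configurations stay as they are). -/
noncomputable def run {Q : Type} (O : Oracle Q) : ℕ → Config Q → Multiset (Config Q)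
  | 0, c => {c}
  | T + 1, c => (step O c).bind (run O T)

/-- The probability that a member of a multiset of histories satisfies `p`. -/
noncomputable def prob {Q : Type} (H : Multiset (Config Q)) (p : Mem → Prop) : ℝ :=
  open Classical in (H.map fun c => if p c.mem then normSq c.vec else 0).sum

/-- Write the string `w` on the classical tape `t`, and its length into counter `t`. -/
def Mem.put (μ : Mem) (t : ℕ) (w : List Bool) : Mem where
  ctr := Function.update μ.ctr t w.length
  bit := fun q => if q.1 = t ∧ q.2 < w.length then w.getD q.2 false else μ.bit q

/-- The string on the classical tape `t`, whose length is stored in counter `t`. -/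
def Mem.get (μ : Mem) (t : ℕ) : List Bool := (List.range (μ.ctr t)).map fun i => μ.bit (t, i)

/-- The blank memory. -/
def Mem.blank : Mem := ⟨fun _ => 0, fun _ => false⟩

/-- The input `1ⁿ`. -/
def unary (n : ℕ) : List Bool := List.replicate n true

/-- The initial configuration of a program on input `1ⁿ` (on tape `0`). -/
noncomputable def start {Q : Type} (P : Prog Q) (n : ℕ) : Config Q :=
  ⟨[P], Mem.blank.put 0 (unary n), vacuum⟩

/-! ### Quantum-secure pseudorandom functions -/

/-- A family of keyed functions `f_k : {0,1}ⁿ → {0,1}ⁿ` with keys `k ∈ {0,1}ⁿ`, for every `n`. -/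
abbrev KeyedFamily : Type := (n : ℕ) → Bits n → Bits n → Bits n

/-- Some deterministic classical program computes `f_k(x)` from `1ⁿ`, `k`, `x` (on the tapes
`0`, `1`, `2`) in time polynomial in `n`, with the output on tape `0`. -/
def EfficientlyComputable (F : KeyedFamily) : Prop :=
  ∃ (P : Prog Empty) (p : Polynomial ℕ), P.IsClassical ∧
    ∀ (n : ℕ) (k x : Bits n) (O : Oracle Empty),
      ∀ c ∈ run O (p.eval n)
          ⟨[P], ((Mem.blank.put 0 (unary n)).put 1 (List.ofFn k)).put 2 (List.ofFn x), vacuum⟩,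
        c.code = [] ∧ c.mem.get 0 = List.ofFn (F n k x)

/-- A quantum polynomial-time distinguisher: a quantum oracle program that, on input `1ⁿ`, halts
within polynomially many steps in every history, whatever its oracle does. -/
structure QPTDistinguisher where
  prog : Prog Unit
  time : Polynomial ℕ
  halts : ∀ (n : ℕ) (O : Oracle Unit), ∀ c ∈ run O (time.eval n) (start prog n), c.code = []

/-- Quantum oracle access to a function: `|x⟩|y⟩ ↦ |x⟩|y ⊕ φ(x)⟩`. -/
noncomputable def funOracle {a b : ℕ} (φ : Bits a → Bits b) : Oracle Unit :=
  fun _ r s v => {xorOracle φ r s v}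

/-- The probability that `D`, on input `1ⁿ` and with quantum oracle `φ`, outputs `1`. -/
noncomputable def QPTDistinguisher.acceptProb (D : QPTDistinguisher) (n : ℕ)
    (φ : Bits n → Bits n) : ℝ :=
  prob (run (funOracle φ) (D.time.eval n) (start D.prog n)) fun μ => μ.get 0 = [true]

/-- Quantum-secure pseudorandom functions. -/
def IsQPRF (F : KeyedFamily) : Prop :=
  EfficientlyComputable F ∧
    ∀ D : QPTDistinguisher, ∃ ε : ℕ → ℝ, Negligible ε ∧ ∀ n,
      |(𝔼 k : Bits n, D.acceptProb n (F n k)) - (𝔼 φ : Bits n → Bits n, D.acceptProb n φ)| ≤ ε n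

/-! ### Symmetric-key encryption schemes -/

/-- A symmetric-key encryption scheme on bit strings. Key generation and encryption are randomized;
their coins are explicit, uniformly random arguments. -/
structure SKES where
  keyCoins : ℕ → ℕ
  keyLen : ℕ → ℕ
  msgLen : ℕ → ℕ
  coinLen : ℕ → ℕ
  ctLen : ℕ → ℕ
  keyGen : (n : ℕ) → Bits (keyCoins n) → Bits (keyLen n)
  enc : (n : ℕ) → Bits (keyLen n) → Bits (msgLen n) → Bits (coinLen n) → Bits (ctLen n)
  dec : (n : ℕ) → Bits (keyLen n) → Bits (ctLen n) → Bits (msgLen n)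
  correct : ∀ n k m r, dec n k (enc n k m r) = m

/-- The PRF scheme: the key is uniform in `{0,1}ⁿ`, `Enc_k(m; r) = (r, f_k(r) ⊕ m)` and
`Dec_k(r, c) = c ⊕ f_k(r)`, the pair being the concatenation. -/
def prfScheme (F : KeyedFamily) : SKES where
  keyCoins n := n
  keyLen n := n
  msgLen n := n
  coinLen n := n
  ctLen n := n + n
  keyGen _ k := k
  enc n k m r := Fin.append r fun i => xor (F n k r i) (m i)
  dec n k c := fun i => xor (c (Fin.natAdd n i)) (F n k (fun j => c (Fin.castAdd n j)) i)
  correct n k m r := by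
    funext i
    simp only [Fin.append_left, Fin.append_right]
    cases F n k r i <;> cases m i <;> rfl

/-- The quantum encryption oracle: each query picks fresh uniform coins `ρ` and applies
`|m⟩|c⟩ ↦ |m⟩|c ⊕ Enc_k(m; ρ)⟩`. -/
noncomputable def SKES.encQuery (S : SKES) (n : ℕ) (k : Bits (S.keyLen n)) (r s : ℕ) (v : Vec) :
    Multiset Vec :=
  (Finset.univ : Finset (Bits (S.coinLen n))).val.map fun ρ =>
    (((Real.sqrt (2 ^ S.coinLen n))⁻¹ : ℝ) : ℂ) • xorOracle (fun m => S.enc n k m ρ) r s v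

/-- The oracles of the pre-challenge phase. -/
inductive CCAQuery where
  | enc
  | dec

/-- Quantum oracles for `Enc_k` and `Dec_k`, the latter being `|c⟩|s⟩ ↦ |c⟩|s ⊕ Dec_k(c)⟩`. -/
noncomputable def SKES.ccaOracle (S : SKES) (n : ℕ) (k : Bits (S.keyLen n)) : Oracle CCAQuery
  | .enc, r, s, v => S.encQuery n k r s v
  | .dec, r, s, v => {xorOracle (S.dec n k) r s v}

/-- Quantum oracle for `Enc_k` only. -/
noncomputable def SKES.encOracle (S : SKES) (n : ℕ) (k : Bits (S.keyLen n)) : Oracle Unit :=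
  fun _ r s v => S.encQuery n k r s v

/-! ### Challenge templates -/

/-- A classical circuit: the wires `0, …, arity - 1` carry the input, each gate `(i, j)` adds a wire
with the NAND of the wires `i` and `j`, and the last `outputs` wires are the output. Wires that do
not exist (yet) read as `0`. -/
structure Circuit where
  arity : ℕ
  outputs : ℕ
  gates : List (ℕ × ℕ)

/-- The function computed by a circuit (the input is cut or padded to the arity). -/
def Circuit.eval (C : Circuit) (x : List Bool) : List Bool :=
  let wires := C.gates.foldl
    (fun w g => w ++ [!(w.getD g.1 false && w.getD g.2 false)])
    ((List.range C.arity).map fun i => x.getD i false)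
  wires.drop (wires.length - C.outputs)

/-- Read a string `1^a 0 1^b 0 ⋯` as the list `a, b, …` (with `acc` ones already read). -/
def blocks : ℕ → List Bool → List ℕ
  | _, [] => []
  | acc, true :: l => blocks (acc + 1) l
  | acc, false :: l => acc :: blocks 0 l

/-- Group a list into consecutive pairs. -/
def pairs : List ℕ → List (ℕ × ℕ)
  | i :: j :: l => (i, j) :: pairs l
  | _ => []

/-- The circuit described by a string: arity, number of outputs and the gates, as numbers in unary,
each followed by `0`. -/
def Circuit.decode (w : List Bool) : Circuit :=
  match blocks 0 w with
  | a :: o :: l => ⟨a, o, pairs l⟩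
  | _ => ⟨0, 0, []⟩

/-- A challenge template `(Samp, h, f)`; `Samp` takes uniformly random bits as its input. -/
structure Template where
  samp : Circuit
  h : Circuit
  f : Circuit

/-- The plaintext of length `ℓ` that `Samp` produces from the coins `σ`. -/
def Template.message (t : Template) (ℓ : ℕ) (σ : Bits t.samp.arity) : Bits ℓ :=
  fun i => (t.samp.eval (List.ofFn σ)).getD i false

/-- The template that a program outputs on the tapes `0`, `1`, `2`. -/
def Mem.template (μ : Mem) : Template :=
  ⟨Circuit.decode (μ.get 0), Circuit.decode (μ.get 1), Circuit.decode (μ.get 2)⟩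

/-! ### Semantic security under non-adaptive quantum chosen-ciphertext attack -/

/-- The configuration in which the post-challenge program `P` starts: the classical and quantum
memory is that left by the pre-challenge program, with `1ⁿ`, the challenge `a` and the side
information `w` written on the tapes `0`, `1`, `2`. -/
def resume {Q Q' : Type} (P : Prog Q') (n : ℕ) (c : Config Q) (a w : List Bool) : Config Q' :=
  ⟨[P], ((c.mem.put 0 (unary n)).put 1 a).put 2 w, c.vec⟩

/-- A quantum polynomial-time algorithm in the semantic-security game, with a pre-challenge and a
post-challenge program, that expects a challenge of length `ℓ n`. In every history, and whatever the
oracles do, the first halts within `time(n)` steps and the second within `time(n + |w|)` steps, where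
`w` is the side information. -/
structure QPTAdversary (ℓ : ℕ → ℕ) where
  pre : Prog CCAQuery
  post : Prog Unit
  time : Polynomial ℕ
  halts : ∀ (n : ℕ) (O : Oracle CCAQuery), ∀ c ∈ run O (time.eval n) (start pre n),
    c.code = [] ∧ ∀ (a w : List Bool) (O' : Oracle Unit), a.length = ℓ n →
      ∀ c' ∈ run O' (time.eval (n + w.length)) (resume post n c a w), c'.code = []

/-- The histories of the pre-challenge phase. -/
noncomputable def SKES.preRun (S : SKES) {ℓ : ℕ → ℕ} (A : QPTAdversary ℓ) (n : ℕ)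
    (k : Bits (S.keyLen n)) : Multiset (Config CCAQuery) :=
  run (S.ccaOracle n k) (A.time.eval n) (start A.pre n)

/-- The histories of the post-challenge phase. -/
noncomputable def SKES.postRun (S : SKES) {ℓ : ℕ → ℕ} (A : QPTAdversary ℓ) (n : ℕ)
    (k : Bits (S.keyLen n)) (c : Config CCAQuery) (a w : List Bool) : Multiset (Config Unit) :=
  run (S.encOracle n k) (A.time.eval (n + w.length)) (resume A.post n c a w)

/-- The length of the challenge: that of a ciphertext if `b = 1`, that of a plaintext if `b = 0`. -/
def SKES.chalLen (S : SKES) (b : Bool) : ℕ → ℕ := if b then S.ctLen else S.msgLen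

/-- The challenge on plaintext `m`: the ciphertext `Enc_k(m; ρ)` if `b = 1`, and only the plaintext
length `|m|`, in unary, if `b = 0`. -/
def SKES.challenge (S : SKES) (b : Bool) (n : ℕ) (k : Bits (S.keyLen n)) (m : Bits (S.msgLen n))
    (ρ : Bits (S.coinLen n)) : List Bool :=
  if b then List.ofFn (S.enc n k m ρ) else unary (S.msgLen n)

/-- The probability that `A` outputs the template `t`. -/
noncomputable def SKES.templateProb (S : SKES) {ℓ : ℕ → ℕ} (A : QPTAdversary ℓ) (n : ℕ)
    (t : Template) : ℝ :=
  𝔼 κ : Bits (S.keyCoins n), prob (S.preRun A n (S.keyGen n κ)) fun μ => μ.template = t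

/-- The probability that `A` wins the semantic-security game with bit `b`: it outputs a template
`(Samp, h, f)` after access to `Enc_k` and `Dec_k`, receives `h(m)` for a sampled plaintext `m`, and
also `Enc_k(m)` if `b = 1`, and outputs the string `f(m)` after further access to `Enc_k`. -/
noncomputable def SKES.semWinProb (S : SKES) (b : Bool) (A : QPTAdversary (S.chalLen b)) (n : ℕ) :
    ℝ :=
  𝔼 κ : Bits (S.keyCoins n),
    let k := S.keyGen n κ
    ((S.preRun A n k).map fun c =>
      let t := c.mem.template
      𝔼 σ : Bits t.samp.arity,
        let m := t.message (S.msgLen n) σ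
        𝔼 ρ : Bits (S.coinLen n),
          prob (S.postRun A n k c (S.challenge b n k m ρ) (t.h.eval (List.ofFn m)))
            fun μ => μ.get 0 = t.f.eval (List.ofFn m)).sum

/-- SEM-QCCA1 security. -/
def SKES.IsSEMQCCA1 (S : SKES) : Prop :=
  ∀ A : QPTAdversary (S.chalLen true), ∃ Sim : QPTAdversary (S.chalLen false),
    (∀ (n : ℕ) (t : Template), S.templateProb A n t = S.templateProb Sim n t) ∧
    ∃ ε : ℕ → ℝ, Negligible ε ∧
      ∀ n, |S.semWinProb true A n - S.semWinProb false Sim n| ≤ ε n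

end QCrypto

/-! The simulator runs the adversary and hands it a uniformly random string of length `2n` where a
ciphertext `(r, f_k(r) ⊕ m)` is expected. It leaves the pre-challenge phase alone, so the templates
agree exactly (`preRun_simulator`), and it remains to compare the two winning probabilities.

Both games can be played by a distinguisher that has only an oracle for a function `φ`. Encryption
is simulated by tossing coins, querying `φ` into a scratch register, using the pad and querying
again to erase it; decryption is one query followed by CNOTs. The distinguisher also evaluates the
circuits of the template, prepares the challenge, either real or random, and checks the adversary's
answer. `val_game` proves that this program halts in polynomial time for every oracle,
`gameValue_eq` that for an honest function oracle its acceptance probability is the winning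
probability. Two applications of the pseudorandomness of `f_k` thus replace it by a uniformly random
`φ` in the real and in the ideal game.

For random `φ` the comparison is information-theoretic (`abs_realValue_sub_idealValue_le`). Let `r`
be the challenge coins. Resampling the value of `φ` at `r` as a fresh `y` does not change the
distribution of `φ` (`expect_resample`). Before the challenge `r` is independent of everything the
adversary sees, so the change at `r` can be ignored there: a query in superposition carries little
weight on a random point, and `t` queries notice it with advantage `O(t / √(2^n))`
(`sum_abs_run_funCCA_sub_le`). After the challenge there is no decryption oracle, and encryption
queries use fresh classical coins, which hit `r` with probability `2^(-n)` each
(`abs_run_funEnc_sub_le`). Once `y` occurs only in the challenge, `y ⊕ m` is uniform whatever `m`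
is, and the real challenge has become the random one.

The query bounds rest on a few facts about runs: the results depend linearly on the initial state
with squared norms adding up (`linearIn_run`), and hence every outcome probability satisfies a
continuity estimate (`ProbLike.run`) that survives a hybrid argument over the steps
(`sum_abs_run_sub_le`). -/

namespace QCrypto

/-! ### Big-step semantics -/

section BigStep

variable {Q : Type}

theorem _root_.Multiset.bind_pure {α : Type*} (M : Multiset α) : (M.bind fun p => {p}) = M := by
  simpa using Multiset.bind_singleton M id

theorem run_add (O : Oracle Q) (s t : ℕ) (c : Config Q) :
    run O (s + t) c = (run O s c).bind (run O t) := by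
  induction s generalizing c with
  | zero => simp [run]
  | succ s ih =>
    rw [Nat.succ_add]
    simp only [run, Multiset.bind_assoc]
    exact congrArg _ (funext fun c' => ih c')

theorem run_nil (O : Oracle Q) (t : ℕ) (μ : Mem) (v : Vec) :
    run O t ⟨[], μ, v⟩ = {⟨[], μ, v⟩} := by
  induction t with
  | zero => rfl
  | succ t ih => simp [run, step, ih]

/-- Within `t` steps, every history of the code `l` halts, with results `M`. -/
def Ends (O : Oracle Q) (t : ℕ) (l : List (Prog Q)) (μ : Mem) (v : Vec)
    (M : Multiset (Mem × Vec)) : Prop :=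
  run O t ⟨l, μ, v⟩ = M.map fun p => ⟨[], p.1, p.2⟩

/-- Halted configurations are stationary, so surplus time changes nothing. All running times below
are therefore generous upper bounds. -/
theorem Ends.mono {O : Oracle Q} {t t' : ℕ} {l : List (Prog Q)} {μ : Mem} {v : Vec}
    {M : Multiset (Mem × Vec)} (h : Ends O t l μ v M) (ht : t ≤ t') : Ends O t' l μ v M := by
  obtain ⟨d, rfl⟩ := Nat.exists_eq_add_of_le ht
  unfold Ends at *
  rw [run_add, h, Multiset.bind_map]
  simp [run_nil, Multiset.bind_singleton]

theorem ends_nil (O : Oracle Q) (t : ℕ) (μ : Mem) (v : Vec) : Ends O t [] μ v {(μ, v)} := by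
  simp [Ends, run_nil]

/-- The program `P` needs at most `t` steps, with results `M`, whatever code comes next. -/
def Big (O : Oracle Q) (t : ℕ) (P : Prog Q) (μ : Mem) (v : Vec) (M : Multiset (Mem × Vec)) :
    Prop :=
  ∀ l T N, (∀ p ∈ M, Ends O T l p.1 p.2 (N p)) → Ends O (t + T) (P :: l) μ v (M.bind N)

theorem Big.mono {O : Oracle Q} {t t' : ℕ} {P : Prog Q} {μ : Mem} {v : Vec}
    {M : Multiset (Mem × Vec)} (h : Big O t P μ v M) (ht : t ≤ t') : Big O t' P μ v M :=
  fun l T N hN => (h l T N hN).mono (by omega)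

theorem Big.to {O : Oracle Q} {t t' : ℕ} {P : Prog Q} {μ : Mem} {v : Vec} {p p' : Mem × Vec}
    (h : Big O t P μ v {p}) (ht : t ≤ t') (hp : p = p') : Big O t' P μ v {p'} :=
  hp ▸ h.mono ht

theorem run_bind_of_ends {O : Oracle Q} {T : ℕ} {l : List (Prog Q)} {M : Multiset (Mem × Vec)}
    {N : Mem × Vec → Multiset (Mem × Vec)} (hN : ∀ p ∈ M, Ends O T l p.1 p.2 (N p)) :
    (M.map fun p => (⟨l, p.1, p.2⟩ : Config Q)).bind (run O T) =
      (M.bind N).map fun p => ⟨[], p.1, p.2⟩ := by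
  rw [Multiset.bind_map, Multiset.map_bind]
  exact Multiset.bind_congr fun p hp => hN p hp

theorem big_of_step {O : Oracle Q} {P : Prog Q} {μ : Mem} {v : Vec} {M : Multiset (Mem × Vec)}
    (h : ∀ l, step O ⟨P :: l, μ, v⟩ = M.map fun p => ⟨l, p.1, p.2⟩) : Big O 1 P μ v M := by
  intro l T N hN
  unfold Ends
  rw [run_add]
  simp only [run, Multiset.bind_pure, h]
  exact run_bind_of_ends hN

theorem ends_cons_of_step {O : Oracle Q} {P : Prog Q} {l l' : List (Prog Q)} {μ : Mem} {v : Vec}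
    {T : ℕ} {M : Multiset (Mem × Vec)} (h : step O ⟨P :: l, μ, v⟩ = {⟨l', μ, v⟩})
    (hN : Ends O T l' μ v M) : Ends O (T + 1) (P :: l) μ v M := by
  unfold Ends at *
  simp only [run, h, Multiset.singleton_bind, hN]

/-- Since `Big` quantifies over the code that follows, the remainder `R :: l` can itself serve as
continuation for `P`. -/
theorem Big.seq {O : Oracle Q} {t t' : ℕ} {P R : Prog Q} {μ : Mem} {v : Vec}
    {M : Multiset (Mem × Vec)} {M' : Mem × Vec → Multiset (Mem × Vec)} (h : Big O t P μ v M)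
    (h' : ∀ p ∈ M, Big O t' R p.1 p.2 (M' p)) : Big O (t + t' + 1) (.seq P R) μ v (M.bind M') := by
  intro l T N hN
  rw [Multiset.bind_assoc]
  refine (ends_cons_of_step (T := t + (t' + T)) rfl
    (h (R :: l) (t' + T) _ fun p hp => h' p hp l T N fun q hq => ?_)).mono (by omega)
  exact hN q (Multiset.mem_bind.2 ⟨p, hp, hq⟩)

theorem Big.seq_det {O : Oracle Q} {t t' : ℕ} {P R : Prog Q} {μ μ' : Mem} {v v' : Vec}
    {M : Multiset (Mem × Vec)} (h : Big O t P μ v {(μ', v')}) (h' : Big O t' R μ' v' M) :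
    Big O (t + t' + 1) (.seq P R) μ v M := by
  have := h.seq (M' := fun _ => M) (R := R) (t' := t') (by simpa using h')
  simpa using this

theorem Ends.unique {O : Oracle Q} {t t' : ℕ} {l : List (Prog Q)} {μ : Mem} {v : Vec}
    {M M' : Multiset (Mem × Vec)} (h : Ends O t l μ v M) (h' : Ends O t' l μ v M') : M = M' := by
  have h1 := h.mono (le_max_left t t')
  have h2 := h'.mono (le_max_right t t')
  unfold Ends at h1 h2
  have := congrArg (Multiset.map fun c : Config Q => (c.mem, c.vec)) (h1.symm.trans h2)
  simpa [Multiset.map_map] using this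

/-- Here the results are indexed by labels `a`, and `M` may depend on the label and not only on the
memory and state `f a`. If `f` identifies two labels, `Ends.unique` forces the continuations to
agree, so choosing a continuation for each pair is harmless. -/
theorem Big.seq_map {α : Type*} {O : Oracle Q} {t t' : ℕ} {P R : Prog Q} {μ : Mem} {v : Vec}
    {A : Multiset α} {f : α → Mem × Vec} {M : α → Multiset (Mem × Vec)}
    (h : Big O t P μ v (A.map f)) (h' : ∀ a ∈ A, Big O t' R (f a).1 (f a).2 (M a)) :
    Big O (t + t' + 1) (.seq P R) μ v (A.bind M) := by
  intro l T N hN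
  have h2 : ∀ a ∈ A, Ends O (t' + T) (R :: l) (f a).1 (f a).2 ((M a).bind N) := fun a ha =>
    h' a ha l T N fun q hq => hN q (Multiset.mem_bind.2 ⟨a, ha, hq⟩)
  have h3 : ∀ p ∈ A.map f, ∃ K, Ends O (t' + T) (R :: l) p.1 p.2 K := by
    intro p hp
    obtain ⟨a, ha, rfl⟩ := Multiset.mem_map.1 hp
    exact ⟨_, h2 a ha⟩
  choose! K hK using h3
  have h4 := ends_cons_of_step (P := .seq P R) (T := t + (t' + T)) rfl (h (R :: l) (t' + T) K hK)
  rw [Multiset.bind_map, Multiset.bind_congr fun a ha =>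
    (hK (f a) (Multiset.mem_map_of_mem f ha)).unique (h2 a ha), ← Multiset.bind_assoc] at h4
  exact h4.mono (by omega)

theorem Big.ite {O : Oracle Q} {t : ℕ} {b : Test} {P R : Prog Q} {μ : Mem} {v : Vec}
    {M : Multiset (Mem × Vec)} (h : Big O t (if b.eval μ then P else R) μ v M) :
    Big O (t + 1) (.ite b P R) μ v M := by
  intro l T N hN
  exact (ends_cons_of_step (T := t + T) rfl (h l T N hN)).mono (by omega)

theorem big_loop_false {O : Oracle Q} {b : Test} {P : Prog Q} {μ : Mem} {v : Vec}
    (hb : b.eval μ = false) : Big O 1 (.loop b P) μ v {(μ, v)} :=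
  big_of_step fun l => by simp [step, hb]

theorem Big.loop {O : Oracle Q} {t t' : ℕ} {b : Test} {P : Prog Q} {μ : Mem} {v : Vec}
    {M : Multiset (Mem × Vec)} {M' : Mem × Vec → Multiset (Mem × Vec)} (hb : b.eval μ = true)
    (h : Big O t P μ v M) (h' : ∀ p ∈ M, Big O t' (.loop b P) p.1 p.2 (M' p)) :
    Big O (t + t' + 1) (.loop b P) μ v (M.bind M') := by
  intro l T N hN
  rw [Multiset.bind_assoc]
  refine (ends_cons_of_step (T := t + (t' + T)) (by simp [step, hb])
    (h (.loop b P :: l) (t' + T) _ fun p hp => h' p hp l T N fun q hq => ?_)).mono (by omega)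
  exact hN q (Multiset.mem_bind.2 ⟨p, hp, hq⟩)

theorem big_query (O : Oracle Q) (o : Q) (r s : ℕ) (μ : Mem) (v : Vec) :
    Big O 1 (.query o r s) μ v ((O o r s v).map fun w => (μ, w)) :=
  big_of_step fun l => by simp [step, Multiset.map_map]

theorem big_measure (O : Oracle Q) (a d : Addr) (μ : Mem) (v : Vec) :
    Big O 1 (.measure a d) μ v ((Finset.univ : Finset Bool).val.map fun b =>
      (⟨μ.ctr, Function.update μ.bit (d.cell μ) b⟩, project (a.cell μ) b v)) :=
  big_of_step fun l => by simp only [step, Multiset.map_map, Function.comp_def]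

/-- Programs without loops, measurements and queries. -/
def Prog.Straight : Prog Q → Prop
  | .measure _ _ | .query _ _ _ | .loop _ _ => False
  | .seq P R | .ite _ P R => P.Straight ∧ R.Straight
  | _ => True

/-- The effect of a straight program. -/
noncomputable def Prog.exec : Prog Q → Mem × Vec → Mem × Vec
  | .inc x, p => (⟨Function.update p.1.ctr x (p.1.ctr x + 1), p.1.bit⟩, p.2)
  | .dec x, p => (⟨Function.update p.1.ctr x (p.1.ctr x - 1), p.1.bit⟩, p.2)
  | .clear x, p => (⟨Function.update p.1.ctr x 0, p.1.bit⟩, p.2)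
  | .copy x y, p => (⟨Function.update p.1.ctr x (p.1.ctr y), p.1.bit⟩, p.2)
  | .write a b, p => (⟨p.1.ctr, Function.update p.1.bit (a.cell p.1) b⟩, p.2)
  | .hadamard a, p => (p.1, hGate (a.cell p.1) p.2)
  | .phase a, p => (p.1, tGate (a.cell p.1) p.2)
  | .flip cs a, p => (p.1, flipGate (cs.map fun d => d.cell p.1) (a.cell p.1) p.2)
  | .seq P R, p => R.exec (P.exec p)
  | .ite t P R, p => if t.eval p.1 then P.exec p else R.exec p
  | _, p => p

/-- The number of instructions in a program. -/
def Prog.size : Prog Q → ℕ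
  | .seq P R | .ite _ P R => P.size + R.size + 1
  | _ => 1

theorem big_exec (O : Oracle Q) : ∀ (P : Prog Q), P.Straight → ∀ (μ : Mem) (v : Vec),
    Big O P.size P μ v {P.exec (μ, v)}
  | .skip, _, _, _ | .inc _, _, _, _ | .dec _, _, _, _ | .clear _, _, _, _ | .copy _ _, _, _, _
  | .write _ _, _, _, _ | .hadamard _, _, _, _ | .phase _, _, _, _ | .flip _ _, _, _, _ =>
    big_of_step fun l => by simp [step, Prog.exec]
  | .measure _ _, h, _, _ | .query _ _ _, h, _, _ | .loop _ _, h, _, _ => h.elim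
  | .seq P R, h, μ, v => (big_exec O P h.1 μ v).seq_det (big_exec O R h.2 _ _)
  | .ite t P R, h, μ, v => by
    refine Big.mono (t := max P.size R.size + 1) (Big.ite ?_) (by simp only [Prog.size]; omega)
    by_cases ht : t.eval μ = true
    · simpa [Prog.exec, ht] using (big_exec O P h.1 μ v).mono (le_max_left _ _)
    · simpa [Prog.exec, ht] using (big_exec O R h.2 μ v).mono (le_max_right _ _)

/-! ### Counter-controlled loops -/

/-- Run `body` until the counters `x` and `y` are equal; the counter `z` is used as a flag. -/
def untilEq (z x y : ℕ) (body : Prog Q) : Prog Q :=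
  .seq (.loop (.isZero z) (.ite (.eq x y) (.inc z) body)) (.clear z)

/-- Iteration of a branching process. -/
def iter {α : Type*} (β : α → Multiset α) : ℕ → α → Multiset α
  | 0, p => {p}
  | k + 1, p => (β p).bind (iter β k)

/-- A loop can only run while a test holds and there is no test for inequality, which is why the
flag `z` is needed. `I k` is an invariant for states with exactly `k` rounds left; each round costs
the body and two steps for the loop and the branch. -/
theorem big_untilEq {O : Oracle Q} {z x y t : ℕ} {body : Prog Q}
    (β : Mem × Vec → Multiset (Mem × Vec)) (I : ℕ → Mem × Vec → Prop)
    (hz : ∀ k p, I k p → p.1.ctr z = 0)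
    (h0 : ∀ p, I 0 p → p.1.ctr x = p.1.ctr y)
    (hs : ∀ k p, I (k + 1) p → p.1.ctr x ≠ p.1.ctr y ∧ Big O t body p.1 p.2 (β p) ∧
      ∀ q ∈ β p, I k q) (k : ℕ) (p : Mem × Vec) (hp : I k p) :
    Big O (k * (t + 2) + 6) (untilEq z x y body) p.1 p.2 (iter β k p) := by
  have key : ∀ k p, I k p → Big O (k * (t + 2) + 4) (.loop (.isZero z) (.ite (.eq x y) (.inc z) body))
      p.1 p.2 ((iter β k p).map fun q => (⟨Function.update q.1.ctr z 1, q.1.bit⟩, q.2)) := by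
    intro k
    induction k with
    | zero =>
      intro p hp
      have hz0 := hz 0 p hp
      refine Big.mono (t := 2 + 1 + 1) ?_ (by omega)
      have h1 : Big O 2 (.ite (.eq x y) (.inc z) body) p.1 p.2
          {(⟨Function.update p.1.ctr z 1, p.1.bit⟩, p.2)} := by
        refine Big.ite ?_
        simp only [Test.eval, h0 p hp, decide_true, if_true]
        simpa [Prog.exec, hz0, Prog.size] using big_exec O (.inc z) trivial p.1 p.2
      have h2 := Big.loop (t' := 1) (b := .isZero z) (by simp [Test.eval, hz0]) h1
        (M' := fun q => {q}) (by
          intro q hq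
          obtain rfl := Multiset.mem_singleton.1 hq
          exact big_loop_false (by simp [Test.eval]))
      simpa [iter] using h2
    | succ k ih =>
      intro p hp
      obtain ⟨hne, hb, hI⟩ := hs k p hp
      refine Big.mono (t := (t + 1) + (k * (t + 2) + 4) + 1) ?_ (by ring_nf; omega)
      have h1 : Big O (t + 1) (.ite (.eq x y) (.inc z) body) p.1 p.2 (β p) := by
        refine Big.ite ?_
        simpa [Test.eval, hne] using hb
      have h2 := Big.loop (b := .isZero z) (by simp [Test.eval, hz _ p hp]) h1
        (fun q hq => ih q (hI q hq))
      simpa [iter, Multiset.map_bind] using h2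
  -- Every final state satisfies `I 0`, so its flag was zero before being raised, and clearing the
  -- flag restores the memory exactly.
  have hIall : ∀ k p, I k p → ∀ q ∈ iter β k p, I 0 q := by
    intro k
    induction k with
    | zero => intro p hp q hq; obtain rfl := Multiset.mem_singleton.1 hq; exact hp
    | succ k ih =>
      intro p hp q hq
      obtain ⟨r, hr, hq⟩ := Multiset.mem_bind.1 hq
      exact ih r ((hs k p hp).2.2 r hr) q hq
  have h3 := (key k p hp).seq (R := .clear z) (t' := 1)
    (M' := fun q => {(⟨Function.update q.1.ctr z 0, q.1.bit⟩, q.2)})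
    (fun q _ => big_of_step fun l => by simp [step])
  refine Big.mono (t := k * (t + 2) + 4 + 1 + 1) ?_ (by omega)
  rw [untilEq]
  convert h3 using 1
  rw [Multiset.bind_map]
  refine Eq.trans ?_ (Multiset.bind_congr (m := iter β k p) (f := fun q => {q}) ?_)
  · simp [Multiset.bind_pure]
  · intro q hq
    have hq0 := hz 0 q (hIall k p hp q hq)
    have : Function.update q.1.ctr z 0 = q.1.ctr := by rw [← hq0]; exact Function.update_eq_self _ _
    simp [this]

/-- The case without branching, where the whole computation is a known sequence of states. The
induction runs backwards, over the number of rounds left. -/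
theorem big_untilEq_det {O : Oracle Q} {z x y t : ℕ} {body : Prog Q}
    (st : ℕ → Mem × Vec) (N : ℕ) (hz : ∀ j ≤ N, (st j).1.ctr z = 0)
    (hne : ∀ j < N, (st j).1.ctr x ≠ (st j).1.ctr y) (he : (st N).1.ctr x = (st N).1.ctr y)
    (hb : ∀ j < N, Big O t body (st j).1 (st j).2 {st (j + 1)}) :
    Big O (N * (t + 2) + 6) (untilEq z x y body) (st 0).1 (st 0).2 {st N} := by
  have key : ∀ k ≤ N, Big O (k * (t + 2) + 4) (.loop (.isZero z) (.ite (.eq x y) (.inc z) body))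
      (st (N - k)).1 (st (N - k)).2
      {(⟨Function.update (st N).1.ctr z 1, (st N).1.bit⟩, (st N).2)} := by
    intro k
    induction k with
    | zero =>
      intro _
      have hz0 := hz N le_rfl
      refine Big.mono (t := 2 + 1 + 1) ?_ (by omega)
      have h1 : Big O 2 (.ite (.eq x y) (.inc z) body) (st N).1 (st N).2
          {(⟨Function.update (st N).1.ctr z 1, (st N).1.bit⟩, (st N).2)} := by
        refine Big.ite ?_
        simp only [Test.eval, he, decide_true, if_true]
        simpa [Prog.exec, hz0, Prog.size] using big_exec O (.inc z) trivial (st N).1 (st N).2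
      have h2 := Big.loop (t' := 1) (b := .isZero z) (by simp [Test.eval, hz0]) h1
        (M' := fun q => {q}) (by
          intro q hq
          obtain rfl := Multiset.mem_singleton.1 hq
          exact big_loop_false (by simp [Test.eval]))
      simpa using h2
    | succ k ih =>
      intro hk
      have hlt : N - (k + 1) < N := by omega
      have hsucc : N - (k + 1) + 1 = N - k := by omega
      refine Big.mono (t := (t + 1) + (k * (t + 2) + 4) + 1) ?_ (by ring_nf; omega)
      have h1 : Big O (t + 1) (.ite (.eq x y) (.inc z) body) (st (N - (k + 1))).1
          (st (N - (k + 1))).2 {st (N - k)} := by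
        refine Big.ite ?_
        simpa [Test.eval, hne _ hlt, hsucc] using hb _ hlt
      have h2 := Big.loop (b := .isZero z) (by simp [Test.eval, hz _ hlt.le]) h1
        (M' := fun _ => {(⟨Function.update (st N).1.ctr z 1, (st N).1.bit⟩, (st N).2)})
        (fun q hq => by obtain rfl := Multiset.mem_singleton.1 hq; exact ih (by omega))
      simpa using h2
  have h3 := (key N le_rfl).seq_det (big_exec O (.clear z) trivial _ _)
  simp only [Nat.sub_self] at h3
  refine Big.mono (t := N * (t + 2) + 4 + 1 + 1) ?_ (by omega)
  have : Function.update (st N).1.ctr z 0 = (st N).1.ctr := by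
    rw [← hz N le_rfl]; exact Function.update_eq_self _ _
  simp only [Prog.exec, Function.update_idem, this] at h3
  exact h3

/-! ### Totals of real values over histories -/

/-- All histories of `l` halt within `t` steps, and the values of `g` at the results add up to
`x`. -/
def Val (O : Oracle Q) (t : ℕ) (l : List (Prog Q)) (μ : Mem) (v : Vec) (g : Mem × Vec → ℝ) (x : ℝ) :
    Prop :=
  ∃ M, Ends O t l μ v M ∧ (M.map g).sum = x

theorem Val.mono {O : Oracle Q} {t t' : ℕ} {l : List (Prog Q)} {μ : Mem} {v : Vec}
    {g : Mem × Vec → ℝ} {x : ℝ} (h : Val O t l μ v g x) (ht : t ≤ t') : Val O t' l μ v g x :=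
  let ⟨M, hM, hx⟩ := h
  ⟨M, hM.mono ht, hx⟩

theorem Big.val {O : Oracle Q} {t T : ℕ} {P : Prog Q} {l : List (Prog Q)} {μ : Mem} {v : Vec}
    {M : Multiset (Mem × Vec)} {g x : Mem × Vec → ℝ} (h : Big O t P μ v M)
    (hl : ∀ p ∈ M, Val O T l p.1 p.2 g (x p)) : Val O (t + T) (P :: l) μ v g (M.map x).sum := by
  choose! N hN hx using hl
  refine ⟨M.bind N, h l T N hN, ?_⟩
  rw [Multiset.map_bind, Multiset.sum_bind]
  exact congrArg _ (Multiset.map_congr rfl fun p hp => hx p hp)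

theorem Big.val_det {O : Oracle Q} {t T : ℕ} {P : Prog Q} {l : List (Prog Q)} {μ μ' : Mem}
    {v v' : Vec} {g : Mem × Vec → ℝ} {x : ℝ} (h : Big O t P μ v {(μ', v')})
    (hl : Val O T l μ' v' g x) : Val O (t + T) (P :: l) μ v g x := by
  simpa using h.val (x := fun _ => x) (by simpa using hl)

theorem Val.unique {O : Oracle Q} {t t' : ℕ} {l : List (Prog Q)} {μ : Mem} {v : Vec}
    {g : Mem × Vec → ℝ} {x x' : ℝ} (h : Val O t l μ v g x) (h' : Val O t' l μ v g x') : x = x' := by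
  obtain ⟨M, hM, rfl⟩ := h
  obtain ⟨M', hM', rfl⟩ := h'
  rw [hM.unique hM']

theorem Big.val_map {α : Type*} {O : Oracle Q} {t T : ℕ} {P : Prog Q} {l : List (Prog Q)} {μ : Mem}
    {v : Vec} {A : Multiset α} {f : α → Mem × Vec} {g : Mem × Vec → ℝ} {x : α → ℝ}
    (h : Big O t P μ v (A.map f)) (hl : ∀ a ∈ A, Val O T l (f a).1 (f a).2 g (x a)) :
    Val O (t + T) (P :: l) μ v g (A.map x).sum := by
  have h3 : ∀ p ∈ A.map f, ∃ y, Val O T l p.1 p.2 g y := by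
    intro p hp
    obtain ⟨a, ha, rfl⟩ := Multiset.mem_map.1 hp
    exact ⟨_, hl a ha⟩
  choose! y hy using h3
  have h4 := h.val hy
  rw [Multiset.map_map] at h4
  have h5 : A.map (y ∘ f) = A.map x := Multiset.map_congr rfl fun a ha =>
    (hy (f a) (Multiset.mem_map_of_mem f ha)).unique (hl a ha)
  rwa [h5] at h4

end BigStep

/-! ### Memory and basis maps -/

/-- Set a counter. -/
def Mem.setC (μ : Mem) (x k : ℕ) : Mem := ⟨Function.update μ.ctr x k, μ.bit⟩

/-- Write a string on a classical tape. -/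
def Mem.fill (μ : Mem) (t : ℕ) (w : List Bool) : Mem :=
  ⟨μ.ctr, fun q => if q.1 = t ∧ q.2 < w.length then w.getD q.2 false else μ.bit q⟩

@[simp] theorem Mem.setC_ctr (μ : Mem) (x k : ℕ) :
    (μ.setC x k).ctr = Function.update μ.ctr x k := rfl

@[simp] theorem Mem.setC_bit (μ : Mem) (x k : ℕ) : (μ.setC x k).bit = μ.bit := rfl

@[simp] theorem Mem.fill_ctr (μ : Mem) (t : ℕ) (w : List Bool) : (μ.fill t w).ctr = μ.ctr := rfl

theorem Mem.fill_bit (μ : Mem) (t : ℕ) (w : List Bool) (q : Cell) : (μ.fill t w).bit q =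
    if q.1 = t ∧ q.2 < w.length then w.getD q.2 false else μ.bit q := rfl

@[ext] theorem Mem.ext' {μ ν : Mem} (h : ∀ x, μ.ctr x = ν.ctr x) (h' : ∀ q, μ.bit q = ν.bit q) :
    μ = ν := by
  cases μ; cases ν
  congr
  · exact funext h
  · exact funext h'

theorem Mem.setC_self (μ : Mem) (x : ℕ) {k : ℕ} (h : μ.ctr x = k) : μ.setC x k = μ := by
  subst h; ext <;> simp [Mem.setC]

@[simp] theorem Mem.setC_setC (μ : Mem) (x k l : ℕ) : (μ.setC x k).setC x l = μ.setC x l := by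
  simp [Mem.setC]

theorem Mem.fill_nil (μ : Mem) (t : ℕ) : μ.fill t [] = μ := by
  ext <;> simp [Mem.fill]

theorem Mem.fill_snoc (μ : Mem) (t : ℕ) (w : List Bool) (b : Bool) :
    μ.fill t (w ++ [b]) = ⟨μ.ctr, Function.update (μ.fill t w).bit (t, w.length) b⟩ := by
  ext q
  · rfl
  · obtain ⟨q1, q2⟩ := q
    simp only [Mem.fill, Function.update_apply, Prod.mk.injEq, List.length_append,
      List.length_singleton]
    rcases lt_trichotomy q2 w.length with h | h | h
    · simp [List.getD_eq_getElem?_getD, h, h.ne, h.trans (Nat.lt_succ_self _)]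
    · subst h
      by_cases h1 : q1 = t <;> simp [h1]
    · have h2 : ¬ q2 < w.length + 1 := by omega
      have h3 : ¬ q2 < w.length := by omega
      simp [h2, h3, h.ne']

/-- The linear map induced by a map of basis states. -/
noncomputable def bmap (f : Basis → Basis) : Vec →ₗ[ℂ] Vec := Finsupp.lmapDomain ℂ ℂ f

theorem bmap_bmap (f g : Basis → Basis) (v : Vec) : bmap f (bmap g v) = bmap (f ∘ g) v := by
  simp [bmap, Finsupp.mapDomain_comp]

/-- Only basis states in the support matter. Through this the assumption that scratch qubits are
zero enters the correctness of the subroutines. -/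
theorem bmap_congr {f g : Basis → Basis} {v : Vec} (h : ∀ e ∈ v.support, f e = g e) :
    bmap f v = bmap g v := Finsupp.mapDomain_congr h

theorem bmap_id (v : Vec) : bmap (fun e => e) v = v := Finsupp.mapDomain_id

theorem bmap_eq_self {f : Basis → Basis} {v : Vec} (h : ∀ e ∈ v.support, f e = e) :
    bmap f v = v := (bmap_congr h).trans (bmap_id v)

/-- The basis map of `xorOracle`. -/
def xorFn {a b : ℕ} (F : Bits a → Bits b) (r s : ℕ) (e : Basis) : Basis := fun q =>
  if h : r ≠ s ∧ q.1 = s ∧ q.2 < b then xor (e q) (F (fun j => e (r, j)) ⟨q.2, h.2.2⟩) else e q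

theorem xorOracle_eq {a b : ℕ} (F : Bits a → Bits b) (r s : ℕ) :
    xorOracle F r s = bmap (xorFn F r s) := rfl

/-- The basis map of `flipGate`. -/
def flipFn (cs : List Cell) (q : Cell) (e : Basis) : Basis :=
  open Classical in
  if q ∉ cs ∧ (∀ c ∈ cs, e c = true) then Function.update e q (!(e q)) else e

theorem flipGate_eq (cs : List Cell) (q : Cell) : flipGate cs q = bmap (flipFn cs q) := by
  unfold flipGate bmap flipFn
  congr 1

theorem flipFn_nil (q : Cell) (e : Basis) : flipFn [] q e = Function.update e q (!(e q)) := by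
  simp [flipFn]

theorem flipFn_one {c q : Cell} (h : q ≠ c) (e : Basis) :
    flipFn [c] q e = Function.update e q (xor (e q) (e c)) := by
  cases hc : e c <;> simp [flipFn, h, hc]

/-! ### Coins -/

/-- All bit strings of length `k`. -/
def coinLists : ℕ → Multiset (List Bool)
  | 0 => {[]}
  | k + 1 => (Finset.univ : Finset Bool).val.bind fun b => (coinLists k).map (b :: ·)

theorem length_of_mem_coinLists : ∀ {k : ℕ} {l : List Bool}, l ∈ coinLists k → l.length = k
  | 0, l, h => by simp [coinLists] at h; simp [h]
  | k + 1, l, h => by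
    simp only [coinLists, Multiset.mem_bind, Multiset.mem_map] at h
    obtain ⟨b, -, l', hl', rfl⟩ := h
    simp [length_of_mem_coinLists hl']

theorem coinLists_eq (k : ℕ) :
    coinLists k = (Finset.univ : Finset (Bits k)).val.map fun u => List.ofFn u := by
  induction k with
  | zero => rfl
  | succ k ih =>
    have h : (Finset.univ : Finset (Bits (k + 1))) =
        (Finset.univ : Finset (Bool × Bits k)).map (Fin.consEquiv fun _ : Fin (k + 1) => Bool).toEmbedding := by
      simp
    rw [coinLists, ih, h, Finset.map_val, Multiset.map_map, ← Finset.univ_product_univ,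
      Finset.product_val]
    simp only [SProd.sprod, Multiset.product, Multiset.map_bind, Multiset.map_map]
    refine Multiset.bind_congr fun b _ => Multiset.map_congr rfl fun u _ => ?_
    simp [List.ofFn_succ, Fin.consEquiv]

/-- Projection to a measurement outcome, as a linear map. -/
noncomputable def projectL (q : Cell) (b : Bool) : Vec →ₗ[ℂ] Vec where
  toFun := project q b
  map_add' _ _ := Finsupp.filter_add
  map_smul' _ _ := Finsupp.filter_smul

/-- The state after a Hadamard gate on qubit `q`, measured as `b` and reset. -/
noncomputable def coinVec (q : Cell) (v : Vec) (b : Bool) : Vec :=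
  if b then flipGate [] q (project q b (hGate q v)) else project q b (hGate q v)

/-- A Hadamard gate turns a qubit in state zero into an equal superposition, so both outcomes leave
the same state, up to the reset, with amplitude `1/√2`. The map is linear, hence basis states
suffice. -/
theorem coinVec_eq (q : Cell) (b : Bool) {v : Vec} (hv : ∀ e ∈ v.support, e q = false) :
    coinVec q v b = (((Real.sqrt 2)⁻¹ : ℝ) : ℂ) • v := by
  have hv' : v = v.sum fun e a => Finsupp.single e a := v.sum_single.symm
  have key : ∀ e : Basis, e q = false → ∀ a : ℂ, coinVec q (Finsupp.single e a) b =
      (((Real.sqrt 2)⁻¹ : ℝ) : ℂ) • Finsupp.single e a := by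
    intro e he a
    have hu : Function.update e q false = e := by rw [← he]; exact Function.update_eq_self _ _
    have hH : hGate q (Finsupp.single e a) =
        Finsupp.single e (a * (((Real.sqrt 2)⁻¹ : ℝ) : ℂ)) +
          Finsupp.single (Function.update e q true) (a * (((Real.sqrt 2)⁻¹ : ℝ) : ℂ)) := by
      rw [hGate, Finsupp.linearCombination_single, hu, he, smul_add, Finsupp.smul_single,
        Finsupp.smul_single]
      simp only [smul_eq_mul, Bool.false_eq_true, if_false, one_mul]
    rw [Finsupp.smul_single, smul_eq_mul, mul_comm]
    cases b
    · rw [coinVec, hH, project, Finsupp.filter_add, Finsupp.filter_single_of_pos (fun e : Basis => e q = false) he,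
        Finsupp.filter_single_of_neg (fun e : Basis => e q = false) (by simp)]
      simp
    · rw [coinVec, hH, project, Finsupp.filter_add, Finsupp.filter_single_of_neg (fun e : Basis => e q = true) (by simp [he]),
        Finsupp.filter_single_of_pos (fun e : Basis => e q = true) (by simp), flipGate_eq, zero_add, bmap,
        Finsupp.lmapDomain_apply, Finsupp.mapDomain_single, flipFn_nil]
      simp [hu]
  have hl : ∀ w : Vec, coinVec q w b = ((if b then flipGate [] q else LinearMap.id).comp
      ((projectL q b).comp (hGate q))) w := by
    intro w; cases b <;> rfl
  conv_lhs => rw [hv', hl, Finsupp.sum, map_sum]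
  conv_rhs => rw [hv', Finsupp.sum, Finset.smul_sum]
  exact Finset.sum_congr rfl fun e he => by rw [← hl, key e (hv e he)]

/-- The state after the coin tosses `l` on qubit `q`. -/
noncomputable def coinsVec (q : Cell) (l : List Bool) (v : Vec) : Vec := l.foldl (coinVec q) v

theorem coinsVec_eq (q : Cell) (l : List Bool) {v : Vec} (hv : ∀ e ∈ v.support, e q = false) :
    coinsVec q l v = (((Real.sqrt 2)⁻¹ ^ l.length : ℝ) : ℂ) • v := by
  induction l generalizing v with
  | nil => simp [coinsVec]
  | cons b l ih =>
    have h := ih (v := coinVec q v b) (by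
      rw [coinVec_eq q b hv]
      exact fun e he => hv e (Finsupp.support_smul he))
    rw [coinsVec, List.foldl_cons, ← coinsVec, h, coinVec_eq q b hv, smul_smul, List.length_cons,
      pow_succ]
    push_cast
    rfl

/-- Toss coins, with the help of qubit `0` of tape `B + 2`, and write them on the first cells of the
classical tape `R`. Their number is in counter `N`. -/
def coin (B R N : ℕ) : Prog Unit :=
  .seq (untilEq (B + 1) (B + 2) N
    (.seq (.hadamard ⟨B + 2, B + 1⟩) (.seq (.measure ⟨B + 2, B + 1⟩ ⟨R, B + 2⟩)
      (.seq (.ite (.bit ⟨R, B + 2⟩) (.flip [] ⟨B + 2, B + 1⟩) .skip) (.inc (B + 2))))))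
    (.clear (B + 2))

/-- The counter `B + 1` is both the flag of the loop and the head of the coin qubit: it is zero
whenever the body runs, so the qubit used is cell `0`. The state stays symbolic, without assuming
that this qubit is blank, because halting has to be shown for arbitrary oracles. -/
theorem big_coin (O : Oracle Unit) (B R N : ℕ) (μ : Mem) (v : Vec) (hz : μ.ctr (B + 1) = 0)
    (hi : μ.ctr (B + 2) = 0) (hN : N ≠ B + 2) :
    Big O (μ.ctr N * 20 + 20) (coin B R N) μ v
      ((coinLists (μ.ctr N)).map fun l => (μ.fill R l, coinsVec (B + 2, 0) l v)) := by
  set st : List Bool → Mem := fun l => (μ.fill R l).setC (B + 2) l.length with hst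
  set β : Mem × Vec → Multiset (Mem × Vec) := fun p => (Finset.univ : Finset Bool).val.map fun b =>
    (⟨Function.update p.1.ctr (B + 2) (p.1.ctr (B + 2) + 1),
      Function.update p.1.bit (R, p.1.ctr (B + 2)) b⟩, coinVec (B + 2, 0) p.2 b) with hβ
  have hβst : ∀ l v, β (st l, v) = (Finset.univ : Finset Bool).val.map fun b =>
      (st (l ++ [b]), coinVec (B + 2, 0) v b) := by
    intro l v
    refine Multiset.map_congr rfl fun b _ => ?_
    simp [hst, Mem.fill_snoc, Mem.setC]
  -- After the outcomes `l`, the remaining `k` tosses append every list of length `k` exactly once.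
  have hiter : ∀ k l v, iter β k (st l, v) =
      (coinLists k).map fun l' => (st (l ++ l'), coinsVec (B + 2, 0) l' v) := by
    intro k
    induction k with
    | zero => intro l v; simp [iter, coinLists, coinsVec]
    | succ k ih =>
      intro l v
      rw [iter, hβst, Multiset.bind_map, coinLists, Multiset.map_bind]
      refine Multiset.bind_congr fun b _ => ?_
      rw [ih, Multiset.map_map]
      refine Multiset.map_congr rfl fun l' _ => ?_
      simp [coinsVec]
  have hbody : ∀ l v, Big O 10
      (.seq (.hadamard ⟨B + 2, B + 1⟩) (.seq (.measure ⟨B + 2, B + 1⟩ ⟨R, B + 2⟩)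
      (.seq (.ite (.bit ⟨R, B + 2⟩) (.flip [] ⟨B + 2, B + 1⟩) .skip) (.inc (B + 2)))))
      (st l) v (β (st l, v)) := by
    intro l v
    have h1 := big_exec O (.hadamard ⟨B + 2, B + 1⟩) trivial (st l) v
    have h2 := fun w => (big_measure O ⟨B + 2, B + 1⟩ ⟨R, B + 2⟩ (st l) w).seq
      (R := .seq (.ite (.bit ⟨R, B + 2⟩) (.flip [] ⟨B + 2, B + 1⟩) .skip) (.inc (B + 2)))
      (fun p _ => big_exec O (.seq (.ite (.bit ⟨R, B + 2⟩) (.flip [] ⟨B + 2, B + 1⟩) .skip)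
        (.inc (B + 2))) ⟨⟨trivial, trivial⟩, trivial⟩ p.1 p.2)
    have h := (h1.seq_det (h2 _)).mono (t' := 10) (by simp [Prog.size])
    convert h using 1
    rw [Multiset.bind_map, Multiset.bind_singleton]
    refine Multiset.map_congr rfl fun b _ => ?_
    have hz' : (st l).ctr (B + 1) = 0 := by simp [hst, hz]
    cases b <;> simp [Prog.exec, Test.eval, Addr.cell, coinVec, hz']
  have h := big_untilEq (O := O) (z := B + 1) (x := B + 2) (y := N) (t := 10) β
    (fun k p => ∃ l v, p = (st l, v) ∧ l.length + k = μ.ctr N)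
    (by rintro k p ⟨l, v, rfl, -⟩; simp [hst, hz])
    (by rintro p ⟨l, v, rfl, hl⟩; simp [hst, hN]; omega)
    (by
      rintro k p ⟨l, v, rfl, hl⟩
      refine ⟨by simp [hst, hN]; omega, hbody l v, ?_⟩
      rw [hβst]
      intro q hq
      obtain ⟨b, -, rfl⟩ := Multiset.mem_map.1 hq
      exact ⟨_, _, rfl, by simp; omega⟩)
    (μ.ctr N) (st [], v) ⟨[], v, rfl, by simp⟩
  have hst0 : st [] = μ := by
    rw [hst]; simp only [Mem.fill_nil, List.length_nil]; exact Mem.setC_self _ _ hi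
  rw [hiter, hst0] at h
  have h' := h.seq (R := .clear (B + 2)) (fun p _ => big_exec O (.clear (B + 2)) trivial p.1 p.2)
  have h := h'.mono (t' := μ.ctr N * 20 + 20) (by simp [Prog.size]; omega)
  rw [coin]
  convert h using 1
  rw [Multiset.bind_map, Multiset.bind_singleton]
  refine Multiset.map_congr rfl fun l _ => ?_
  simp only [Prog.exec, Prod.mk.injEq, and_true, List.nil_append]
  ext x
  · by_cases hx : x = B + 2 <;> simp [hst, hx, hi]
  · rfl

/-! ### Simulation of the encryption and decryption oracles

Scratch registers: counter `B` holds `n`; counters `B + 1`, `B + 2`, `B + 3` and the cells of tape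
`B + 1` are zero between the subroutines. -/

/-- Memories in which the scratch counters of the subroutines are ready for use. -/
structure Counters (B n : ℕ) (μ : Mem) : Prop where
  len : μ.ctr B = n
  z : μ.ctr (B + 1) = 0
  i : μ.ctr (B + 2) = 0
  j : μ.ctr (B + 3) = 0

/-- Memories in which the scratch registers of the subroutines are ready for use. -/
structure Ready (B n : ℕ) (μ : Mem) : Prop extends Counters B n μ where
  blank : ∀ k, μ.bit (B + 1, k) = false

/-- For `i` from `0` to `n - 1`. -/
def forLoop (B : ℕ) (body : Prog Unit) : Prog Unit :=
  .seq (untilEq (B + 1) (B + 2) B (.seq body (.inc (B + 2)))) (.clear (B + 2))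

/-- `ν k` is the memory after `k` rounds with the loop counter set back to zero, so that `ν` only
records the effect of the body; the true value `k` of the counter is put in by `setC`. -/
theorem big_forLoop {O : Oracle Unit} {B t : ℕ} {body : Prog Unit} (ν : ℕ → Mem) (w : ℕ → Vec)
    (n : ℕ) (hn : ∀ k, (ν k).ctr B = n) (hz : ∀ k, (ν k).ctr (B + 1) = 0)
    (hi : ∀ k, (ν k).ctr (B + 2) = 0)
    (hb : ∀ k < n, Big O t body ((ν k).setC (B + 2) k) (w k)
      {((ν (k + 1)).setC (B + 2) k, w (k + 1))}) :
    Big O (n * (t + 4) + 8) (forLoop B body) (ν 0) (w 0) {(ν n, w n)} := by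
  have h := big_untilEq_det (O := O) (z := B + 1) (x := B + 2) (y := B) (t := t + 2)
    (body := .seq body (.inc (B + 2))) (fun k => ((ν k).setC (B + 2) k, w k)) n
    (by intro j _; simp [hz]) (by intro j hj; simp [hn]; omega) (by simp [hn])
    (by
      intro k hk
      have h2 := (hb k hk).seq_det (big_exec O (.inc (B + 2)) trivial _ _)
      exact h2.to (by simp [Prog.size]) (by simp [Prog.exec, Mem.setC]))
  have h0 : (ν 0).setC (B + 2) 0 = ν 0 := Mem.setC_self _ _ (hi 0)
  simp only [h0] at h
  have h3 := h.seq_det (big_exec O (.clear (B + 2)) trivial _ _)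
  refine Big.mono (t := n * (t + 2 + 2) + 6 + 1 + 1) ?_ (by ring_nf; omega)
  have h4 : Prog.exec (Q := Unit) (.clear (B + 2)) ((ν n).setC (B + 2) n, w n) = (ν n, w n) := by
    have : (⟨Function.update (Function.update (ν n).ctr (B + 2) n) (B + 2) 0, (ν n).bit⟩ : Mem) =
        (ν n).setC (B + 2) 0 := by simp [Mem.setC]
    simp only [Prog.exec, Mem.setC_ctr, Mem.setC_bit, this, Mem.setC_self _ _ (hi n)]
  rw [h4] at h3
  exact h3

/-- Add the first `n` classical bits on tape `R` to the first qubits on tape `B + 2`. -/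
def load (B R : ℕ) : Prog Unit :=
  forLoop B (.ite (.bit ⟨R, B + 2⟩) (.flip [] ⟨B + 2, B + 2⟩) .skip)

/-- The basis map of `load`. -/
def loadFn (X : ℕ) (u : ℕ → Bool) (n : ℕ) (e : Basis) : Basis := fun q =>
  if q.1 = X ∧ q.2 < n then xor (e q) (u q.2) else e q

theorem loadFn_zero (X : ℕ) (u : ℕ → Bool) : loadFn X u 0 = fun e => e := by
  funext e q; simp [loadFn]

theorem big_load (O : Oracle Unit) (B R n : ℕ) (μ : Mem) (v : Vec) (hn : μ.ctr B = n)
    (hz : μ.ctr (B + 1) = 0) (hi : μ.ctr (B + 2) = 0) :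
    Big O (n * 20 + 20) (load B R) μ v
      {(μ, bmap (loadFn (B + 2) (fun i => μ.bit (R, i)) n) v)} := by
  have h := big_forLoop (O := O) (B := B) (t := 4)
    (body := .ite (.bit ⟨R, B + 2⟩) (.flip [] ⟨B + 2, B + 2⟩) .skip) (fun _ => μ)
    (fun k => bmap (loadFn (B + 2) (fun i => μ.bit (R, i)) k) v) n (fun _ => hn) (fun _ => hz)
    (fun _ => hi) (by
      intro k _
      refine (big_exec O (.ite (.bit ⟨R, B + 2⟩) (.flip [] ⟨B + 2, B + 2⟩) .skip)
        ⟨trivial, trivial⟩ (μ.setC (B + 2) k)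
        (bmap (loadFn (B + 2) (fun i => μ.bit (R, i)) k) v)).to (by simp [Prog.size]) ?_
      by_cases hb : μ.bit (R, k) = true
      · simp only [Prog.exec, Test.eval, Addr.cell, Mem.setC_bit, Mem.setC_ctr,
          Function.update_self, hb, if_true, List.map_nil, flipGate_eq, bmap_bmap, Prod.mk.injEq,
          true_and]
        refine bmap_congr fun e _ => ?_
        rw [Function.comp, flipFn_nil]
        funext q
        obtain ⟨q1, q2⟩ := q
        simp only [loadFn, Function.update_apply, Prod.mk.injEq]
        by_cases h1 : q1 = B + 2
        · rcases lt_trichotomy q2 k with h2 | h2 | h2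
          · simp [h1, h2.ne, h2, h2.trans (Nat.lt_succ_self k)]
          · simp [h1, h2, hb]
          · have : ¬ q2 < k + 1 := by omega
            simp [h1, h2.ne', this, h2.not_gt]
        · simp [h1]
      · simp only [Prog.exec, Test.eval, Addr.cell, Mem.setC_bit, Mem.setC_ctr,
          Function.update_self, hb, Bool.false_eq_true, if_false, Prod.mk.injEq, true_and]
        refine bmap_congr fun e _ => ?_
        funext q
        obtain ⟨q1, q2⟩ := q
        simp only [loadFn]
        by_cases h1 : q1 = B + 2
        · rcases lt_trichotomy q2 k with h2 | h2 | h2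
          · simp [h1, h2, h2.trans (Nat.lt_succ_self k)]
          · simp [h1, h2, hb]
          · have : ¬ q2 < k + 1 := by omega
            simp [h1, this, h2.not_gt]
        · simp [h1])
  simp only [loadFn_zero, bmap_id] at h
  exact h.mono (by omega)

/-- Erase the first `n` classical bits on tape `B + 1`. -/
def erase (B : ℕ) : Prog Unit := forLoop B (.write ⟨B + 1, B + 2⟩ false)

/-- Subroutines must return the classical memory exactly as they found it, so the tossed coins have
to be removed. As tape `B + 1` was blank, writing zeros achieves this. -/
theorem big_erase (O : Oracle Unit) (B n : ℕ) (μ : Mem) (v : Vec) (l : List Bool)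
    (h : Ready B n μ) (hl : l.length = n) :
    Big O (n * 20 + 20) (erase B) (μ.fill (B + 1) l) v {(μ, v)} := by
  have hl2 := h.blank
  have h := big_forLoop (O := O) (B := B) (t := 1) (body := .write ⟨B + 1, B + 2⟩ false)
    (fun k => ⟨μ.ctr, fun q => if q.1 = B + 1 ∧ q.2 < k then false else (μ.fill (B + 1) l).bit q⟩)
    (fun k => v) n (fun _ => h.len) (fun _ => h.z)
    (fun _ => h.i) (by
      intro k _
      refine (big_exec O (.write ⟨B + 1, B + 2⟩ false) trivial
        (Mem.setC ⟨μ.ctr, fun q => if q.1 = B + 1 ∧ q.2 < k then false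
          else (μ.fill (B + 1) l).bit q⟩ (B + 2) k) v).to le_rfl ?_
      simp only [Prog.exec, Prod.mk.injEq, and_true]
      ext q
      · rfl
      · obtain ⟨q1, q2⟩ := q
        simp only [Mem.setC_bit, Addr.cell, Mem.setC_ctr, Function.update_self,
          Function.update_apply, Prod.mk.injEq]
        grind)
  have e0 : (⟨μ.ctr, fun q => if q.1 = B + 1 ∧ q.2 < 0 then false
      else (μ.fill (B + 1) l).bit q⟩ : Mem) = μ.fill (B + 1) l := by simp [Mem.fill]
  simp only [e0] at h
  refine h.to (by omega) ?_
  simp only [Prod.mk.injEq, and_true]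
  ext q
  · rfl
  · obtain ⟨q1, q2⟩ := q
    simp only [Mem.fill_bit, hl]
    by_cases h1 : q1 = B + 1
    · subst h1; by_cases h2 : q2 < n <;> simp [hl2, h2]
    · simp [h1]

/-- Add the coins on tape `B + 2` and the ciphertext, computed from the pad on tape `B + 3` and the
plaintext on tape `r`, to the qubits on tape `s`. -/
def encXor (B r s : ℕ) : Prog Unit :=
  .seq (.copy (B + 3) B) (.seq (forLoop B
    (.seq (.flip [⟨B + 2, B + 2⟩] ⟨s, B + 2⟩) (.seq (.flip [⟨B + 3, B + 2⟩] ⟨s, B + 3⟩)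
      (.seq (.flip [⟨r, B + 2⟩] ⟨s, B + 3⟩) (.inc (B + 3)))))) (.clear (B + 3)))

/-- The basis map of `encXor`. -/
def encXorFn (B r s n k : ℕ) (e : Basis) : Basis := fun q =>
  if q.1 = s ∧ q.2 < k then xor (e q) (e (B + 2, q.2))
  else if q.1 = s ∧ n ≤ q.2 ∧ q.2 < n + k then
    xor (xor (e q) (e (B + 3, q.2 - n))) (e (r, q.2 - n))
  else e q

/-- Round `i` treats the cells `i` and `n + i` of tape `s`; the counter `B + 3`, started at `n`, is
the head for the second half. The conditions on `s` ensure that no control qubit lies on the target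
tape. -/
theorem big_encXor (O : Oracle Unit) (B r s n : ℕ) (hs : s < B) (hrs : r ≠ s) (μ : Mem)
    (v : Vec) (h : Counters B n μ) :
    Big O (n * 20 + 20) (encXor B r s) μ v {(μ, bmap (encXorFn B r s n n) v)} := by
  have h1 := big_exec O (.copy (B + 3) B) trivial μ v
  have h2 := big_forLoop (O := O) (B := B) (t := 7)
    (body := .seq (.flip [⟨B + 2, B + 2⟩] ⟨s, B + 2⟩) (.seq (.flip [⟨B + 3, B + 2⟩] ⟨s, B + 3⟩)
      (.seq (.flip [⟨r, B + 2⟩] ⟨s, B + 3⟩) (.inc (B + 3)))))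
    (fun k => μ.setC (B + 3) (n + k)) (fun k => bmap (encXorFn B r s n k) v) n
    (by simp [h.len]) (by simp [h.z]) (by simp [h.i])
    (by
      intro k hk
      refine (big_exec O (.seq (.flip [⟨B + 2, B + 2⟩] ⟨s, B + 2⟩)
        (.seq (.flip [⟨B + 3, B + 2⟩] ⟨s, B + 3⟩)
          (.seq (.flip [⟨r, B + 2⟩] ⟨s, B + 3⟩) (.inc (B + 3)))))
        ⟨trivial, trivial, trivial, trivial⟩ ((μ.setC (B + 3) (n + k)).setC (B + 2) k)
        (bmap (encXorFn B r s n k) v)).to (by simp [Prog.size]) ?_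
      simp only [Prog.exec, Prod.mk.injEq]
      constructor
      · ext x
        · simp only [Mem.setC_ctr, Function.update_apply]; grind
        · rfl
      · have e1 : (((μ.setC (B + 3) (n + k)).setC (B + 2) k).ctr (B + 2)) = k := by simp
        have e2 : (((μ.setC (B + 3) (n + k)).setC (B + 2) k).ctr (B + 3)) = n + k := by simp
        simp only [Addr.cell, List.map_cons, List.map_nil, e1, e2, flipGate_eq, bmap_bmap]
        refine bmap_congr fun e _ => ?_
        simp only [Function.comp]
        rw [flipFn_one (by simp; omega), flipFn_one (by simp; omega), flipFn_one (by simp; omega)]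
        funext q
        obtain ⟨q1, q2⟩ := q
        have a1 : B + 2 ≠ s := by omega
        have a2 : B + 3 ≠ s := by omega
        simp only [encXorFn, Function.update_apply, Prod.mk.injEq, a1, a2, hrs, false_and, if_false]
        by_cases h1 : q1 = s
        · by_cases h2 : q2 = k
          · subst h2
            have : ¬ n ≤ q2 := by omega
            have h3 : q2 ≠ n + q2 := by omega
            have h4 : n ≠ 0 := by omega
            simp [h1, this, h4]
          · by_cases h3 : q2 = n + k
            · have h4 : ¬ n + k < k + 1 := by omega
              have h5 : ¬ n + k < k := by omega
              have h6 : n ≠ 0 := by omega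
              simp [h1, h3, h4, h5, h6]
            · have h4 : q2 < k + 1 ↔ q2 < k := by omega
              have h5 : q2 < n + (k + 1) ↔ q2 < n + k := by omega
              simp [h1, h2, h3, h4, h5]
        · simp [h1])
  have h0 : encXorFn B r s n 0 = fun e => e := by
    funext e q
    simp [encXorFn]
  simp only [h0, bmap_id] at h2
  have h3 : Prog.exec (Q := Unit) (.copy (B + 3) B) (μ, v) = (μ.setC (B + 3) (n + 0), v) := by
    simp [Prog.exec, Mem.setC, h.len]
  rw [h3] at h1
  refine (h1.seq_det (h2.seq_det (big_exec O (.clear (B + 3)) trivial _ _))).to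
    (by simp [Prog.size]; omega) ?_
  have : (μ.setC (B + 3) (n + n)).setC (B + 3) 0 = μ := by
    rw [Mem.setC_setC, Mem.setC_self _ _ h.j]
  simp only [Prog.exec, Prod.mk.injEq, and_true]
  exact this

/-- The encryption oracle on tapes `r` and `s`, with the help of an oracle for the function. -/
def encSub (B r s : ℕ) : Prog Unit :=
  .seq (coin B (B + 1) B) (.seq (load B (B + 1)) (.seq (.query () (B + 2) (B + 3))
    (.seq (if r = s then .skip else encXor B r s) (.seq (.query () (B + 2) (B + 3))
      (.seq (load B (B + 1)) (erase B))))))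

/-- The basis map of `load` for the string `l`. -/
noncomputable def loadVec (B : ℕ) (l : List Bool) (v : Vec) : Vec :=
  bmap (loadFn (B + 2) (fun i => l.getD i false) l.length) v

/-- The effect of `encSub`, for any oracle. -/
noncomputable def encSem (O : Oracle Unit) (B n r s : ℕ) (v : Vec) : Multiset Vec :=
  (coinLists n).bind fun l =>
    (O () (B + 2) (B + 3) (loadVec B l (coinsVec (B + 2, 0) l v))).bind fun w =>
      (O () (B + 2) (B + 3) (if r = s then w else bmap (encXorFn B r s n n) w)).map (loadVec B l)

theorem big_load_fill (O : Oracle Unit) (B n R : ℕ) (μ : Mem) (v : Vec) (l : List Bool)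
    (hl : l.length = n) (hn : μ.ctr B = n) (hz : μ.ctr (B + 1) = 0) (hi : μ.ctr (B + 2) = 0) :
    Big O (n * 20 + 20) (load B R) (μ.fill R l) v {(μ.fill R l, loadVec B l v)} := by
  refine (big_load O B R n (μ.fill R l) v hn hz hi).to le_rfl ?_
  simp only [Prod.mk.injEq, true_and, loadVec]
  refine bmap_congr fun e _ => ?_
  funext q
  simp only [loadFn, hl]
  split_ifs with h
  · simp [Mem.fill_bit, hl, h.2]
  · rfl

theorem Big.query_seq {O : Oracle Unit} {r s t : ℕ} {P : Prog Unit} {μ : Mem} {v : Vec}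
    {M : Vec → Multiset (Mem × Vec)} (h : ∀ w, Big O t P μ w (M w)) :
    Big O (t + 2) (.seq (.query () r s) P) μ v ((O () r s v).bind M) := by
  have := (big_query O () r s μ v).seq (R := P) (t' := t) (M' := fun p => M p.2) (by
    intro p hp
    obtain ⟨w, -, rfl⟩ := Multiset.mem_map.1 hp
    exact h w)
  rw [Multiset.bind_map] at this
  exact this.mono (by omega)

/-- Compute, use, uncompute: the second query and the second `load` undo the first ones when the
oracle is a function. For `r = s` the encryption oracle acts trivially, but the coins are still
tossed, so that the histories match one by one. Nothing is assumed about the oracle or the state. -/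
theorem big_encSub (O : Oracle Unit) (B n r s : ℕ) (hs : s < B) (μ : Mem) (v : Vec)
    (h : Ready B n μ) :
    Big O (n * 100 + 120) (encSub B r s) μ v ((encSem O B n r s v).map fun w => (μ, w)) := by
  have h1 := big_coin O B (B + 1) B μ v h.z h.i (by omega)
  rw [h.len] at h1
  have hx : ∀ (l : List Bool) (w : Vec), l.length = n → Big O (n * 20 + 20)
      (if r = s then .skip else encXor B r s) (μ.fill (B + 1) l) w
      {(μ.fill (B + 1) l, if r = s then w else bmap (encXorFn B r s n n) w)} := by
    intro l w hl
    by_cases hrs : r = s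
    · simp only [hrs, if_true]
      exact (big_exec O .skip trivial _ _).mono (by simp [Prog.size])
    · simp only [hrs, if_false]
      exact big_encXor O B r s n hs hrs (μ.fill (B + 1) l) w ⟨h.len, h.z, h.i, h.j⟩
  have hq : ∀ l : List Bool, l.length = n → ∀ w, Big O (n * 40 + 50)
      (.seq (load B (B + 1)) (erase B)) (μ.fill (B + 1) l) w {(μ, loadVec B l w)} := fun l hl w =>
    ((big_load_fill O B n (B + 1) μ w l hl h.len h.z h.i).seq_det
      (big_erase O B n μ _ l h hl)).mono (by omega)
  have h2 : ∀ l ∈ coinLists n, _ := fun l hl =>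
    (big_load_fill O B n (B + 1) μ (coinsVec (B + 2, 0) l v) l (length_of_mem_coinLists hl) h.len
      h.z h.i).seq_det (Big.query_seq (O := O) (r := B + 2) (s := B + 3) fun w =>
        (hx l w (length_of_mem_coinLists hl)).seq_det
          (Big.query_seq (O := O) (r := B + 2) (s := B + 3) fun w' =>
            hq l (length_of_mem_coinLists hl) w'))
  have h3 := (h1.seq_map h2).mono (t' := n * 100 + 120) (by omega)
  have h4 : (encSem O B n r s v).map (fun w => (μ, w)) = (coinLists n).bind fun l =>
      (O () (B + 2) (B + 3) (loadVec B l (coinsVec (B + 2, 0) l v))).bind fun w =>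
      (O () (B + 2) (B + 3) (if r = s then w else bmap (encXorFn B r s n n) w)).bind fun w' =>
        {(μ, loadVec B l w')} := by
    simp only [encSem, Multiset.map_bind, Multiset.map_map, Multiset.bind_singleton,
      Function.comp_def]
  rw [h4]
  exact h3

/-! ### The decryption subroutine -/

/-- Add the second half of the ciphertext on tape `r` to the qubits on tape `s`. -/
def decXor (B r s : ℕ) : Prog Unit :=
  .seq (.copy (B + 3) B) (.seq (forLoop B
    (.seq (.flip [⟨r, B + 3⟩] ⟨s, B + 2⟩) (.inc (B + 3)))) (.clear (B + 3)))

/-- The basis map of `decXor`. -/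
def decXorFn (r s n k : ℕ) (e : Basis) : Basis := fun q =>
  if q.1 = s ∧ q.2 < k then xor (e q) (e (r, n + q.2)) else e q

theorem big_decXor (O : Oracle Unit) (B r s n : ℕ) (hrs : r ≠ s) (μ : Mem)
    (v : Vec) (h : Counters B n μ) :
    Big O (n * 20 + 20) (decXor B r s) μ v {(μ, bmap (decXorFn r s n n) v)} := by
  have h1 := big_exec O (.copy (B + 3) B) trivial μ v
  have h2 := big_forLoop (O := O) (B := B) (t := 3)
    (body := .seq (.flip [⟨r, B + 3⟩] ⟨s, B + 2⟩) (.inc (B + 3)))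
    (fun k => μ.setC (B + 3) (n + k)) (fun k => bmap (decXorFn r s n k) v) n
    (by simp [h.len]) (by simp [h.z]) (by simp [h.i])
    (by
      intro k hk
      refine (big_exec O (.seq (.flip [⟨r, B + 3⟩] ⟨s, B + 2⟩) (.inc (B + 3)))
        ⟨trivial, trivial⟩ ((μ.setC (B + 3) (n + k)).setC (B + 2) k)
        (bmap (decXorFn r s n k) v)).to (by simp [Prog.size]) ?_
      simp only [Prog.exec, Prod.mk.injEq]
      constructor
      · ext x
        · simp only [Mem.setC_ctr, Function.update_apply]; grind
        · rfl
      · have e1 : (((μ.setC (B + 3) (n + k)).setC (B + 2) k).ctr (B + 2)) = k := by simp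
        have e2 : (((μ.setC (B + 3) (n + k)).setC (B + 2) k).ctr (B + 3)) = n + k := by simp
        simp only [Addr.cell, List.map_cons, List.map_nil, e1, e2, flipGate_eq, bmap_bmap]
        refine bmap_congr fun e _ => ?_
        simp only [Function.comp]
        rw [flipFn_one (by simp; omega)]
        funext q
        obtain ⟨q1, q2⟩ := q
        simp only [decXorFn, Function.update_apply, Prod.mk.injEq, hrs, false_and, if_false]
        by_cases h1 : q1 = s
        · by_cases h2 : q2 = k
          · simp [h1, h2]
          · have h4 : q2 < k + 1 ↔ q2 < k := by omega
            simp [h1, h2, h4]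
        · simp [h1])
  have h0 : decXorFn r s n 0 = fun e => e := by
    funext e q
    simp [decXorFn]
  simp only [h0, bmap_id] at h2
  have h3 : Prog.exec (Q := Unit) (.copy (B + 3) B) (μ, v) = (μ.setC (B + 3) (n + 0), v) := by
    simp [Prog.exec, Mem.setC, h.len]
  rw [h3] at h1
  refine (h1.seq_det (h2.seq_det (big_exec O (.clear (B + 3)) trivial _ _))).to
    (by simp [Prog.size]; omega) ?_
  have : (μ.setC (B + 3) (n + n)).setC (B + 3) 0 = μ := by
    rw [Mem.setC_setC, Mem.setC_self _ _ h.j]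
  simp only [Prog.exec, Prod.mk.injEq, and_true]
  exact this

/-- The decryption oracle on tapes `r` and `s`, with the help of an oracle for the function. -/
def decSub (B r s : ℕ) : Prog Unit :=
  if r = s then .skip else .seq (.query () r s) (decXor B r s)

/-- The effect of `decSub`, for any oracle. -/
noncomputable def decSem (O : Oracle Unit) (n r s : ℕ) (v : Vec) : Multiset Vec :=
  if r = s then {v} else (O () r s v).map (bmap (decXorFn r s n n))

/-- No scratch qubits are needed. The first half of the ciphertext already occupies the first `n`
cells of tape `r`, so one query adds the pad to tape `s`, and the second half is added by CNOTs. -/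
theorem big_decSub (O : Oracle Unit) (B n r s : ℕ) (μ : Mem) (v : Vec)
    (h : Ready B n μ) :
    Big O (n * 100 + 120) (decSub B r s) μ v ((decSem O n r s v).map fun w => (μ, w)) := by
  unfold decSub decSem
  by_cases hrs : r = s
  · simp only [hrs, if_true, Multiset.map_singleton]
    exact (big_exec O .skip trivial μ v).mono (by simp [Prog.size])
  · simp only [hrs, if_false]
    have h1 := Big.query_seq (O := O) (r := r) (s := s) (v := v) fun w =>
      big_decXor O B r s n hrs μ w h.toCounters
    rw [Multiset.map_map]
    rw [Multiset.bind_singleton] at h1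
    exact h1.mono (by omega)

/-! ### Exactness for function oracles -/

/-- States in which all qubits on the tapes from `B` on are zero. -/
def Blank (B : ℕ) (v : Vec) : Prop := ∀ e ∈ v.support, ∀ q : Cell, B ≤ q.1 → e q = false

theorem Blank.smul {B : ℕ} {v : Vec} (h : Blank B v) (a : ℂ) : Blank B (a • v) :=
  fun e he => h e (Finsupp.support_smul he)

theorem Blank.bmap {B : ℕ} {v : Vec} (h : Blank B v) {f : Basis → Basis}
    (hf : ∀ e, (∀ q : Cell, B ≤ q.1 → e q = false) → ∀ q : Cell, B ≤ q.1 → f e q = false) :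
    Blank B (bmap f v) := by
  classical
  intro e he
  obtain ⟨e', he', rfl⟩ := Finset.mem_image.1 (Finsupp.mapDomain_support he)
  exact hf e' (h e' he')

theorem Blank.xorOracle {B a b r s : ℕ} {v : Vec} (h : Blank B v) (hs : s < B) (F : Bits a → Bits b) :
    Blank B (xorOracle F r s v) := by
  rw [xorOracle_eq]
  refine h.bmap fun e he q hq => ?_
  have : q.1 ≠ s := by omega
  simp [xorFn, this, he q hq]

/-- Encryption with the function `φ`. -/
def encFn {n : ℕ} (φ : Bits n → Bits n) (m ρ : Bits n) : Bits (n + n) :=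
  Fin.append ρ fun i => xor (φ ρ i) (m i)

/-- Decryption with the function `φ`. -/
def decFn {n : ℕ} (φ : Bits n → Bits n) (c : Bits (n + n)) : Bits n :=
  fun i => xor (c (Fin.natAdd n i)) (φ (fun j => c (Fin.castAdd n j)) i)

/-- The quantum encryption oracle with the function `φ`. -/
noncomputable def encQ {n : ℕ} (φ : Bits n → Bits n) (r s : ℕ) (v : Vec) : Multiset Vec :=
  (Finset.univ : Finset (Bits n)).val.map fun ρ =>
    (((Real.sqrt (2 ^ n))⁻¹ : ℝ) : ℂ) • xorOracle (fun m => encFn φ m ρ) r s v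

theorem encFn_apply {n : ℕ} (φ : Bits n → Bits n) (m ρ : Bits n) (k : ℕ) (hk : k < n + n) :
    encFn φ m ρ ⟨k, hk⟩ = if h : k < n then ρ ⟨k, h⟩ else
      xor (φ ρ ⟨k - n, by omega⟩) (m ⟨k - n, by omega⟩) := by
  split_ifs with h
  · exact Fin.append_left ρ _ ⟨k, h⟩
  · have : (⟨k, hk⟩ : Fin (n + n)) = Fin.natAdd n ⟨k - n, by omega⟩ := by
      ext; simp; omega
    rw [encFn, this, Fin.append_right]

/-- With blank scratch tapes the pad register receives exactly `φ ρ`, and repeating the query with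
the same input removes it again. No entanglement with the scratch qubits is left, and the `n` tosses
supply the amplitude `1/√(2^n)`. -/
theorem encSem_funOracle {B n r s : ℕ} (hr : r < B) (hs : s < B) (φ : Bits n → Bits n) {v : Vec}
    (hv : Blank B v) : encSem (funOracle φ) B n r s v = encQ φ r s v := by
  simp only [encSem, funOracle, coinLists_eq, 
    Multiset.map_singleton, Multiset.bind_singleton, encQ]
  rw [Multiset.map_map]
  refine Multiset.map_congr rfl fun ρ _ => ?_
  rw [Function.comp, coinsVec_eq _ _ fun e he => hv e he _ (by simp)]
  have hs2 : Real.sqrt 2 ^ n = Real.sqrt (2 ^ n) := by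
    rw [Real.sqrt_eq_rpow, Real.sqrt_eq_rpow, ← Real.rpow_natCast, ← Real.rpow_natCast,
      ← Real.rpow_mul (by norm_num), ← Real.rpow_mul (by norm_num), mul_comm]
  have hg : ∀ w : Vec, (if r = s then w else bmap (encXorFn B r s n n) w) =
      bmap (if r = s then fun e => e else encXorFn B r s n n) w := by
    intro w; split_ifs
    · exact (bmap_id w).symm
    · rfl
  simp only [hg]
  simp only [loadVec, xorOracle_eq, map_smul, List.length_ofFn, inv_pow, hs2]
  congr 1
  simp only [bmap_bmap]
  refine bmap_congr fun e he => ?_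
  have hb := hv e he
  set L : Basis → Basis := loadFn (B + 2) (fun i => (List.ofFn ρ).getD i false) n with hL
  have hLX : (fun j : Fin n => L e (B + 2, j)) = ρ := by
    funext j
    simp [hL, loadFn, hb]
  have hLe : ∀ q : Cell, q.1 ≠ B + 2 → L e q = e q := fun q hq => by simp [hL, loadFn, hq]
  -- Loading the coins is an involution, cell by cell.
  have hLL : ∀ e' q, e' q = L e q → L e' q = e q := by
    intro e' q h
    simp only [hL, loadFn] at h ⊢
    split_ifs at h ⊢
    · rw [h]; cases e q <;> simp
    · exact h
  have h2 : xorFn φ (B + 2) (B + 3) (L e) = fun q => if h : q.1 = B + 3 ∧ q.2 < n then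
      φ ρ ⟨q.2, h.2⟩ else L e q := by
    funext q
    simp only [xorFn, hLX]
    by_cases h : q.1 = B + 3 ∧ q.2 < n
    · have : L e q = false := by rw [hLe q (by omega), hb q (by omega)]
      simp [h, this]
    · have : ¬ (B + 2 ≠ B + 3 ∧ q.1 = B + 3 ∧ q.2 < n) := fun h' => h h'.2
      simp only [dif_neg h, dif_neg this]
  -- The tape `s` now holds what the encryption oracle would give; the scratch tapes are as they
  -- were after the first query.
  have h3 : (if r = s then fun e => e else encXorFn B r s n n) (xorFn φ (B + 2) (B + 3) (L e)) =
      fun q => if q.1 = s then xorFn (fun m => encFn φ m ρ) r s e q else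
        xorFn φ (B + 2) (B + 3) (L e) q := by
    rw [h2]
    have hrB : r ≠ B + 3 := by omega
    have hsB : s ≠ B + 3 := by omega
    have hrX : r ≠ B + 2 := by omega
    have hsX : s ≠ B + 2 := by omega
    funext ⟨q1, q2⟩
    by_cases hq : q1 = s
    · subst hq
      by_cases hrs : r = q1
      · simp [hrs, xorFn, hsB, hLe, hsX]
      · simp only [hrs, if_false, encXorFn, xorFn, true_and, if_true, ne_eq, not_false_eq_true,
          hsB, false_and, dif_neg, hLe (q1, q2) hsX, encFn_apply]
        by_cases h4 : q2 < n
        · have h5 : q2 < n + n := by omega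
          have h6 := congrFun hLX ⟨q2, h4⟩
          simp only at h6
          simp [h4, h5, h6]
        · by_cases h5 : q2 < n + n
          · have h6 : n ≤ q2 := by omega
            have h7 : q2 - n < n := by omega
            simp only [h4, h5, h6, h7, if_false, and_self, if_true, dif_pos, dif_neg,
              not_false_eq_true, hrB, false_and, hLe (r, q2 - n) hrX]
            rw [Bool.xor_assoc]
          · simp [h4, h5]
    · split_ifs with hrs
      · simp
      · simp [encXorFn, hq]
  rw [Function.comp, Function.comp, Function.comp, Function.comp]
  simp only [h3]
  -- The input register still holds the coins, so the second query cancels the pad.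
  have h4 : xorFn φ (B + 2) (B + 3) (fun q => if q.1 = s then xorFn (fun m => encFn φ m ρ) r s e q
      else xorFn φ (B + 2) (B + 3) (L e) q) =
      fun q => if q.1 = s then xorFn (fun m => encFn φ m ρ) r s e q else L e q := by
    have hsB : ¬ B + 3 = s := by omega
    have hsX : ¬ B + 2 = s := by omega
    funext ⟨q1, q2⟩
    rw [h2]
    simp only [xorFn]
    by_cases hq : q1 = B + 3 ∧ q2 < n
    · obtain ⟨rfl, hq2⟩ := hq
      have : L e (B + 3, q2) = false := by rw [hLe _ (by simp), hb _ (by simp)]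
      simp [hsB, hsX, hq2, hLX, this]
    · have h5 : ¬ (B + 2 ≠ B + 3 ∧ q1 = B + 3 ∧ q2 < n) := fun h' => hq h'.2
      simp only [dif_neg hq, dif_neg h5]
  rw [h4]
  funext q
  by_cases hq : q.1 = s
  · have h5 : s ≠ B + 2 := by omega
    simp [hL, loadFn, h5, hq]
  · rw [hLL _ q (by simp [hq])]
    simp [xorFn, hq]

theorem decSem_funOracle {n r s : ℕ} (φ : Bits n → Bits n) (v : Vec) :
    decSem (funOracle φ) n r s v = {xorOracle (decFn φ) r s v} := by
  unfold decSem
  by_cases hrs : r = s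
  · simp only [hrs, if_true, xorOracle_eq]
    rw [bmap_eq_self]
    intro e _
    funext q
    simp [xorFn]
  · simp only [hrs, if_false, funOracle, Multiset.map_singleton, xorOracle_eq, bmap_bmap]
    congr 1
    refine bmap_congr fun e _ => ?_
    funext ⟨q1, q2⟩
    have hrs' : r ≠ s := hrs
    simp only [Function.comp, decXorFn, xorFn, hrs, false_and, and_false, dif_neg,
      not_false_eq_true, ne_eq, true_and, decFn]
    by_cases h : q1 = s ∧ q2 < n
    · simp only [h, and_self, if_true, dif_pos, Fin.natAdd_mk, Fin.val_castAdd]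
      rw [Bool.xor_assoc, Bool.xor_comm (φ _ _)]
    · simp only [h, if_false, dif_neg, not_false_eq_true]

theorem blank_encQ {B n r s : ℕ} (hs : s < B) (φ : Bits n → Bits n) {v : Vec} (hv : Blank B v) :
    ∀ w ∈ encQ φ r s v, Blank B w := by
  intro w hw
  obtain ⟨ρ, -, rfl⟩ := Multiset.mem_map.1 hw
  exact (hv.xorOracle hs _).smul _

/-! ### Replacing oracle queries by programs -/

section Compile

variable {Q : Type}

/-- All counters and tapes of the address are below `B`. -/
def Addr.Below (B : ℕ) (a : Addr) : Prop := a.tape < B ∧ a.head < B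

/-- All counters and tapes of the test are below `B`. -/
def Test.Below (B : ℕ) : Test → Prop
  | .isZero x => x < B
  | .eq x y => x < B ∧ y < B
  | .bit a => a.Below B

/-- All counters and tapes in the program are below `B`. -/
def Prog.Below (B : ℕ) : Prog Q → Prop
  | .skip => True
  | .inc x | .dec x | .clear x => x < B
  | .copy x y => x < B ∧ y < B
  | .write a _ | .hadamard a | .phase a => a.Below B
  | .flip cs a => (∀ c ∈ cs, c.Below B) ∧ a.Below B
  | .measure a d => a.Below B ∧ d.Below B
  | .query _ r s => r < B ∧ s < B
  | .seq P R => P.Below B ∧ R.Below B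
  | .ite t P R => t.Below B ∧ P.Below B ∧ R.Below B
  | .loop t P => t.Below B ∧ P.Below B

theorem Addr.Below.mono {B B' : ℕ} (h : B ≤ B') {a : Addr} (ha : a.Below B) : a.Below B' :=
  ⟨ha.1.trans_le h, ha.2.trans_le h⟩

theorem Test.Below.mono {B B' : ℕ} (h : B ≤ B') : ∀ {t : Test}, t.Below B → t.Below B'
  | .isZero _, ht => ht.trans_le h
  | .eq _ _, ht => ⟨ht.1.trans_le h, ht.2.trans_le h⟩
  | .bit _, ht => Addr.Below.mono h ht

theorem Prog.Below.mono {B B' : ℕ} (h : B ≤ B') : ∀ {P : Prog Q}, P.Below B → P.Below B'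
  | .skip, _ => trivial
  | .inc _, hP | .dec _, hP | .clear _, hP => Nat.lt_of_lt_of_le hP h
  | .copy _ _, hP | .query _ _ _, hP => ⟨hP.1.trans_le h, hP.2.trans_le h⟩
  | .write _ _, hP | .hadamard _, hP | .phase _, hP => Addr.Below.mono h hP
  | .flip _ _, hP => ⟨fun c hc => (hP.1 c hc).mono h, hP.2.mono h⟩
  | .measure _ _, hP => ⟨hP.1.mono h, hP.2.mono h⟩
  | .seq _ _, hP => ⟨hP.1.mono h, hP.2.mono h⟩
  | .ite _ _ _, hP => ⟨hP.1.mono h, hP.2.1.mono h, hP.2.2.mono h⟩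
  | .loop _ _, hP => ⟨hP.1.mono h, hP.2.mono h⟩

theorem Addr.exists_below (a : Addr) : ∃ B, a.Below B :=
  ⟨max a.tape a.head + 1, by simp only [Addr.Below]; omega⟩

theorem Test.exists_below : ∀ t : Test, ∃ B, t.Below B
  | .isZero x => ⟨x + 1, Nat.lt_succ_self x⟩
  | .eq x y => ⟨max x y + 1, by simp only [Test.Below]; omega⟩
  | .bit a => a.exists_below

theorem exists_below_list : ∀ l : List Addr, ∃ B, ∀ c ∈ l, c.Below B
  | [] => ⟨0, by simp⟩
  | a :: l => by
    obtain ⟨B, hB⟩ := a.exists_below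
    obtain ⟨B', hB'⟩ := exists_below_list l
    refine ⟨max B B', fun c hc => ?_⟩
    rcases List.mem_cons.1 hc with rfl | hc
    · exact hB.mono (le_max_left _ _)
    · exact (hB' c hc).mono (le_max_right _ _)

/-- A program is a finite text and addresses fixed tapes and counters, so everything from some `B`
on is free as scratch space for the simulation. -/
theorem Prog.exists_below : ∀ P : Prog Q, ∃ B, P.Below B
  | .skip => ⟨0, trivial⟩
  | .inc x | .dec x | .clear x => ⟨x + 1, Nat.lt_succ_self x⟩
  | .copy x y | .query _ x y => ⟨max x y + 1, by simp only [Prog.Below]; omega⟩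
  | .write a _ | .hadamard a | .phase a => a.exists_below
  | .flip cs a => by
    obtain ⟨B, hB⟩ := exists_below_list cs
    obtain ⟨B', hB'⟩ := a.exists_below
    exact ⟨max B B', fun c hc => (hB c hc).mono (le_max_left _ _), hB'.mono (le_max_right _ _)⟩
  | .measure a d => by
    obtain ⟨B, hB⟩ := a.exists_below
    obtain ⟨B', hB'⟩ := d.exists_below
    exact ⟨max B B', hB.mono (le_max_left _ _), hB'.mono (le_max_right _ _)⟩
  | .seq P R => by
    obtain ⟨B, hB⟩ := P.exists_below
    obtain ⟨B', hB'⟩ := R.exists_below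
    exact ⟨max B B', hB.mono (le_max_left _ _), hB'.mono (le_max_right _ _)⟩
  | .ite t P R => by
    obtain ⟨B, hB⟩ := P.exists_below
    obtain ⟨B', hB'⟩ := R.exists_below
    obtain ⟨B₀, hB₀⟩ := t.exists_below
    exact ⟨max B₀ (max B B'), hB₀.mono (by omega), hB.mono (by omega), hB'.mono (by omega)⟩
  | .loop t P => by
    obtain ⟨B, hB⟩ := P.exists_below
    obtain ⟨B₀, hB₀⟩ := t.exists_below
    exact ⟨max B₀ B, hB₀.mono (by omega), hB.mono (by omega)⟩

/-- Replace each query by a program. -/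
def Prog.compile (sub : Q → ℕ → ℕ → Prog Unit) : Prog Q → Prog Unit
  | .skip => .skip
  | .inc x => .inc x
  | .dec x => .dec x
  | .clear x => .clear x
  | .copy x y => .copy x y
  | .write a b => .write a b
  | .hadamard a => .hadamard a
  | .phase a => .phase a
  | .flip cs a => .flip cs a
  | .measure a d => .measure a d
  | .query o r s => sub o r s
  | .seq P R => .seq (P.compile sub) (R.compile sub)
  | .ite t P R => .ite t (P.compile sub) (R.compile sub)
  | .loop t P => .loop t (P.compile sub)

/-- The memory `μ` on the registers below `B`, and `S` on the others. -/
def overlay (B : ℕ) (S μ : Mem) : Mem :=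
  ⟨fun x => if x < B then μ.ctr x else S.ctr x, fun q => if q.1 < B then μ.bit q else S.bit q⟩

theorem overlay_self (B : ℕ) (μ : Mem) : overlay B μ μ = μ := by
  ext <;> simp [overlay]

theorem Addr.Below.cell_overlay {B : ℕ} {a : Addr} (h : a.Below B) (S μ : Mem) :
    a.cell (overlay B S μ) = a.cell μ := by
  simp [Addr.cell, overlay, h.2]

theorem Test.Below.eval_overlay {B : ℕ} (S μ : Mem) : ∀ {t : Test}, t.Below B →
    t.eval (overlay B S μ) = t.eval μ
  | .isZero x, h => by
    have h : x < B := h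
    simp [Test.eval, overlay, h]
  | .eq x y, h => by simp [Test.eval, overlay, h.1, h.2]
  | .bit a, h => by
    have h : a.Below B := h
    simp only [Test.eval, h.cell_overlay]
    simp [overlay, Addr.cell, h.1]

theorem overlay_ctr {B x : ℕ} (S μ : Mem) (h : x < B) : (overlay B S μ).ctr x = μ.ctr x := by
  simp [overlay, h]

theorem overlay_update_ctr {B x : ℕ} (S μ : Mem) (h : x < B) (k : ℕ) :
    (⟨Function.update (overlay B S μ).ctr x k, (overlay B S μ).bit⟩ : Mem) =
      overlay B S ⟨Function.update μ.ctr x k, μ.bit⟩ := by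
  ext y
  · by_cases hy : y = x
    · subst hy; simp [overlay, h]
    · simp [overlay, hy]
  · rfl

theorem overlay_update_bit {B : ℕ} {q : Cell} (S μ : Mem) (h : q.1 < B) (b : Bool) :
    (⟨(overlay B S μ).ctr, Function.update (overlay B S μ).bit q b⟩ : Mem) =
      overlay B S ⟨μ.ctr, Function.update μ.bit q b⟩ := by
  ext y
  · rfl
  · by_cases hy : y = q
    · subst hy; simp [overlay, h]
    · simp [overlay, hy]

/-- The configuration of the compiled program that corresponds to `c`. -/
def Config.compile (sub : Q → ℕ → ℕ → Prog Unit) (B : ℕ) (S : Mem) (l' : List (Prog Unit))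
    (c : Config Q) : Config Unit :=
  ⟨c.code.map (Prog.compile sub) ++ l', overlay B S c.mem, c.vec⟩

/-- Instructions other than queries neither read nor write registers from `B` on, so the compiled
program follows in lockstep. -/
theorem step_compile {B : ℕ} (O : Oracle Unit) (O' : Oracle Q) (sub : Q → ℕ → ℕ → Prog Unit)
    (S : Mem) (l' : List (Prog Unit)) (P : Prog Q) (hP : P.Below B) (hq : ∀ o r s, P ≠ .query o r s)
    (l : List (Prog Q)) (μ : Mem) (v : Vec) :
    step O (Config.compile sub B S l' ⟨P :: l, μ, v⟩) =
      (step O' ⟨P :: l, μ, v⟩).map (Config.compile sub B S l') := by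
  have hcs : ∀ cs : List Addr, (∀ c ∈ cs, c.Below B) →
      (cs.map fun d => d.cell (overlay B S μ)) = cs.map fun d => d.cell μ := fun cs h =>
    List.map_congr_left fun c hc => (h c hc).cell_overlay S μ
  cases P with
  | query o r s => exact absurd rfl (hq o r s)
  | skip | seq => simp [step, Config.compile, Prog.compile]
  | inc x | dec x | clear x =>
    have hP : x < B := hP
    simp [step, Config.compile, Prog.compile, ← overlay_update_ctr S μ hP, overlay_ctr S μ hP]
  | copy x y =>
    simp [step, Config.compile, Prog.compile, ← overlay_update_ctr S μ hP.1, overlay_ctr S μ hP.2]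
  | write a b =>
    have hP : a.Below B := hP
    simp [step, Config.compile, Prog.compile, hP.cell_overlay,
      ← overlay_update_bit (q := a.cell μ) S μ hP.1]
  | hadamard a | phase a =>
    have hP : a.Below B := hP
    simp [step, Config.compile, Prog.compile, hP.cell_overlay]
  | flip cs a =>
    simp [step, Config.compile, Prog.compile, hP.2.cell_overlay, hcs cs hP.1]
  | measure a d =>
    simp only [step, Config.compile, Prog.compile, hP.1.cell_overlay, hP.2.cell_overlay,
      ← overlay_update_bit (q := d.cell μ) S μ hP.2.1, Multiset.map_map, Function.comp_def,
      List.map_cons, List.cons_append]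
  | ite t P R =>
    simp only [step, Config.compile, Prog.compile, hP.1.eval_overlay, Multiset.map_singleton,
      List.map_cons, List.cons_append]
    split_ifs <;> rfl
  | loop t P =>
    simp only [step, Config.compile, Prog.compile, hP.1.eval_overlay, Multiset.map_singleton,
      List.map_cons, List.cons_append]
    split_ifs <;> rfl

theorem below_of_mem_step {B : ℕ} (O : Oracle Q) {c c' : Config Q} (h : ∀ P ∈ c.code, P.Below B)
    (hc : c' ∈ step O c) : ∀ P ∈ c'.code, P.Below B := by
  obtain ⟨code, μ, v⟩ := c
  cases code with
  | nil =>
    obtain rfl := Multiset.mem_singleton.1 hc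
    exact h
  | cons P l =>
    have hP : P.Below B := h P List.mem_cons_self
    have hl : ∀ P ∈ l, P.Below B := fun R hR => h R (List.mem_cons_of_mem _ hR)
    cases P with
    | skip | inc | dec | clear | copy | write | hadamard | phase | flip =>
      obtain rfl := Multiset.mem_singleton.1 hc
      exact hl
    | measure a d =>
      simp only [step, Multiset.mem_map] at hc
      obtain ⟨b, -, rfl⟩ := hc
      exact hl
    | query o r s =>
      obtain ⟨b, -, rfl⟩ := Multiset.mem_map.1 hc
      exact hl
    | seq P R =>
      obtain rfl := Multiset.mem_singleton.1 hc
      simpa [hP.1, hP.2] using hl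
    | ite t P R =>
      obtain rfl := Multiset.mem_singleton.1 hc
      cases ht : t.eval μ
      · simpa [ht, hP.2.2] using hl
      · simpa [ht, hP.2.1] using hl
    | loop t P =>
      obtain rfl := Multiset.mem_singleton.1 hc
      cases ht : t.eval μ
      · simpa [ht] using hl
      · simpa [ht, hP.1, hP.2, Prog.Below] using hl

/-- Every step of the original costs at most `q + 1` steps of the compiled program. It is essential
that `hsub` returns the same scratch memory `S`: then the next query finds its registers ready
again. -/
theorem ends_compile {B q : ℕ} (O : Oracle Unit) (O' : Oracle Q) (sub : Q → ℕ → ℕ → Prog Unit)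
    (S : Mem)
    (hsub : ∀ o r s μ v, r < B → s < B → Big O q (sub o r s) (overlay B S μ) v
      ((O' o r s v).map fun w => (overlay B S μ, w)))
    (l' : List (Prog Unit)) (T : ℕ) (N : Mem × Vec → Multiset (Mem × Vec)) (t : ℕ) :
    ∀ c : Config Q, (∀ P ∈ c.code, P.Below B) → (∀ c' ∈ run O' t c, c'.code = []) →
      (∀ c' ∈ run O' t c, Ends O T l' (overlay B S c'.mem) c'.vec (N (c'.mem, c'.vec))) →
      Ends O (t * (q + 1) + T) (c.code.map (Prog.compile sub) ++ l') (overlay B S c.mem) c.vec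
          ((run O' t c).bind fun c' => N (c'.mem, c'.vec)) := by
  induction t with
  | zero =>
    intro c _ hh hN
    simp only [run, Multiset.mem_singleton, forall_eq] at hh hN
    simpa [run, hh] using hN
  | succ t ih =>
    intro c hl hh hN
    have hmem : ∀ c₁ ∈ step O' c, ∀ c' ∈ run O' t c₁, c' ∈ run O' (t + 1) c := fun c₁ h₁ c' h' =>
      Multiset.mem_bind.2 ⟨c₁, h₁, h'⟩
    have ih' : ∀ c₁ ∈ step O' c, Ends O (t * (q + 1) + T) (c₁.code.map (Prog.compile sub) ++ l')
        (overlay B S c₁.mem) c₁.vec ((run O' t c₁).bind fun c' => N (c'.mem, c'.vec)) :=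
      fun c₁ h₁ => ih c₁ (below_of_mem_step O' hl h₁) (fun c' h' => hh c' (hmem c₁ h₁ c' h'))
        (fun c' h' => hN c' (hmem c₁ h₁ c' h'))
    have hbind : (run O' (t + 1) c).bind (fun c' => N (c'.mem, c'.vec)) =
        (step O' c).bind fun c₁ => (run O' t c₁).bind fun c' => N (c'.mem, c'.vec) := by
      rw [run, Multiset.bind_assoc]
    rw [hbind]
    obtain ⟨code, μ, v⟩ := c
    cases code with
    | nil =>
      have h := (ih' ⟨[], μ, v⟩ (by simp [step])).mono
        (t' := (t + 1) * (q + 1) + T) (by ring_nf; omega)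
      simpa [step] using h
    -- A query is replaced by its subroutine, and the induction hypothesis serves as the
    -- continuation; any other instruction takes one step on both sides.
    | cons P l =>
      by_cases hq : ∃ o r s, P = .query o r s
      · obtain ⟨o, r, s, rfl⟩ := hq
        have hP : Prog.Below B (.query o r s : Prog Q) := hl _ List.mem_cons_self
        have h := hsub o r s μ v hP.1 hP.2 (l.map (Prog.compile sub) ++ l') (t * (q + 1) + T)
          (fun p => (run O' t ⟨l, μ, p.2⟩).bind fun c' => N (c'.mem, c'.vec)) (by
            intro p hp
            obtain ⟨w, hw, rfl⟩ := Multiset.mem_map.1 hp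
            exact ih' ⟨l, μ, w⟩ (Multiset.mem_map.2 ⟨w, hw, rfl⟩))
        rw [Multiset.bind_map] at h
        simp only [step, Multiset.bind_map]
        exact h.mono (by ring_nf; omega)
      · have hs := step_compile O O' sub S l' P (hl _ List.mem_cons_self)
          (fun o r s h => hq ⟨o, r, s, h⟩) l μ v
        have h1 : Ends O (t * (q + 1) + T + 1) ((P :: l).map (Prog.compile sub) ++ l')
            (overlay B S μ) v ((step O' ⟨P :: l, μ, v⟩).bind fun c₁ =>
              (run O' t c₁).bind fun c' => N (c'.mem, c'.vec)) := by
          unfold Ends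
          rw [run]
          erw [hs]
          rw [Multiset.bind_map, Multiset.map_bind]
          exact Multiset.bind_congr fun c₁ h₁ => ih' c₁ h₁
        exact h1.mono (by ring_nf; omega)

/-- The value `x` may depend on the whole final configuration of the original run, though the
compiled run only sees memory and state; `Val.unique` reconciles the two. -/
theorem val_compile {B q : ℕ} (O : Oracle Unit) (O' : Oracle Q) (sub : Q → ℕ → ℕ → Prog Unit)
    (S : Mem)
    (hsub : ∀ o r s μ v, r < B → s < B → Big O q (sub o r s) (overlay B S μ) v
      ((O' o r s v).map fun w => (overlay B S μ, w)))
    (l' : List (Prog Unit)) (T t : ℕ) (g : Mem × Vec → ℝ) (x : Config Q → ℝ) (P : Prog Q)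
    (μ : Mem) (v : Vec) (hP : P.Below B) (hh : ∀ c ∈ run O' t ⟨[P], μ, v⟩, c.code = [])
    (hx : ∀ c ∈ run O' t ⟨[P], μ, v⟩, Val O T l' (overlay B S c.mem) c.vec g (x c)) :
    Val O (t * (q + 1) + T) (P.compile sub :: l') (overlay B S μ) v g
      ((run O' t ⟨[P], μ, v⟩).map x).sum := by
  have h1 : ∀ p ∈ (run O' t ⟨[P], μ, v⟩).map (fun c => (c.mem, c.vec)),
      ∃ N, Ends O T l' (overlay B S p.1) p.2 N := by
    intro p hp
    obtain ⟨c, hc, rfl⟩ := Multiset.mem_map.1 hp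
    obtain ⟨N, hN, -⟩ := hx c hc
    exact ⟨N, hN⟩
  choose! N hN using h1
  have hN' : ∀ c ∈ run O' t ⟨[P], μ, v⟩, Ends O T l' (overlay B S c.mem) c.vec (N (c.mem, c.vec)) :=
    fun c hc => hN _ (Multiset.mem_map_of_mem (fun c : Config Q => (c.mem, c.vec)) hc)
  refine ⟨_, ends_compile O O' sub S hsub l' T N t ⟨[P], μ, v⟩ (by simpa using hP) hh hN', ?_⟩
  rw [Multiset.map_bind, Multiset.sum_bind]
  refine congrArg _ (Multiset.map_congr rfl fun c hc => ?_)
  exact Val.unique ⟨_, hN' c hc, rfl⟩ (hx c hc)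

/-! ### Invariants of runs -/

/-- A property of configurations that is preserved by steps is preserved by runs. -/
theorem run_invariant {O : Oracle Q} {I : Config Q → Prop}
    (h : ∀ c, I c → ∀ c' ∈ step O c, I c') (t : ℕ) :
    ∀ c, I c → ∀ c' ∈ run O t c, I c' := by
  induction t with
  | zero =>
    intro c hc c' hc'
    obtain rfl := Multiset.mem_singleton.1 hc'
    exact hc
  | succ t ih =>
    intro c hc c' hc'
    obtain ⟨c₁, h₁, h'⟩ := Multiset.mem_bind.1 hc'
    exact ih c₁ (h c hc c₁ h₁) c' h'

/-- Oracles that agree on states with an invariant property have the same runs. -/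
theorem run_congr {O O' : Oracle Q} {I : Config Q → Prop}
    (h : ∀ c, I c → ∀ c' ∈ step O c, I c') (h' : ∀ c, I c → step O' c = step O c) (t : ℕ) :
    ∀ c, I c → run O' t c = run O t c := by
  induction t with
  | zero => intro c _; rfl
  | succ t ih =>
    intro c hc
    rw [run, run, h' c hc]
    exact Multiset.bind_congr fun c₁ h₁ => ih c₁ (h c hc c₁ h₁)

theorem mem_ctr_of_mem_step {B : ℕ} (O : Oracle Q) {c c' : Config Q}
    (h : ∀ P ∈ c.code, P.Below B) (hc : c' ∈ step O c) :
    ∀ x, B ≤ x → c'.mem.ctr x = c.mem.ctr x := by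
  intro x hx
  obtain ⟨code, μ, v⟩ := c
  cases code with
  | nil =>
    obtain rfl := Multiset.mem_singleton.1 hc
    rfl
  | cons P l =>
    have hP : P.Below B := h P List.mem_cons_self
    cases P with
    | skip | write | hadamard | phase | flip | seq | ite | loop =>
      obtain rfl := Multiset.mem_singleton.1 hc
      rfl
    | inc y | dec y | clear y =>
      obtain rfl := Multiset.mem_singleton.1 hc
      have hP : y < B := hP
      exact Function.update_of_ne (by omega) _ _
    | copy y z =>
      obtain rfl := Multiset.mem_singleton.1 hc
      have hP : y < B := hP.1
      exact Function.update_of_ne (by omega) _ _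
    | measure a d =>
      simp only [step, Multiset.mem_map] at hc
      obtain ⟨b, -, rfl⟩ := hc
      rfl
    | query o r s =>
      obtain ⟨b, -, rfl⟩ := Multiset.mem_map.1 hc
      rfl

theorem mem_ctr_of_mem_run {B : ℕ} (O : Oracle Q) (t : ℕ) (c : Config Q)
    (h : ∀ P ∈ c.code, P.Below B) : ∀ c' ∈ run O t c, ∀ x, B ≤ x → c'.mem.ctr x = c.mem.ctr x :=
  fun c' hc' => (run_invariant (O := O)
    (I := fun c' => (∀ P ∈ c'.code, P.Below B) ∧ ∀ x, B ≤ x → c'.mem.ctr x = c.mem.ctr x)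
    (fun _ h₁ _ h₂ => ⟨below_of_mem_step O h₁.1 h₂,
      fun x hx => (mem_ctr_of_mem_step O h₁.1 h₂ x hx).trans (h₁.2 x hx)⟩)
    t c ⟨h, fun _ _ => rfl⟩ c' hc').2

theorem ctr_le_of_mem_step (O : Oracle Q) {c c' : Config Q} {K : ℕ} (h : ∀ x, c.mem.ctr x ≤ K)
    (hc : c' ∈ step O c) : ∀ x, c'.mem.ctr x ≤ K + 1 := by
  have h0 : ∀ x, c.mem.ctr x ≤ K + 1 := fun x => (h x).trans (Nat.le_succ K)
  have hu : ∀ y k, k ≤ K + 1 → ∀ x, Function.update c.mem.ctr y k x ≤ K + 1 := by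
    intro y k hk x
    by_cases hx : x = y
    · subst hx; simpa using hk
    · simpa [hx] using h0 x
  obtain ⟨code, μ, v⟩ := c
  cases code with
  | nil =>
    obtain rfl := Multiset.mem_singleton.1 hc
    exact h0
  | cons P l =>
    cases P with
    | skip | write | hadamard | phase | flip | seq | ite | loop =>
      obtain rfl := Multiset.mem_singleton.1 hc
      exact h0
    | inc y =>
      obtain rfl := Multiset.mem_singleton.1 hc
      exact hu y _ (Nat.succ_le_succ (h y))
    | dec y =>
      obtain rfl := Multiset.mem_singleton.1 hc
      exact hu y _ ((Nat.sub_le _ _).trans (h0 y))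
    | clear y =>
      obtain rfl := Multiset.mem_singleton.1 hc
      exact hu y _ (Nat.zero_le _)
    | copy y z =>
      obtain rfl := Multiset.mem_singleton.1 hc
      exact hu y _ (h0 z)
    | measure a d =>
      simp only [step, Multiset.mem_map] at hc
      obtain ⟨b, -, rfl⟩ := hc
      exact h0
    | query o r s =>
      obtain ⟨b, -, rfl⟩ := Multiset.mem_map.1 hc
      exact h0

/-- One step raises the largest counter by at most one. As the length of a tape is stored in a
counter, the strings output in polynomial time have polynomial length. -/
theorem ctr_le_of_mem_run (O : Oracle Q) (t : ℕ) : ∀ (c : Config Q) (K : ℕ),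
    (∀ x, c.mem.ctr x ≤ K) → ∀ c' ∈ run O t c, ∀ x, c'.mem.ctr x ≤ K + t := by
  induction t with
  | zero =>
    intro c K h c' hc'
    obtain rfl := Multiset.mem_singleton.1 hc'
    exact h
  | succ t ih =>
    intro c K h c' hc' x
    obtain ⟨c₁, h₁, h'⟩ := Multiset.mem_bind.1 hc'
    have := ih c₁ (K + 1) (ctr_le_of_mem_step O h h₁) c' h' x
    omega

theorem Blank.linearCombination {B : ℕ} {v : Vec} (h : Blank B v) (f : Basis → Vec)
    (hf : ∀ e, (∀ q : Cell, B ≤ q.1 → e q = false) → Blank B (f e)) :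
    Blank B (Finsupp.linearCombination ℂ f v) := by
  classical
  intro e he
  rw [Finsupp.linearCombination_apply] at he
  obtain ⟨e', he', h'⟩ := Finset.mem_biUnion.1 (Finsupp.support_sum he)
  exact hf e' (h e' he') e (Finsupp.support_smul h')

theorem blank_single {B : ℕ} {e : Basis} (h : ∀ q : Cell, B ≤ q.1 → e q = false) (a : ℂ) :
    Blank B (Finsupp.single e a) := by
  intro e' he'
  rw [Finset.mem_singleton.1 (Finsupp.support_single_subset he')]
  exact h

theorem Blank.add {B : ℕ} {v w : Vec} (h : Blank B v) (h' : Blank B w) : Blank B (v + w) := by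
  classical
  intro e he
  rcases Finset.mem_union.1 (Finsupp.support_add he) with he | he
  · exact h e he
  · exact h' e he

theorem blank_of_mem_step {B : ℕ} {O : Oracle Q}
    (hO : ∀ o r s v, r < B → s < B → Blank B v → ∀ w ∈ O o r s v, Blank B w) {c c' : Config Q}
    (h : ∀ P ∈ c.code, P.Below B) (hv : Blank B c.vec) (hc : c' ∈ step O c) : Blank B c'.vec := by
  obtain ⟨code, μ, v⟩ := c
  have hupd : ∀ (e : Basis) (q : Cell) (b : Bool), q.1 < B → (∀ q : Cell, B ≤ q.1 → e q = false) →
      ∀ q' : Cell, B ≤ q'.1 → Function.update e q b q' = false := by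
    intro e q b hq he q' hq'
    have : q' ≠ q := by rintro rfl; omega
    rw [Function.update_of_ne this]
    exact he q' hq'
  cases code with
  | nil =>
    obtain rfl := Multiset.mem_singleton.1 hc
    exact hv
  | cons P l =>
    have hP : P.Below B := h P List.mem_cons_self
    cases P with
    | skip | inc | dec | clear | copy | write | seq | ite | loop =>
      obtain rfl := Multiset.mem_singleton.1 hc
      exact hv
    | hadamard a =>
      obtain rfl := Multiset.mem_singleton.1 hc
      have hP : a.Below B := hP
      exact hv.linearCombination _ fun e he =>
        (blank_single (hupd e _ _ hP.1 he) _).add (blank_single (hupd e _ _ hP.1 he) _)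
    | phase a =>
      obtain rfl := Multiset.mem_singleton.1 hc
      exact hv.linearCombination _ fun e he => blank_single he _
    | flip cs a =>
      obtain rfl := Multiset.mem_singleton.1 hc
      have hP : a.Below B := hP.2
      simp only [flipGate_eq]
      refine hv.bmap fun e he => ?_
      unfold flipFn
      split_ifs
      · exact hupd e _ _ hP.1 he
      · exact he
    | measure a d =>
      simp only [step, Multiset.mem_map] at hc
      obtain ⟨b, -, rfl⟩ := hc
      intro e he
      have he' : ¬ v e = 0 ∧ e (a.cell μ) = b := by simpa [project] using he
      exact hv e (Finsupp.mem_support_iff.2 he'.1)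
    | query o r s =>
      obtain ⟨w, hw, rfl⟩ := Multiset.mem_map.1 hc
      exact hO o r s v hP.1 hP.2 hv w hw

/-- Oracles that agree on blank states have the same runs on programs below `B`. -/
theorem run_congr_blank {B : ℕ} {O O' : Oracle Q}
    (hO : ∀ o r s v, r < B → s < B → Blank B v → ∀ w ∈ O o r s v, Blank B w)
    (h : ∀ o r s v, r < B → s < B → Blank B v → O' o r s v = O o r s v) (t : ℕ) (c : Config Q)
    (hc : ∀ P ∈ c.code, P.Below B) (hv : Blank B c.vec) : run O' t c = run O t c := by
  refine run_congr (I := fun c => (∀ P ∈ c.code, P.Below B) ∧ Blank B c.vec)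
    (fun _ h₁ _ h₂ => ⟨below_of_mem_step O h₁.1 h₂, blank_of_mem_step hO h₁.1 h₁.2 h₂⟩)
    ?_ t c ⟨hc, hv⟩
  rintro ⟨code, μ, v⟩ ⟨h₁, h₂⟩
  cases code with
  | nil => rfl
  | cons P l =>
    cases P with
    | query o r s =>
      have hP : Prog.Below B (.query o r s : Prog Q) := h₁ _ List.mem_cons_self
      simp only [step, h o r s v hP.1 hP.2 h₂]
    | _ => rfl

theorem blank_of_mem_run {B : ℕ} {O : Oracle Q}
    (hO : ∀ o r s v, r < B → s < B → Blank B v → ∀ w ∈ O o r s v, Blank B w) (t : ℕ) (c : Config Q)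
    (hc : ∀ P ∈ c.code, P.Below B) (hv : Blank B c.vec) : ∀ c' ∈ run O t c, Blank B c'.vec :=
  fun c' hc' => (run_invariant (I := fun c => (∀ P ∈ c.code, P.Below B) ∧ Blank B c.vec)
    (fun _ h₁ _ h₂ => ⟨below_of_mem_step O h₁.1 h₂, blank_of_mem_step hO h₁.1 h₁.2 h₂⟩)
    t c ⟨hc, hv⟩ c' hc').2

theorem blank_vacuum (B : ℕ) : Blank B vacuum := blank_single (fun _ _ => rfl) _

end Compile

/-! ### Evaluation of circuits -/

/-- The state of the streaming evaluation of a circuit description: flags for the parts of the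
description that have been read, the number of outputs, the first input of the current gate, and the
wires. -/
structure EvalState where
  f0 : ℕ
  f1 : ℕ
  f2 : ℕ
  out : ℕ
  gate : ℕ
  len : ℕ
  wire : ℕ → Bool

/-- Process one number of a circuit description. -/
def EvalState.block (x : ℕ → Bool) (s : EvalState) (a : ℕ) : EvalState :=
  if s.f0 = 0 then { s with f0 := 1, len := a, wire := fun i => if i < a then x i else s.wire i }
  else if s.f1 = 0 then { s with f1 := 1, out := a }
  else if s.f2 = 0 then { s with f2 := 1, gate := a }
  else { s with
    f2 := 0, len := s.len + 1, wire := Function.update s.wire s.len !(s.wire s.gate && s.wire a) }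

/-- Process one bit of a circuit description. -/
def EvalState.feed (x : ℕ → Bool) (s : EvalState × ℕ) (b : Bool) : EvalState × ℕ :=
  if b then (s.1, s.2 + 1) else (s.1.block x s.2, 0)

/-- The initial state. -/
def EvalState.init : EvalState := ⟨0, 0, 0, 0, 0, 0, fun _ => false⟩

theorem EvalState.foldl_feed (x : ℕ → Bool) (w : List Bool) (s : EvalState) (a : ℕ) :
    (w.foldl (EvalState.feed x) (s, a)).1 = (blocks a w).foldl (EvalState.block x) s := by
  induction w generalizing s a with
  | nil => rfl
  | cons b w ih => cases b <;> simp [EvalState.feed, blocks, ih]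

theorem EvalState.feed_snd_le (x : ℕ → Bool) (w : List Bool) (s : EvalState) (a : ℕ) :
    (w.foldl (EvalState.feed x) (s, a)).2 ≤ a + w.length := by
  induction w generalizing s a with
  | nil => simp
  | cons b w ih =>
    cases b
    · simp only [List.foldl_cons, EvalState.feed, Bool.false_eq_true, if_false, List.length_cons]
      exact (ih _ _).trans (by omega)
    · simp only [List.foldl_cons, EvalState.feed, if_true, List.length_cons]
      exact (ih _ _).trans (by omega)

/-- The wires of the state are those in the list. -/
def EvalState.Wires (s : EvalState) (ws : List Bool) : Prop :=
  s.len = ws.length ∧ ∀ i, s.wire i = ws.getD i false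

/-- Two numbers make a gate, so the induction follows `pairs`; the flag `f2` tells which of the two
comes next. A single leftover number is stored but adds no wire, in accordance with `pairs`. Cells
beyond the last wire read as `false`, like missing wires. -/
theorem EvalState.wires_gates (x : ℕ → Bool) (l : List ℕ) (s : EvalState) (ws : List Bool)
    (h : s.Wires ws) (h0 : s.f0 = 1) (h1 : s.f1 = 1) (h2 : s.f2 = 0) :
    (l.foldl (EvalState.block x) s).out = s.out ∧ (l.foldl (EvalState.block x) s).Wires
      ((pairs l).foldl (fun w g => w ++ [!(w.getD g.1 false && w.getD g.2 false)]) ws) := by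
  induction l using pairs.induct generalizing s ws with
  | case1 i j l ih =>
    simp only [List.foldl_cons, pairs]
    set s' := EvalState.block x (EvalState.block x s i) j with hs'
    have e : s' = { s with
        f2 := 0, gate := i, len := s.len + 1,
        wire := Function.update s.wire s.len !(s.wire i && s.wire j) } := by
      simp [hs', EvalState.block, h0, h1, h2]
    have := ih s' (ws ++ [!(ws.getD i false && ws.getD j false)]) (by
      refine ⟨by simp [e, h.1], fun k => ?_⟩
      simp only [e, Function.update_apply, h.1, h.2]
      rcases lt_trichotomy k ws.length with hk | hk | hk
      · simp [hk.ne, List.getElem?_append_left hk]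
      · simp [hk]
      · have h3 : ws.length + 1 ≤ k := hk
        simp [hk.ne', List.getElem?_eq_none, h3, hk.le]) (by simp [e, h0]) (by simp [e, h1])
      (by simp [e])
    exact ⟨this.1.trans (by simp [e]), this.2⟩
  | case2 l h' =>
    rcases l with _ | ⟨i, _ | ⟨j, l⟩⟩
    · exact ⟨rfl, h⟩
    · simp [EvalState.block, h0, h1, h2, pairs]
      exact h
    · exact (h' i j l rfl).elim

/-- Subtraction is truncated: if more outputs are requested than wires exist, all wires are output,
as with `drop`. Descriptions with fewer than two numbers leave `out` at zero, and the output is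
empty as it is for the default circuit. -/
theorem EvalState.final (w x : List Bool) :
    let s := (w.foldl (EvalState.feed fun i => x.getD i false) (.init, 0)).1
    (List.range (s.len - (s.len - s.out))).map (fun i => s.wire (s.len - s.out + i)) =
      (Circuit.decode w).eval x := by
  intro s
  have hs : s = (blocks 0 w).foldl (EvalState.block fun i => x.getD i false) .init :=
    EvalState.foldl_feed _ w _ _
  have key : ∀ (ws : List Bool) (o : ℕ), s.Wires ws → s.out = o →
      (List.range (s.len - (s.len - s.out))).map (fun i => s.wire (s.len - s.out + i)) =
        ws.drop (ws.length - o) := by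
    intro ws o h ho
    rw [ho, h.1]
    apply List.ext_getElem
    · simp
    · intro i h1 h2
      simp at h1
      simp [h.2]
      rw [List.getElem?_eq_getElem (by omega)]
      rfl
  unfold Circuit.decode
  rcases hb : blocks 0 w with _ | ⟨a, _ | ⟨o, l⟩⟩
  · rw [hb] at hs
    rw [key [] 0 ⟨by simp [hs, EvalState.init], by simp [hs, EvalState.init]⟩
      (by simp [hs, EvalState.init])]
    simp [Circuit.eval]
  · rw [hb] at hs
    have h0 : s.out = 0 := by simp [hs, EvalState.init, EvalState.block]
    simp [h0, Circuit.eval]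
  · rw [hb] at hs
    simp only [List.foldl_cons] at hs
    have h := EvalState.wires_gates (fun i => x.getD i false) l
      ⟨1, 1, 0, o, 0, a, fun i => if i < a then x.getD i false else false⟩
      ((List.range a).map fun i => x.getD i false) ⟨by simp, fun i => by
        by_cases hi : i < a <;> simp [hi]⟩ rfl rfl rfl
    have e : (EvalState.block (fun i => x.getD i false)
        (EvalState.block (fun i => x.getD i false) .init a) o) =
        ⟨1, 1, 0, o, 0, a, fun i => if i < a then x.getD i false else false⟩ := by
      simp [EvalState.block, EvalState.init]
    rw [e] at hs
    rw [← hs] at h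
    rw [key _ o h.2 h.1]
    rfl

/-! ### A program that evaluates circuits -/

/-- Copy a classical bit. -/
def copyBit (a b : Addr) : Prog Unit := .ite (.bit a) (.write b true) (.write b false)

theorem copyBit_exec (a b : Addr) (μ : Mem) (v : Vec) : (copyBit a b).exec (μ, v) =
    (⟨μ.ctr, Function.update μ.bit (b.cell μ) (μ.bit (a.cell μ))⟩, v) := by
  cases h : μ.bit (a.cell μ) <;> simp [copyBit, Prog.exec, Test.eval, h]

/-- The memory that holds the state `s` (and an unfinished block `a`, at position `p`) in the scratch
registers of `evalCircuit`. -/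
def EvalState.toMem (K : ℕ) (μ : Mem) (s : EvalState × ℕ) (p : ℕ) : Mem where
  ctr x := if x = K then p else if x = K + 1 then s.1.f0 else if x = K + 2 then s.1.f1
    else if x = K + 3 then s.1.f2 else if x = K + 4 then s.2 else if x = K + 5 then s.1.out
    else if x = K + 6 then s.1.gate else if x = K + 7 then s.1.len else μ.ctr x
  bit q := if q.1 = K then s.1.wire q.2 else μ.bit q

/-- Write the value of a gate. -/
def nandBit (a b c : Addr) : Prog Unit :=
  .ite (.bit a) (.ite (.bit b) (.write c false) (.write c true)) (.write c true)

theorem nandBit_exec (a b c : Addr) (ν : Mem × Vec) : (nandBit a b c).exec ν =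
    (⟨ν.1.ctr, Function.update ν.1.bit (c.cell ν.1)
      !(ν.1.bit (a.cell ν.1) && ν.1.bit (b.cell ν.1))⟩, ν.2) := by
  cases h4 : ν.1.bit (a.cell ν.1) <;> cases h5 : ν.1.bit (b.cell ν.1) <;>
    simp [nandBit, Prog.exec, Test.eval, h4, h5]

/-- Process the end of a block. -/
def blockProg (K tx : ℕ) : Prog Unit :=
  .ite (.isZero (K + 1)) (.seq (.inc (K + 1)) (.seq (.clear (K + 7))
    (untilEq (K + 9) (K + 7) (K + 4) (.seq (copyBit ⟨tx, K + 7⟩ ⟨K, K + 7⟩) (.inc (K + 7))))))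
  (.ite (.isZero (K + 2)) (.seq (.inc (K + 2)) (.copy (K + 5) (K + 4)))
  (.ite (.isZero (K + 3)) (.seq (.inc (K + 3)) (.copy (K + 6) (K + 4)))
  (.seq (.clear (K + 3)) (.seq (nandBit ⟨K, K + 6⟩ ⟨K, K + 4⟩ ⟨K, K + 7⟩) (.inc (K + 7))))))

/-- Only the first number, the arity, needs a loop, which copies that many input bits onto the wire
tape; the other cases are straight-line code. The loop has its own flag `K + 9`, as `K + 8` is the
flag of the loop around it. -/
theorem big_blockProg (O : Oracle Unit) (K tx : ℕ) (μ : Mem) (v : Vec) (s : EvalState) (a p : ℕ)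
    (hz : μ.ctr (K + 9) = 0) (htx : tx ≠ K) :
    Big O (a * 10 + 20) (blockProg K tx) (EvalState.toMem K μ (s, a) p) v
      {(EvalState.toMem K μ (s.block (fun i => μ.bit (tx, i)) a, a) p, v)} := by
  unfold blockProg
  refine Big.mono (t := (a * 10 + 18) + 1) (Big.ite ?_) (by omega)
  have e1 : Test.eval (EvalState.toMem K μ (s, a) p) (.isZero (K + 1)) = decide (s.f0 = 0) := by
    simp [Test.eval, EvalState.toMem]
  rw [e1]
  by_cases h0 : s.f0 = 0
  · simp only [h0, decide_true, if_true]
    have h1 := big_untilEq_det (O := O) (z := K + 9) (x := K + 7) (y := K + 4) (t := 5)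
      (body := .seq (copyBit ⟨tx, K + 7⟩ ⟨K, K + 7⟩) (.inc (K + 7)))
      (fun j => (EvalState.toMem K μ ({ s with
        f0 := 1, len := j,
        wire := fun i => if i < j then μ.bit (tx, i) else s.wire i }, a) p, v)) a
      (by simp [EvalState.toMem, hz]) (by simp [EvalState.toMem]; omega) (by simp [EvalState.toMem])
      (by
        intro j hj
        refine (big_exec O (.seq (copyBit ⟨tx, K + 7⟩ ⟨K, K + 7⟩) (.inc (K + 7)))
          ⟨⟨trivial, trivial⟩, trivial⟩ _ _).to (by simp [Prog.size, copyBit]) ?_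
        rw [Prog.exec, copyBit_exec]
        simp only [Prog.exec, Prod.mk.injEq, and_true]
        ext x
        · simp only [EvalState.toMem, Function.update_apply]
          by_cases hx : x = K + 7 <;> simp [hx]
        · obtain ⟨q1, q2⟩ := x
          simp only [EvalState.toMem, Function.update_apply, Addr.cell, Prod.mk.injEq]
          by_cases hq : q1 = K
          · rcases lt_trichotomy q2 j with h2 | h2 | h2
            · simp [hq, h2.ne, h2, h2.trans (Nat.lt_succ_self j)]
            · simp [hq, h2, htx]
            · have : ¬ q2 < j + 1 := by omega
              simp [hq, h2.ne', h2.not_gt, this]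
          · simp [hq])
    refine ((big_exec O (.inc (K + 1)) trivial _ _).seq_det
      (((big_exec O (.clear (K + 7)) trivial _ _).to le_rfl ?_).seq_det h1)).to
      (by simp [Prog.size]; omega) ?_
    · simp only [Prog.exec, Prod.mk.injEq, and_true]
      ext x
      · simp only [EvalState.toMem, Function.update_apply]
        by_cases hx : x = K + 7
        · simp [hx]
        · by_cases hx : x = K + 1 <;> simp [*]
      · simp [EvalState.toMem]
    · simp [EvalState.block, h0]
  · simp only [h0, decide_false, Bool.false_eq_true, if_false]
    refine Big.to (big_exec O _ (by simp [Prog.Straight, nandBit]) _ _)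
      (by simp [Prog.size, nandBit]) ?_
    by_cases h1 : s.f1 = 0
    · have e2 : Test.eval (EvalState.toMem K μ (s, a) p) (.isZero (K + 2)) = true := by
        simp [Test.eval, EvalState.toMem, h1]
      simp only [Prog.exec, e2, if_true, Prod.mk.injEq, and_true]
      ext x
      · simp only [EvalState.toMem, Function.update_apply, EvalState.block, h0, h1, if_true, if_false]
        by_cases hx : x = K + 5
        · simp [hx]
        · by_cases hx' : x = K + 2 <;> simp [hx, hx']
      · simp [EvalState.toMem, EvalState.block, h0, h1]
    · have e2 : Test.eval (EvalState.toMem K μ (s, a) p) (.isZero (K + 2)) = false := by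
        simp [Test.eval, EvalState.toMem, h1]
      by_cases h2 : s.f2 = 0
      · have e3 : Test.eval (EvalState.toMem K μ (s, a) p) (.isZero (K + 3)) = true := by
          simp [Test.eval, EvalState.toMem, h2]
        simp only [Prog.exec, e2, e3, if_true, Bool.false_eq_true, if_false, Prod.mk.injEq, and_true]
        ext x
        · simp only [EvalState.toMem, Function.update_apply, EvalState.block, h0, h1, h2, if_true,
            if_false]
          by_cases hx : x = K + 6
          · simp [hx]
          · by_cases hx' : x = K + 3 <;> simp [hx, hx']
        · simp [EvalState.toMem, EvalState.block, h0, h1, h2]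
      · have e3 : Test.eval (EvalState.toMem K μ (s, a) p) (.isZero (K + 3)) = false := by
          simp [Test.eval, EvalState.toMem, h2]
        simp only [Prog.exec, e2, e3, Bool.false_eq_true, if_false]
        rw [nandBit_exec]
        simp only [Prod.mk.injEq, and_true]
        ext x
        · simp only [EvalState.toMem, Function.update_apply, EvalState.block, h0, h1, h2, if_false]
          by_cases hx : x = K + 7
          · simp [hx]
          · by_cases hx' : x = K + 3 <;> simp [hx, hx']
        · obtain ⟨q1, q2⟩ := x
          simp only [EvalState.toMem, Function.update_apply, EvalState.block, h0, h1, h2, if_false,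
            Addr.cell, Prod.mk.injEq]
          by_cases hq : q1 = K
          · simp [hq]
          · simp [hq]

theorem EvalState.le_of_foldl_block (x : ℕ → Bool) (l : List ℕ) (s : EvalState) :
    (l.foldl (EvalState.block x) s).len ≤ s.len + l.sum + l.length ∧
      (l.foldl (EvalState.block x) s).out ≤ s.out + l.sum := by
  induction l generalizing s with
  | nil => simp
  | cons a l ih =>
    have h := ih (s.block x a)
    have h1 : (s.block x a).len ≤ s.len + a + 1 ∧ (s.block x a).out ≤ s.out + a := by
      unfold EvalState.block
      split_ifs <;> simp <;> omega
    simp only [List.foldl_cons, List.sum_cons, List.length_cons]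
    omega

/-- Each symbol `1` contributes to one number and each `0` ends one. Thanks to this unary encoding
the arity, the number of outputs and the number of wires are at most the length of the description.
-/
theorem blocks_le (a : ℕ) (w : List Bool) : (blocks a w).sum + (blocks a w).length ≤ a + w.length := by
  induction w generalizing a with
  | nil => simp [blocks]
  | cons b w ih =>
    cases b
    · have := ih 0
      simp only [blocks, List.sum_cons, List.length_cons]
      omega
    · have := ih (a + 1)
      simp only [blocks, List.length_cons]
      omega

/-- The part of the program that reads the description of the circuit. -/
def evalLoop (K td tx : ℕ) : Prog Unit :=
  untilEq (K + 8) K td (.seq (.ite (.bit ⟨td, K⟩) (.inc (K + 4))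
    (.seq (blockProg K tx) (.clear (K + 4)))) (.inc K))

/-- The part of the program that writes the output of the circuit. -/
def evalOutput (K dst : ℕ) : Prog Unit :=
  .seq (.copy (K + 10) (K + 7)) (.seq (untilEq (K + 8) (K + 11) (K + 5)
    (.seq (.dec (K + 10)) (.inc (K + 11)))) (.seq (.clear (K + 11))
    (.seq (untilEq (K + 8) (K + 10) (K + 7) (.seq (copyBit ⟨K, K + 10⟩ ⟨dst, K + 11⟩)
      (.seq (.inc (K + 10)) (.inc (K + 11))))) (.copy dst (K + 11)))))

theorem big_evalLoop (O : Oracle Unit) (K td tx L : ℕ) (μ : Mem) (v : Vec) (X : ℕ → Bool)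
    (hctr : ∀ j < 12, μ.ctr (K + j) = 0) (hW : ∀ j, μ.bit (K, j) = false)
    (hXμ : (fun i => μ.bit (tx, i)) = X) (hL : μ.ctr td ≤ L) (htd : td < K) (htx : tx < K) :
    Big O (μ.ctr td * (L * 10 + 30 + 2) + 6) (evalLoop K td tx) μ v
      {(EvalState.toMem K μ ((μ.get td).foldl (EvalState.feed X) (.init, 0)) (μ.ctr td), v)} := by
  set w := μ.get td with hw
  set st : ℕ → EvalState × ℕ := fun j => (w.take j).foldl (EvalState.feed X) (.init, 0) with hst
  have hlen : w.length = μ.ctr td := by simp [hw, Mem.get]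
  have hdiff : ∀ {c : ℕ}, c < K → ∀ j, c ≠ K + j := by intros; omega
  have hsucc : ∀ j < μ.ctr td, st (j + 1) = EvalState.feed X (st j) (μ.bit (td, j)) := by
    intro j hj
    simp only [hst, List.take_add_one, List.foldl_append]
    simp [hw, Mem.get, hj]
  -- The unfinished number never exceeds the count of symbols read, which bounds the cost of
  -- processing it.
  have hacc : ∀ j, (st j).2 ≤ j := fun j =>
    (EvalState.feed_snd_le X (w.take j) .init 0).trans (by simp)
  have h1 := big_untilEq_det (O := O) (z := K + 8) (x := K) (y := td) (t := L * 10 + 30)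
    (body := .seq (.ite (.bit ⟨td, K⟩) (.inc (K + 4))
      (.seq (blockProg K tx) (.clear (K + 4)))) (.inc K))
    (fun j => (EvalState.toMem K μ (st j) j, v)) (μ.ctr td)
    (by simp [EvalState.toMem, hctr 8])
    (by
      intro j hj
      have := hdiff htd
      have := hdiff htd 0
      simp_all [EvalState.toMem]; omega)
    (by have := hdiff htd
        have := hdiff htd 0
        simp_all [EvalState.toMem])
    (by
      intro j hj
      have hK : td ≠ K := htd.ne
      have hb : (EvalState.toMem K μ (st j) j).bit (td, j) = μ.bit (td, j) := by
        simp [EvalState.toMem, hK]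
      have hc : (Addr.mk td K).cell (EvalState.toMem K μ (st j) j) = (td, j) := by
        simp [Addr.cell, EvalState.toMem]
      have hfin : Big O (L * 10 + 28) (.ite (.bit ⟨td, K⟩) (.inc (K + 4))
          (.seq (blockProg K tx) (.clear (K + 4)))) (EvalState.toMem K μ (st j) j) v
          {(EvalState.toMem K μ (st (j + 1)) j, v)} := by
        refine Big.mono (t := (L * 10 + 26) + 1) (Big.ite ?_) (by omega)
        rw [Test.eval, hc, hb, hsucc j hj]
        cases hbit : μ.bit (td, j)
        · simp only [Bool.false_eq_true, if_false, EvalState.feed]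
          have h2 := big_blockProg O K tx μ v (st j).1 (st j).2 j (hctr 9 (by norm_num)) htx.ne
          rw [hXμ] at h2
          have := hacc j
          refine (h2.seq_det (big_exec O (.clear (K + 4)) trivial _ _)).to
            (by simp [Prog.size]; omega) ?_
          simp only [Prog.exec, Prod.mk.injEq, and_true]
          ext c
          · simp only [EvalState.toMem, Function.update_apply]
            by_cases hc : c = K + 4 <;> simp [hc]
          · rfl
        · simp only [if_true, EvalState.feed]
          refine (big_exec O (.inc (K + 4)) trivial _ _).to (by simp [Prog.size]) ?_
          simp only [Prog.exec, Prod.mk.injEq, and_true]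
          ext c
          · simp only [EvalState.toMem, Function.update_apply]
            by_cases hc : c = K + 4 <;> simp [hc]
          · rfl
      refine (hfin.seq_det (big_exec O (.inc K) trivial _ _)).to (by simp [Prog.size]) ?_
      simp only [Prog.exec, Prod.mk.injEq, and_true]
      ext c
      · simp only [EvalState.toMem, Function.update_apply]
        by_cases hc : c = K <;> simp [hc]
      · rfl)
  have hst0 : EvalState.toMem K μ (st 0) 0 = μ := by
    ext c
    · simp only [EvalState.toMem, hst, List.take_zero, List.foldl_nil, EvalState.init]
      split_ifs with a0 a1 a2 a3 a4 a5 a6 a7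
      · rw [a0]; exact (hctr 0 (by norm_num)).symm
      · rw [a1]; exact (hctr 1 (by norm_num)).symm
      · rw [a2]; exact (hctr 2 (by norm_num)).symm
      · rw [a3]; exact (hctr 3 (by norm_num)).symm
      · rw [a4]; exact (hctr 4 (by norm_num)).symm
      · rw [a5]; exact (hctr 5 (by norm_num)).symm
      · rw [a6]; exact (hctr 6 (by norm_num)).symm
      · rw [a7]; exact (hctr 7 (by norm_num)).symm
      · rfl
    · obtain ⟨q1, q2⟩ := c
      simp only [EvalState.toMem, hst, List.take_zero, List.foldl_nil, EvalState.init]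
      split_ifs with h
      · have h : q1 = K := h
        rw [h, hW]
      · rfl
  simp only [hst0] at h1
  have hstw : st (μ.ctr td) = w.foldl (EvalState.feed X) (.init, 0) := by
    rw [hst]; simp only; rw [← hlen, List.take_length]
  rw [← hstw]
  exact h1

theorem big_evalOutput (O : Oracle Unit) (K dst L : ℕ) (μ₁ : Mem) (v : Vec) (s : EvalState)
    (c7 : μ₁.ctr (K + 7) = s.len) (c5 : μ₁.ctr (K + 5) = s.out) (c8 : μ₁.ctr (K + 8) = 0)
    (c11 : μ₁.ctr (K + 11) = 0) (cW : ∀ i, μ₁.bit (K, i) = s.wire i) (hle : s.len ≤ L ∧ s.out ≤ L)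
    (hto : dst < K) (out : List Bool)
    (hout : (List.range (s.len - (s.len - s.out))).map (fun i => s.wire (s.len - s.out + i)) = out) :
    Big O (L * 20 + 40) (evalOutput K dst) μ₁ v {(⟨Function.update
      (((μ₁.fill dst out).setC (K + 10) (s.len - s.out + (s.len - (s.len - s.out)))).setC (K + 11)
        (s.len - (s.len - s.out))).ctr dst (s.len - (s.len - s.out)), (μ₁.fill dst out).bit⟩, v)} := by
  have h2 := big_exec O (.copy (K + 10) (K + 7)) trivial μ₁ v
  -- Decrementing stops at zero, so counter `K + 10` ends at the truncated difference of the number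
  -- of wires and the number of outputs, the position of the first output wire.
  have h3 := big_untilEq_det (O := O) (z := K + 8) (x := K + 11) (y := K + 5) (t := 3)
    (body := .seq (.dec (K + 10)) (.inc (K + 11)))
    (fun j => ((μ₁.setC (K + 10) (s.len - j)).setC (K + 11) j, v)) s.out
    (by simp [c8]) (by simp [c5]; omega) (by simp [c5])
    (by
      intro j _
      refine (big_exec O (.seq (.dec (K + 10)) (.inc (K + 11))) ⟨trivial, trivial⟩ _ _).to
        (by simp [Prog.size]) ?_
      simp only [Prog.exec, Prod.mk.injEq, and_true]
      ext c
      · simp only [Mem.setC_ctr, Function.update_apply]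
        by_cases hc : c = K + 10
        · simp [hc]; omega
        · by_cases hc' : c = K + 11 <;> simp [hc, hc']
      · rfl)
  set s0 := s.len - s.out with hs0
  have h4 := big_untilEq_det (O := O) (z := K + 8) (x := K + 10) (y := K + 7) (t := 7)
    (body := .seq (copyBit ⟨K, K + 10⟩ ⟨dst, K + 11⟩) (.seq (.inc (K + 10)) (.inc (K + 11))))
    (fun j => (((μ₁.fill dst ((List.range j).map fun i => s.wire (s0 + i))).setC
      (K + 10) (s0 + j)).setC (K + 11) j, v)) (s.len - s0)
    (by simp [c8]) (by simp [c7]; omega) (by simp [c7]; omega)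
    (by
      intro j _
      refine Big.to (big_exec O _ (by simp [Prog.Straight, copyBit]) _ _)
        (by simp [Prog.size, copyBit]) ?_
      rw [Prog.exec, copyBit_exec]
      simp only [Prog.exec, Prod.mk.injEq, and_true, List.range_succ, List.map_append,
        List.map_cons, List.map_nil, Mem.fill_snoc]
      have hK : ¬ K = dst := hto.ne'
      ext c
      · simp only [Mem.setC_ctr, Mem.fill_ctr, Function.update_apply]
        by_cases hc : c = K + 10
        · simp [hc]; omega
        · by_cases hc' : c = K + 11 <;> simp [hc, hc']
      · simp [Addr.cell, Mem.fill_bit, cW, hK])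
  rw [hout] at h4
  have e1 : Prog.exec (Q := Unit) (.copy (K + 10) (K + 7)) (μ₁, v) =
      ((μ₁.setC (K + 10) (s.len - 0)).setC (K + 11) 0, v) := by
    simp only [Prog.exec, Prod.mk.injEq, and_true]
    rw [Mem.setC_self (μ₁.setC (K + 10) (s.len - 0)) (K + 11) (by simp [c11])]
    simp [Mem.setC, c7]
  have e2 : Prog.exec (Q := Unit) (.clear (K + 11)) ((μ₁.setC (K + 10) s0).setC (K + 11) s.out, v) =
      (((μ₁.fill dst ((List.range 0).map fun i => s.wire (s0 + i))).setC
        (K + 10) (s0 + 0)).setC (K + 11) 0, v) := by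
    simp only [Prog.exec, Prod.mk.injEq, and_true, List.range_zero, List.map_nil, Mem.fill_nil]
    simp [Mem.setC]
  rw [e1] at h2
  have h5 := big_exec O (.clear (K + 11)) trivial ((μ₁.setC (K + 10) s0).setC (K + 11) s.out) v
  rw [e2] at h5
  refine (h2.seq_det (h3.seq_det (h5.seq_det (h4.seq_det
    (big_exec O (.copy dst (K + 11)) trivial _ _))))).to ?_ ?_
  · simp only [Prog.size]
    omega
  · simp only [Prog.exec, Prod.mk.injEq, and_true]
    simp [Mem.setC]

/-- Evaluate the circuit that is described on tape `td`, on the input on tape `tx`, and write the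
output on tape `dst`. The scratch registers are those from `K` on. -/
def evalCircuit (K td tx dst : ℕ) : Prog Unit := .seq (evalLoop K td tx) (evalOutput K dst)

/-- The final contents of the scratch registers are left unspecified on tape `K` and the counters
from `K` to `K + 11`; every evaluation gets a fresh block of registers. The running time is
quadratic in the bound `L` on the description, since each symbol may end a number of size up to `L`.
-/
theorem big_evalCircuit (O : Oracle Unit) (K td tx dst L : ℕ) (μ : Mem) (v : Vec) (x : List Bool)
    (hctr : ∀ j < 12, μ.ctr (K + j) = 0) (hW : ∀ j, μ.bit (K, j) = false)
    (hx : ∀ i, μ.bit (tx, i) = x.getD i false) (hL : μ.ctr td ≤ L)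
    (htd : td < K) (htx : tx < K) (hto : dst < K) :
    ∃ μ', Big O (L * (L * 10 + 100) + 100) (evalCircuit K td tx dst) μ v {(μ', v)} ∧
      (∀ c < K, c ≠ dst → μ'.ctr c = μ.ctr c) ∧ (∀ c, K + 12 ≤ c → μ'.ctr c = μ.ctr c) ∧
      μ'.ctr dst = ((Circuit.decode (μ.get td)).eval x).length ∧
      ∀ q : Cell, q.1 ≠ K → μ'.bit q = (μ.fill dst ((Circuit.decode (μ.get td)).eval x)).bit q := by
  set w := μ.get td with hw
  set X : ℕ → Bool := fun i => x.getD i false with hX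
  have hlen : w.length = μ.ctr td := by simp [hw, Mem.get]
  have hXμ : (fun i => μ.bit (tx, i)) = X := funext hx
  have h1 := big_evalLoop O K td tx L μ v X hctr hW hXμ hL htd htx
  set st := (μ.get td).foldl (EvalState.feed X) (.init, 0) with hst
  set s := st.1 with hs
  have hsw : s = (w.foldl (EvalState.feed X) (.init, 0)).1 := rfl
  have hfinal : (List.range (s.len - (s.len - s.out))).map (fun i => s.wire (s.len - s.out + i)) =
      (Circuit.decode w).eval x := by
    have := EvalState.final w x
    rwa [← hX, ← hsw] at this
  have hle : s.len ≤ L ∧ s.out ≤ L := by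
    have h2 := EvalState.le_of_foldl_block X (blocks 0 w) .init
    have h3 := blocks_le 0 w
    rw [← EvalState.foldl_feed, ← hsw] at h2
    simp only [EvalState.init] at h2
    omega
  set μ₁ := EvalState.toMem K μ st (μ.ctr td) with hμ₁
  have c7 : μ₁.ctr (K + 7) = s.len := by simp [hμ₁, EvalState.toMem, hs]
  have c5 : μ₁.ctr (K + 5) = s.out := by simp [hμ₁, EvalState.toMem, hs]
  have c8 : μ₁.ctr (K + 8) = 0 := by simp [hμ₁, EvalState.toMem, hctr]
  have c11 : μ₁.ctr (K + 11) = 0 := by simp [hμ₁, EvalState.toMem, hctr]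
  have cW : ∀ i, μ₁.bit (K, i) = s.wire i := by simp [hμ₁, EvalState.toMem, hs]
  have h2 := big_evalOutput O K dst L μ₁ v s c7 c5 c8 c11 cW hle hto _ hfinal
  set out := (Circuit.decode w).eval x with hout
  have hol : out.length = s.len - (s.len - s.out) := by rw [← hfinal]; simp
  have hdiff : ∀ {c : ℕ}, c < K → ∀ j, c ≠ K + j := by intros; omega
  have h6 : μ.ctr td * (L * 10 + 30 + 2) ≤ L * (L * 10 + 30 + 2) := Nat.mul_le_mul_right _ hL
  refine ⟨_, (h1.seq_det h2).mono (by nlinarith), ?_, ?_, ?_, ?_⟩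
  · intro c hc hne
    have h5 := hdiff hc
    have h6 := hdiff hc 0
    simp only [Function.update_of_ne hne, Mem.setC_ctr, Mem.fill_ctr, Function.update_of_ne (h5 11),
      Function.update_of_ne (h5 10)]
    simp only [hμ₁, EvalState.toMem, h5, if_false]
    simp only [Nat.add_zero] at h6
    simp [h6]
  · intro c hc
    have h5 : ∀ j < 12, c ≠ K + j := by intro j _; omega
    have h6 : c ≠ dst := by omega
    have h7 : c ≠ K := by omega
    simp only [Function.update_of_ne h6, Mem.setC_ctr, Mem.fill_ctr,
      Function.update_of_ne (h5 11 (by norm_num)), Function.update_of_ne (h5 10 (by norm_num))]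
    simp [hμ₁, EvalState.toMem, h5, h7]
  · simp [hol]
  · intro q hq
    simp only [Mem.fill_bit, hμ₁, EvalState.toMem, hq, if_false]

/-! ### Challenges -/

/-- Set counter `1` to twice the value of counter `0`. -/
def double (B : ℕ) : Prog Unit :=
  .seq (.copy 1 0) (.seq (untilEq (B + 1) (B + 2) 0 (.seq (.inc 1) (.inc (B + 2)))) (.clear (B + 2)))

theorem big_double (O : Oracle Unit) (B n : ℕ) (μ : Mem) (v : Vec) (hB : 3 ≤ B) (h0 : μ.ctr 0 = n)
    (hz : μ.ctr (B + 1) = 0) (hi : μ.ctr (B + 2) = 0) :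
    Big O (n * 20 + 20) (double B) μ v {(μ.setC 1 (n + n), v)} := by
  have hB0 : B ≠ 0 := by omega
  have h1 := big_exec O (.copy 1 0) trivial μ v
  have h2 := big_untilEq_det (O := O) (z := B + 1) (x := B + 2) (y := 0) (t := 3)
    (body := .seq (.inc 1) (.inc (B + 2)))
    (fun j => ((μ.setC 1 (n + j)).setC (B + 2) j, v)) n
    (by simp [hz, hB0]) (by simp [h0]; omega) (by simp [h0])
    (by
      intro j _
      refine (big_exec O (.seq (.inc 1) (.inc (B + 2))) ⟨trivial, trivial⟩ _ _).to
        (by simp [Prog.size]) ?_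
      simp only [Prog.exec, Prod.mk.injEq, and_true]
      ext c
      · simp only [Mem.setC_ctr, Function.update_apply]
        by_cases hc : c = B + 2
        · simp [hc]
        · by_cases hc' : c = 1 <;> simp [hc, hc']; omega
      · rfl)
  have e0 : (μ.setC 1 (n + 0)).setC (B + 2) 0 = μ.setC 1 n :=
    Mem.setC_self _ _ (by simp [hi])
  have e1 : Prog.exec (Q := Unit) (.copy 1 0) (μ, v) = (μ.setC 1 n, v) := by
    simp [Prog.exec, Mem.setC, h0]
  rw [e1] at h1
  simp only [e0] at h2
  refine (h1.seq_det (h2.seq_det (big_exec O (.clear (B + 2)) trivial _ _))).to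
    (by simp [Prog.size]; omega) ?_
  have e2 : ((μ.setC 1 (n + n)).setC (B + 2) n).setC (B + 2) 0 = μ.setC 1 (n + n) := by
    rw [Mem.setC_setC, Mem.setC_self]
    simp [hi]
  simp only [Prog.exec, Prod.mk.injEq, and_true]
  exact e2

theorem Mem.setC_fill (μ : Mem) (x k t : ℕ) (w : List Bool) :
    (μ.setC x k).fill t w = (μ.fill t w).setC x k := rfl

theorem Mem.put_eq (μ : Mem) (t : ℕ) (w : List Bool) :
    μ.put t w = (μ.fill t w).setC t w.length := rfl

/-- A uniformly random challenge on tape `1`. -/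
def uniformChallenge (B : ℕ) : Prog Unit := .seq (double B) (coin B 1 1)

theorem big_uniformChallenge (O : Oracle Unit) (B n : ℕ) (μ : Mem) (v : Vec) (hB : 3 ≤ B)
    (h0 : μ.ctr 0 = n) (hz : μ.ctr (B + 1) = 0) (hi : μ.ctr (B + 2) = 0) :
    Big O (n * 100 + 100) (uniformChallenge B) μ v
      ((coinLists (n + n)).map fun l => (μ.put 1 l, coinsVec (B + 2, 0) l v)) := by
  have h1 := big_double O B n μ v hB h0 hz hi
  have h2 := big_coin O B 1 1 (μ.setC 1 (n + n)) v (by simp [hz, show B ≠ 0 by omega]) (by simp [hi]) (by omega)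
  have e : (μ.setC 1 (n + n)).ctr 1 = n + n := by simp
  rw [e] at h2
  have h3 := (h1.seq_det h2).mono (t' := n * 100 + 100) (by omega)
  have e2 : ((coinLists (n + n)).map fun l => (μ.put 1 l, coinsVec (B + 2, 0) l v)) =
      (coinLists (n + n)).map fun l => ((μ.setC 1 (n + n)).fill 1 l, coinsVec (B + 2, 0) l v) := by
    refine Multiset.map_congr rfl fun l hl => ?_
    rw [Mem.put_eq, length_of_mem_coinLists hl, Mem.setC_fill]
  rw [e2]
  exact h3

/-! ### Producing an honest ciphertext as a classical string -/

/-- The state after qubit `q` has been measured as `b` and reset. -/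
noncomputable def measBit (q : Cell) (v : Vec) (b : Bool) : Vec :=
  if b then flipGate [] q (project q b v) else project q b v

/-- The state after the qubits on tape `Y` from position `k` on have been measured and reset. -/
noncomputable def measVec (Y : ℕ) : ℕ → List Bool → Vec → Vec
  | _, [], v => v
  | k, b :: l, v => measVec Y (k + 1) l (measBit (Y, k) v b)

/-- Add the bits of `m`, from position `k` on, to a string. -/
def mask (m : ℕ → Bool) : ℕ → List Bool → List Bool
  | _, [] => []
  | k, b :: l => xor b (m k) :: mask m (k + 1) l

theorem length_mask (m : ℕ → Bool) (k : ℕ) (l : List Bool) : (mask m k l).length = l.length := by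
  induction l generalizing k with
  | nil => rfl
  | cons b l ih => simp [mask, ih]

/-- Measure a qubit of the pad on tape `B + 3`, reset it, and write the outcome, plus a bit of the
plaintext on tape `B + 6`, on tape `1`. -/
def padBit (B : ℕ) : Prog Unit :=
  .seq (.measure ⟨B + 3, B + 2⟩ ⟨1, B + 3⟩)
    (.seq (.ite (.bit ⟨1, B + 3⟩) (.flip [] ⟨B + 3, B + 2⟩) .skip)
    (.seq (.ite (.bit ⟨B + 6, B + 2⟩) (nandBit ⟨1, B + 3⟩ ⟨1, B + 3⟩ ⟨1, B + 3⟩) .skip)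
    (.seq (.inc (B + 2)) (.inc (B + 3)))))

/-- Measure the pad and write the second half of the challenge. -/
def padLoop (B : ℕ) : Prog Unit :=
  .seq (.copy (B + 3) B) (.seq (untilEq (B + 1) (B + 2) B (padBit B))
    (.seq (.clear (B + 2)) (.clear (B + 3))))

/-- The challenge is a classical string, so the pad is measured instead of uncomputed, and the reset
blanks its register. All outcomes are listed because the oracle is arbitrary; for a function oracle
only one has nonzero weight, see `loadVec_measVec`. A plaintext bit `1` is added by a NAND of the
cell with itself. -/
theorem big_padLoop (O : Oracle Unit) (B n : ℕ) (μ : Mem) (v : Vec) (hB : 3 ≤ B)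
    (h : Counters B n μ) (ρ : List Bool) (hρ : ρ.length = n) :
    Big O (n * 30 + 30) (padLoop B) (μ.fill 1 ρ) v ((coinLists n).map fun u =>
      (μ.fill 1 (ρ ++ mask (fun i => μ.bit (B + 6, i)) 0 u), measVec (B + 3) 0 u v)) := by
  set m : ℕ → Bool := fun i => μ.bit (B + 6, i) with hm
  set st : List Bool → Mem := fun l =>
    ((μ.fill 1 (ρ ++ l)).setC (B + 2) l.length).setC (B + 3) (n + l.length) with hst
  set β : Mem × Vec → Multiset (Mem × Vec) := fun p => (Finset.univ : Finset Bool).val.map fun b =>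
    (⟨Function.update (Function.update p.1.ctr (B + 2) (p.1.ctr (B + 2) + 1)) (B + 3)
        (p.1.ctr (B + 3) + 1),
      Function.update p.1.bit (1, p.1.ctr (B + 3)) (xor b (p.1.bit (B + 6, p.1.ctr (B + 2))))⟩,
      measBit (B + 3, p.1.ctr (B + 2)) p.2 b) with hβ
  have hB6 : B + 6 ≠ 1 := by omega
  have hstm : ∀ l i, (st l).bit (B + 6, i) = m i := by
    intro l i
    simp [hst, hm, Mem.fill_bit, hB6]
  have hst2 : ∀ l, (st l).ctr (B + 2) = l.length := by intro l; simp [hst]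
  have hst3 : ∀ l, (st l).ctr (B + 3) = n + l.length := by intro l; simp [hst]
  have hβst : ∀ l v, β (st l, v) = (Finset.univ : Finset Bool).val.map fun b =>
      (st (l ++ [xor b (m l.length)]), measBit (B + 3, l.length) v b) := by
    intro l v
    refine Multiset.map_congr rfl fun b _ => ?_
    simp only [hst2, hst3, hstm, Prod.mk.injEq, and_true]
    simp only [hst]
    rw [← List.append_assoc, Mem.fill_snoc]
    ext c
    · simp only [Mem.setC_ctr, Mem.fill_ctr, Function.update_apply]
      by_cases hc : c = B + 3
      · simp [hc]; omega
      · by_cases hc' : c = B + 2 <;> simp [hc, hc']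
    · simp [hρ]
  have hiter : ∀ k l v, iter β k (st l, v) = (coinLists k).map fun l' =>
      (st (l ++ mask m l.length l'), measVec (B + 3) l.length l' v) := by
    intro k
    induction k with
    | zero => intro l v; simp [iter, coinLists, mask, measVec]
    | succ k ih =>
      intro l v
      rw [iter, hβst, Multiset.bind_map, coinLists, Multiset.map_bind]
      refine Multiset.bind_congr fun b _ => ?_
      rw [ih, Multiset.map_map]
      refine Multiset.map_congr rfl fun l' _ => ?_
      simp [mask, measVec]
  have hbody : ∀ l v, Big O 25 (padBit B) (st l) v (β (st l, v)) := by
    intro l v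
    have h2 := (big_measure O ⟨B + 3, B + 2⟩ ⟨1, B + 3⟩ (st l) v).seq
      (R := (.seq (.ite (.bit ⟨1, B + 3⟩) (.flip [] ⟨B + 3, B + 2⟩) .skip)
        (.seq (.ite (.bit ⟨B + 6, B + 2⟩) (nandBit ⟨1, B + 3⟩ ⟨1, B + 3⟩ ⟨1, B + 3⟩) .skip)
        (.seq (.inc (B + 2)) (.inc (B + 3))))))
      (fun p _ => big_exec O _ (by simp [Prog.Straight, nandBit]) p.1 p.2)
    have h := h2.mono (t' := 25) (by simp [Prog.size, nandBit])
    rw [padBit]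
    convert h using 1
    rw [Multiset.bind_map, Multiset.bind_singleton]
    refine Multiset.map_congr rfl fun b _ => ?_
    have hne : ∀ i j, ((B + 6, i) : Cell) ≠ (1, j) := fun i j h => hB6 (congrArg Prod.fst h)
    simp only [Prog.exec, nandBit_exec]
    cases b <;> cases hmb : (st l).bit (B + 6, (st l).ctr (B + 2)) <;>
      simp [Test.eval, Addr.cell, measBit, hmb, hne]
  have h1 := big_exec O (.copy (B + 3) B) trivial (μ.fill 1 ρ) v
  have e1 : Prog.exec (Q := Unit) (.copy (B + 3) B) (μ.fill 1 ρ, v) = (st [], v) := by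
    simp only [Prog.exec, Prod.mk.injEq, and_true, hst]
    ext c
    · simp only [Mem.fill_ctr, Mem.setC_ctr, Function.update_apply, List.length_nil, h.len,
        Nat.add_zero]
      by_cases hc : c = B + 3
      · simp [hc]
      · by_cases hc' : c = B + 2
        · simp [hc', h.i]
        · simp [hc, hc']
    · simp
  rw [e1] at h1
  have h2 := big_untilEq (O := O) (z := B + 1) (x := B + 2) (y := B) (t := 25) β
    (fun k p => ∃ l v, p = (st l, v) ∧ l.length + k = n)
    (by rintro k p ⟨l, v, rfl, -⟩; simp [hst, h.z])
    (by rintro p ⟨l, v, rfl, hl⟩; simp [hst, h.len]; omega)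
    (by
      rintro k p ⟨l, v, rfl, hl⟩
      refine ⟨by simp [hst, h.len]; omega, hbody l v, ?_⟩
      rw [hβst]
      intro q hq
      obtain ⟨b, -, rfl⟩ := Multiset.mem_map.1 hq
      exact ⟨_, _, rfl, by simp; omega⟩)
    n (st [], v) ⟨[], v, rfl, by simp⟩
  rw [hiter] at h2
  have h3 := h1.seq_det (h2.seq (R := .seq (.clear (B + 2)) (.clear (B + 3))) (fun p _ => big_exec O (.seq (.clear (B + 2)) (.clear (B + 3)))
    ⟨trivial, trivial⟩ p.1 p.2))
  have h4 := h3.mono (t' := n * 30 + 30) (by simp [Prog.size]; omega)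
  rw [padLoop]
  convert h4 using 1
  rw [Multiset.bind_map, Multiset.bind_singleton]
  refine Multiset.map_congr rfl fun l _ => ?_
  simp only [Prog.exec, Prod.mk.injEq, List.nil_append, List.length_nil, and_true, hst]
  ext c
  · simp only [Mem.fill_ctr, Mem.setC_ctr, Function.update_apply]
    by_cases hc : c = B + 3
    · simp [hc, h.j]
    · by_cases hc' : c = B + 2
      · simp [hc', h.i]
      · simp [hc, hc']
  · rfl

/-- The encryption of the plaintext on tape `B + 6`, on tape `1`. -/
def realChallenge (B : ℕ) : Prog Unit :=
  .seq (double B) (.seq (coin B 1 0) (.seq (load B 1) (.seq (.query () (B + 2) (B + 3))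
    (.seq (padLoop B) (load B 1)))))

/-- The effect of `realChallenge`, for any oracle. -/
noncomputable def realSem (O : Oracle Unit) (B n : ℕ) (m : ℕ → Bool) (v : Vec) :
    Multiset (List Bool × Vec) :=
  (coinLists n).bind fun ρ =>
    (O () (B + 2) (B + 3) (loadVec B ρ (coinsVec (B + 2, 0) ρ v))).bind fun w =>
      (coinLists n).map fun u => (ρ ++ mask m 0 u, loadVec B ρ (measVec (B + 3) 0 u w))

theorem big_realChallenge (O : Oracle Unit) (B n : ℕ) (μ : Mem) (v : Vec) (hB : 3 ≤ B)
    (h : Counters B n μ) (h0 : μ.ctr 0 = n) :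
    Big O (n * 200 + 200) (realChallenge B) μ v
      ((realSem O B n (fun i => μ.bit (B + 6, i)) v).map fun p => (μ.put 1 p.1, p.2)) := by
  have h1 := big_double O B n μ v hB h0 h.z h.i
  set μ' := μ.setC 1 (n + n) with hμ'
  have hB0 : 0 ≠ 1 := by omega
  have hC : Counters B n μ' := by
    have b0 : B ≠ 1 := by omega
    have b1 : B + 1 ≠ 1 := by omega
    have b2 : B + 2 ≠ 1 := by omega
    have b3 : B + 3 ≠ 1 := by omega
    constructor <;>
      simp only [hμ', Mem.setC_ctr, Function.update_of_ne b0, Function.update_of_ne b1,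
        Function.update_of_ne b2, Function.update_of_ne b3, h.len, h.z, h.i, h.j]
  have h2 := big_coin O B 1 0 μ' v hC.z hC.i (by omega)
  have e : μ'.ctr 0 = n := by simp [hμ', h0]
  rw [e] at h2
  -- At the second call tape `1` holds the whole challenge, but only its first `n` bits are read,
  -- and these are still the coins; so the input register is cleared.
  have hload : ∀ (ρ l : List Bool) (w : Vec), ρ.length = n → Big O (n * 20 + 20) (load B 1)
      (μ'.fill 1 (ρ ++ l)) w {(μ'.fill 1 (ρ ++ l), loadVec B ρ w)} := by
    intro ρ l w hl
    refine (big_load O B 1 n (μ'.fill 1 (ρ ++ l)) w hC.len hC.z hC.i).to le_rfl ?_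
    simp only [Prod.mk.injEq, true_and, loadVec]
    refine bmap_congr fun e _ => ?_
    funext q
    simp only [loadFn, hl]
    split_ifs with hq
    · have h3 : q.2 < ρ.length := by omega
      have h4 : q.2 < n + l.length := by omega
      simp [Mem.fill_bit, hl, h4, List.getElem_append_left h3, List.getElem?_eq_getElem h3]
    · rfl
  have h3 : ∀ ρ ∈ coinLists n, Big O (n * 80 + 90)
      (.seq (load B 1) (.seq (.query () (B + 2) (B + 3)) (.seq (padLoop B) (load B 1))))
      (μ'.fill 1 ρ) (coinsVec (B + 2, 0) ρ v)
      ((O () (B + 2) (B + 3) (loadVec B ρ (coinsVec (B + 2, 0) ρ v))).bind fun w =>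
        (coinLists n).bind fun u => {(μ'.fill 1 (ρ ++ mask (fun i => μ'.bit (B + 6, i)) 0 u),
          loadVec B ρ (measVec (B + 3) 0 u w))}) := by
    intro ρ hρ
    have hl := length_of_mem_coinLists hρ
    have := hload ρ [] (coinsVec (B + 2, 0) ρ v) hl
    rw [List.append_nil] at this
    refine (this.seq_det (Big.query_seq (O := O) fun w =>
      (big_padLoop O B n μ' w hB hC ρ hl).seq_map fun u _ => hload ρ _ _ hl)).mono (by omega)
  have h4 := (h1.seq_det (h2.seq_map h3)).mono (t' := n * 200 + 200) (by omega)
  have e2 : ((realSem O B n (fun i => μ.bit (B + 6, i)) v).map fun p => (μ.put 1 p.1, p.2)) =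
      (coinLists n).bind fun ρ =>
        (O () (B + 2) (B + 3) (loadVec B ρ (coinsVec (B + 2, 0) ρ v))).bind fun w =>
        (coinLists n).bind fun u => {(μ'.fill 1 (ρ ++ mask (fun i => μ'.bit (B + 6, i)) 0 u),
          loadVec B ρ (measVec (B + 3) 0 u w))} := by
    simp only [realSem, Multiset.map_bind, Multiset.map_map, Multiset.bind_singleton]
    refine Multiset.bind_congr fun ρ hρ => Multiset.bind_congr fun w _ =>
      Multiset.map_congr rfl fun u hu => ?_
    simp only [Function.comp, Mem.put_eq, List.length_append, length_mask,
      length_of_mem_coinLists hρ, length_of_mem_coinLists hu]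
    rfl
  rw [e2]
  exact h4

/-! ### The challenger and the final test -/

/-- For loops that fill tape `R` cell by cell: the hypothesis on the body lets it rely on the
original contents of the other tapes only. -/
theorem big_forLoop_write {O : Oracle Unit} {B t : ℕ} {body : Prog Unit} (n R : ℕ) (g : ℕ → Bool)
    (μ : Mem) (v : Vec) (hn : μ.ctr B = n) (hz : μ.ctr (B + 1) = 0) (hi : μ.ctr (B + 2) = 0)
    (hb : ∀ k < n, ∀ ν : Mem, ν.ctr (B + 2) = k → (∀ q : Cell, q.1 ≠ R → ν.bit q = μ.bit q) →
      Big O t body ν v {(⟨ν.ctr, Function.update ν.bit (R, k) (g k)⟩, v)}) :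
    Big O (n * (t + 4) + 8) (forLoop B body) μ v
      {(⟨μ.ctr, fun q => if q.1 = R ∧ q.2 < n then g q.2 else μ.bit q⟩, v)} := by
  have h := big_forLoop (O := O) (B := B) (t := t) (body := body)
    (fun k => ⟨μ.ctr, fun q => if q.1 = R ∧ q.2 < k then g q.2 else μ.bit q⟩) (fun _ => v) n
    (fun _ => hn) (fun _ => hz) (fun _ => hi) (by
      intro k hk
      refine (hb k hk _ (by simp) (by intro q hq; simp [Mem.setC, hq])).to le_rfl ?_
      simp only [Prod.mk.injEq, and_true]
      ext x
      · rfl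
      · obtain ⟨x1, x2⟩ := x
        simp only [Mem.setC, Function.update_apply, Prod.mk.injEq]
        by_cases h1 : x1 = R
        · rcases lt_trichotomy x2 k with h2 | h2 | h2
          · simp [h1, h2, h2.ne, h2.trans (Nat.lt_succ_self k)]
          · simp [h1, h2]
          · simp [h1, h2.ne', not_lt.2 h2.le, not_lt.2 (Nat.succ_le_of_lt h2)]
        · simp [h1])
  refine h.mono le_rfl |>.to le_rfl rfl |> fun h' => ?_
  have e : (⟨μ.ctr, fun q => if q.1 = R ∧ q.2 < 0 then g q.2 else μ.bit q⟩ : Mem) = μ := by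
    ext <;> simp
  simpa only [e] using h'

theorem Mem.get_congr {μ ν : Mem} {t : ℕ} (h : μ.ctr t = ν.ctr t)
    (h' : ∀ i, μ.bit (t, i) = ν.bit (t, i)) : μ.get t = ν.get t := by
  simp [Mem.get, h, h']

theorem Mem.get_eq {μ : Mem} {t : ℕ} {w : List Bool} (h : μ.ctr t = w.length)
    (h' : ∀ i < w.length, μ.bit (t, i) = w.getD i false) : μ.get t = w := by
  refine List.ext_getElem (by simp [Mem.get, h]) fun i h1 h2 => ?_
  simp [Mem.get, h' i h2, h2]

/-- Run the challenger: evaluate `Samp` on the coins on tape `B + 4`, put the plaintext on tape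
`B + 6`, the target `f(m)` on tape `B + 7`, and restart the adversary with `1ⁿ` and `h(m)`. -/
def challenger (B : ℕ) : Prog Unit :=
  .seq (evalCircuit (B + 20) 0 (B + 4) (B + 5))
    (.seq (forLoop B (copyBit ⟨B + 5, B + 2⟩ ⟨B + 6, B + 2⟩))
    (.seq (evalCircuit (B + 40) 2 (B + 6) (B + 7))
    (.seq (evalCircuit (B + 60) 1 (B + 6) 2)
    (.seq (.copy 0 B) (forLoop B (.write ⟨0, B + 2⟩ true))))))

/-- The plaintext that the template `t` yields with the coins `l`. -/
def Template.msg (t : Template) (n : ℕ) (l : List Bool) : Bits n :=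
  fun i => (t.samp.eval l).getD i false

theorem big_challenger (O : Oracle Unit) (B n L : ℕ) (μ : Mem) (v : Vec) (l : List Bool)
    (hB : 3 ≤ B) (hctr : ∀ x, B ≤ x → μ.ctr x = if x = B then n else 0)
    (hbit : ∀ q : Cell, B ≤ q.1 → μ.bit q = if q.1 = B + 4 then l.getD q.2 false else false)
    (hL : ∀ x < 3, μ.ctr x ≤ L) (hn : n ≤ L) :
    ∃ S : Mem, Big O (L * (L * 100 + 1000) + 1000) (challenger B) μ v
        {(overlay B S ((μ.put 2 (μ.template.h.eval (List.ofFn (μ.template.msg n l)))).put 0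
          (unary n)), v)} ∧
      Ready B n S ∧ (∀ i, S.bit (B + 6, i) = (List.ofFn (μ.template.msg n l)).getD i false) ∧
      S.get (B + 7) = μ.template.f.eval (List.ofFn (μ.template.msg n l)) ∧
      S.ctr (B + 8) = 0 ∧ S.ctr (B + 9) = 0 := by
  set m := μ.template.msg n l with hm
  obtain ⟨μ₁, h1, c1, c1', l1, b1⟩ := big_evalCircuit O (B + 20) 0 (B + 4) (B + 5) L μ v l
    (fun j _ => by rw [hctr _ (by omega), if_neg (by omega)])
    (fun j => by rw [hbit _ (by dsimp only; omega), if_neg (by simp)])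
    (fun i => by rw [hbit _ (by simp), if_pos rfl]) (hL 0 (by omega)) (by omega) (by omega)
    (by omega)
  have k1 : ∀ q : Cell, q.1 ≠ B + 20 → q.1 ≠ B + 5 → μ₁.bit q = μ.bit q := by
    intro q hq hq'
    rw [b1 q hq, Mem.fill_bit, if_neg (by tauto)]
  -- Copying exactly `n` cells cuts the output of `Samp` to length `n`, or pads it with zeros, since
  -- tape `B + 5` is zero beyond that output.
  have h2 := big_forLoop_write (O := O) (B := B) (t := 3)
    (body := copyBit ⟨B + 5, B + 2⟩ ⟨B + 6, B + 2⟩) n (B + 6) (fun i => μ₁.bit (B + 5, i)) μ₁ v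
    (by rw [c1 _ (by omega) (by omega), hctr _ le_rfl, if_pos rfl])
    (by rw [c1 _ (by omega) (by omega), hctr _ (by omega), if_neg (by omega)])
    (by rw [c1 _ (by omega) (by omega), hctr _ (by omega), if_neg (by omega)])
    (by
      intro k _ ν hν hν'
      refine (big_exec O (copyBit ⟨B + 5, B + 2⟩ ⟨B + 6, B + 2⟩) ⟨trivial, trivial⟩ ν v).to
        (by simp [Prog.size, copyBit]) ?_
      rw [copyBit_exec]
      simp only [Addr.cell, hν]
      rw [hν' _ (by simp)])
  set μ₂ : Mem := ⟨μ₁.ctr, fun q => if q.1 = B + 6 ∧ q.2 < n then μ₁.bit (B + 5, q.2) else μ₁.bit q⟩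
    with hμ₂
  have k2 : ∀ q : Cell, q.1 ≠ B + 20 → q.1 ≠ B + 5 → q.1 ≠ B + 6 → μ₂.bit q = μ.bit q := by
    intro q hq hq' hq''
    simp only [hμ₂]
    rw [if_neg (by tauto), k1 q hq hq']
  have hm2 : ∀ i, μ₂.bit (B + 6, i) = (List.ofFn m).getD i false := by
    intro i
    simp only [hμ₂, true_and]
    by_cases hi : i < n
    · rw [if_pos hi, b1 _ (by simp), Mem.fill_bit]
      have e : (List.ofFn m).getD i false = m ⟨i, hi⟩ := by simp [hi]
      rw [e]
      simp only [true_and, hm, Template.msg, Mem.template]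
      split_ifs with h
      · rfl
      · rw [hbit _ (by simp), if_neg (by simp), List.getD_eq_default _ _ (not_lt.1 h)]
    · rw [if_neg hi, k1 _ (by simp) (by simp), hbit _ (by simp), if_neg (by simp)]
      simp [hi]
  have g2 : ∀ t, t < 3 → μ₂.get t = μ.get t := fun t ht => Mem.get_congr
    (c1 t (by omega) (by omega)) fun i => k2 _ (by dsimp only; omega) (by dsimp only; omega) (by dsimp only; omega)
  obtain ⟨μ₃, h3, c3, c3', l3, b3⟩ := big_evalCircuit O (B + 40) 2 (B + 6) (B + 7) L μ₂ v
    (List.ofFn m)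
    (fun j _ => by
      show μ₁.ctr _ = 0
      rw [c1' _ (by omega), hctr _ (by omega), if_neg (by omega)])
    (fun j => by
      rw [k2 _ (by simp) (by simp) (by simp), hbit _ (by dsimp only; omega), if_neg (by simp)])
    hm2 (by
      show μ₁.ctr _ ≤ L
      rw [c1 _ (by omega) (by omega)]; exact hL 2 (by omega)) (by omega) (by omega) (by omega)
  have k3 : ∀ q : Cell, q.1 ≠ B + 40 → q.1 ≠ B + 7 → μ₃.bit q = μ₂.bit q := by
    intro q hq hq'
    rw [b3 q hq, Mem.fill_bit, if_neg (by tauto)]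
  have g3 : μ₃.get 1 = μ.get 1 := (Mem.get_congr (c3 1 (by omega) (by omega)) fun i =>
    k3 _ (by dsimp only; omega) (by dsimp only; omega)).trans (g2 1 (by omega))
  obtain ⟨μ₄, h4, c4, c4', l4, b4⟩ := big_evalCircuit O (B + 60) 1 (B + 6) 2 L μ₃ v
    (List.ofFn m)
    (fun j _ => by
      rw [c3' _ (by omega)]
      show μ₁.ctr _ = 0
      rw [c1' _ (by omega), hctr _ (by omega), if_neg (by omega)])
    (fun j => by
      rw [k3 _ (by simp) (by simp), k2 _ (by simp) (by simp) (by simp), hbit _ (by dsimp only; omega),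
        if_neg (by simp)])
    (fun i => by rw [k3 _ (by simp) (by simp)]; exact hm2 i) (by
      rw [c3 _ (by omega) (by omega)]
      show μ₁.ctr _ ≤ L
      rw [c1 _ (by omega) (by omega)]; exact hL 1 (by omega)) (by omega) (by omega) (by omega)
  rw [g3] at l4 b4
  rw [g2 2 (by omega)] at l3 b3
  have k4 : ∀ q : Cell, q.1 ≠ B + 60 → q.1 ≠ 2 → μ₄.bit q = μ₃.bit q := by
    intro q hq hq'
    rw [b4 q hq, Mem.fill_bit, if_neg (by tauto)]
  have x4 : ∀ x, x < B + 20 → x ≠ B + 5 → x ≠ B + 7 → x ≠ 2 → μ₄.ctr x = μ.ctr x := by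
    intro x hx hx1 hx2 hx3
    rw [c4 _ (by omega) hx3, c3 _ (by omega) hx2]
    exact c1 _ hx hx1
  have xB : ∀ x, B ≤ x → x < B + 20 → x ≠ B + 5 → x ≠ B + 7 →
      μ₄.ctr x = if x = B then n else 0 := by
    intro x hx hx' hx1 hx2
    rw [x4 x hx' hx1 hx2 (by omega), hctr x hx]
  have h5 := big_exec O (.copy 0 B) trivial μ₄ v
  set μ₅ : Mem := ⟨Function.update μ₄.ctr 0 n, μ₄.bit⟩ with hμ₅
  have e5 : Prog.exec (Q := Unit) (.copy 0 B) (μ₄, v) = (μ₅, v) := by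
    simp only [Prog.exec, hμ₅, xB B le_rfl (by omega) (by omega) (by omega), if_true]
  rw [e5] at h5
  have x5 : ∀ x, x ≠ 0 → μ₅.ctr x = μ₄.ctr x := fun x hx => Function.update_of_ne hx _ _
  have h6 := big_forLoop_write (O := O) (B := B) (t := 1) (body := .write ⟨0, B + 2⟩ true) n 0
    (fun _ => true) μ₅ v
    (by rw [x5 _ (by omega), xB _ le_rfl (by omega) (by omega) (by omega), if_pos rfl])
    (by rw [x5 _ (by omega), xB _ (by omega) (by omega) (by omega) (by omega), if_neg (by omega)])
    (by rw [x5 _ (by omega), xB _ (by omega) (by omega) (by omega) (by omega), if_neg (by omega)])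
    (by
      intro k _ ν hν _
      refine (big_exec O (.write ⟨0, B + 2⟩ true) trivial ν v).to le_rfl ?_
      simp [Prog.exec, Addr.cell, hν])
  set S : Mem := ⟨μ₅.ctr, fun q => if q.1 = 0 ∧ q.2 < n then true else μ₅.bit q⟩ with hS
  have xS : ∀ x, B ≤ x → x < B + 20 → x ≠ B + 5 → x ≠ B + 7 → S.ctr x = if x = B then n else 0 :=
    fun x hx hx' hx1 hx2 => (x5 x (by omega)).trans (xB x hx hx' hx1 hx2)
  have bS : ∀ q : Cell, B ≤ q.1 → S.bit q = μ₄.bit q := by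
    intro q hq
    simp only [hS, hμ₅]
    rw [if_neg (by omega)]
  refine ⟨S, ?_, ⟨⟨?_, ?_, ?_, ?_⟩, ?_⟩, ?_, ?_, ?_, ?_⟩
  · have := h1.seq_det (h2.seq_det (h3.seq_det (h4.seq_det (h5.seq_det h6))))
    refine this.to ?_ ?_
    · have e1 : L * (L * 100 + 1000) = 10 * (L * (L * 10 + 100)) := by ring
      have e2 : 100 * L ≤ L * (L * 10 + 100) := by nlinarith
      have e3 : Prog.size (Q := Unit) (.copy 0 B) = 1 := rfl
      rw [e1, e3]
      generalize L * (L * 10 + 100) = X at *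
      omega
    · simp only [Prod.mk.injEq, and_true]
      ext x
      · simp only [overlay]
        split_ifs with hx
        · simp only [hS, hμ₅, Mem.put, Function.update_apply, unary, List.length_replicate]
          by_cases hx0 : x = 0
          · simp [hx0]
          · by_cases hx2 : x = 2
            · simp only [hx2]
              rw [if_neg (by omega), if_neg (by omega), if_pos trivial, l4]
              rfl
            · simp only [hx0, hx2, if_false]
              exact x4 x (by omega) (by omega) (by omega) hx2
        · rfl
      · obtain ⟨q1, q2⟩ := x
        simp only [overlay]
        split_ifs with hq
        · simp only [hS, hμ₅, Mem.put, unary, List.length_replicate]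
          by_cases hx0 : q1 = 0 ∧ q2 < n
          · rw [if_pos hx0, if_pos hx0]
            simp [hx0.2]
          · rw [if_neg hx0, if_neg hx0, b4 _ (by dsimp only; omega), Mem.fill_bit]
            have : μ₃.bit (q1, q2) = μ.bit (q1, q2) := by
              rw [k3 _ (by dsimp only; omega) (by dsimp only; omega),
                k2 _ (by dsimp only; omega) (by dsimp only; omega) (by dsimp only; omega)]
            rw [this]
            rfl
        · rfl
  · rw [xS _ le_rfl (by omega) (by omega) (by omega), if_pos rfl]
  · rw [xS _ (by omega) (by omega) (by omega) (by omega), if_neg (by omega)]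
  · rw [xS _ (by omega) (by omega) (by omega) (by omega), if_neg (by omega)]
  · rw [xS _ (by omega) (by omega) (by omega) (by omega), if_neg (by omega)]
  · intro k
    rw [bS _ (by simp), k4 _ (by simp) (by dsimp only; omega), k3 _ (by simp) (by simp),
      k2 _ (by simp) (by simp) (by simp), hbit _ (by simp), if_neg (by simp)]
  · intro i
    rw [bS _ (by simp), k4 _ (by simp) (by dsimp only; omega), k3 _ (by simp) (by simp), hm2]
  · refine Mem.get_eq ?_ fun i hi => ?_
    · rw [show S.ctr (B + 7) = μ₄.ctr (B + 7) from x5 (B + 7) (by omega), c4 _ (by omega) (by omega), l3]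
      rfl
    · rw [bS _ (by simp), k4 _ (by simp) (by dsimp only; omega), b3 _ (by simp), Mem.fill_bit]
      exact if_pos ⟨rfl, hi⟩
  · rw [xS _ (by omega) (by omega) (by omega) (by omega), if_neg (by omega)]
  · rw [xS _ (by omega) (by omega) (by omega) (by omega), if_neg (by omega)]

/-! ### Testing the adversary's answer -/

/-- Compare the bits at the position in counter `B + 9` of the tapes `0` and `B + 7`, and count the
differences. -/
def compareBit (B : ℕ) : Prog Unit :=
  .seq (.ite (.bit ⟨0, B + 9⟩) (.ite (.bit ⟨B + 7, B + 9⟩) .skip (.inc (B + 8)))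
    (.ite (.bit ⟨B + 7, B + 9⟩) (.inc (B + 8)) .skip)) (.inc (B + 9))

theorem compareBit_exec (B : ℕ) (ν : Mem) (v : Vec) : (compareBit B).exec (ν, v) =
    (⟨Function.update (if ν.bit (0, ν.ctr (B + 9)) ≠ ν.bit (B + 7, ν.ctr (B + 9)) then
        Function.update ν.ctr (B + 8) (ν.ctr (B + 8) + 1) else ν.ctr) (B + 9) (ν.ctr (B + 9) + 1),
      ν.bit⟩, v) := by
  cases h0 : ν.bit (0, ν.ctr (B + 9)) <;> cases h7 : ν.bit (B + 7, ν.ctr (B + 9)) <;>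
    simp [compareBit, Prog.exec, Test.eval, Addr.cell, h0, h7]

/-- Output `1` if the strings on the tapes `0` and `B + 7` are equal, and the empty string
otherwise. -/
def compareOutput (B : ℕ) : Prog Unit :=
  .seq (.ite (.eq 0 (B + 7)) (untilEq (B + 1) (B + 9) 0
      (compareBit B)) (.inc (B + 8)))
    (.ite (.isZero (B + 8)) (.seq (.clear 0) (.seq (.write ⟨0, 0⟩ true) (.inc 0))) (.clear 0))

/-- Equal strings have equal lengths and no mismatch. Counter `B + 8` counts the mismatches, as
`Nat.count` does, and is set to one at once if the lengths differ. -/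
theorem big_compareOutput (O : Oracle Unit) (B L : ℕ) (μ : Mem) (v : Vec) (hL : μ.ctr 0 ≤ L)
    (hz : μ.ctr (B + 1) = 0) (hf : μ.ctr (B + 8) = 0) (hi : μ.ctr (B + 9) = 0) :
    ∃ μ', Big O (L * 20 + 20) (compareOutput B) μ v {(μ', v)} ∧
      (μ'.get 0 = [true] ↔ μ.get 0 = μ.get (B + 7)) := by
  have key : ∃ ν : Mem, Big O (L * 11 + 7) (.ite (.eq 0 (B + 7)) (untilEq (B + 1) (B + 9) 0
      (compareBit B)) (.inc (B + 8)))
      μ v {(ν, v)} ∧ (ν.ctr (B + 8) = 0 ↔ μ.get 0 = μ.get (B + 7)) := by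
    by_cases hl : μ.ctr 0 = μ.ctr (B + 7)
    · set p : ℕ → Prop := fun i => μ.bit (0, i) ≠ μ.bit (B + 7, i) with hp
      have h := big_untilEq_det (O := O) (z := B + 1) (x := B + 9) (y := 0) (t := 9)
        (body := compareBit B)
        (fun j => ((μ.setC (B + 8) (Nat.count p j)).setC (B + 9) j, v)) (μ.ctr 0)
        (by simp [hz]) (by simp; omega) (by simp)
        (by
          intro j _
          refine (big_exec O (compareBit B) (by simp [Prog.Straight, compareBit]) _ _).to
            (by simp [Prog.size, compareBit]) ?_
          rw [compareBit_exec, Nat.count_succ]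
          simp only [Prod.mk.injEq, and_true]
          have e0 : ∀ t, ((μ.setC (B + 8) (Nat.count p j)).setC (B + 9) j).bit (t, j) =
            μ.bit (t, j) := fun _ => rfl
          ext x
          · simp only [Mem.setC_ctr, Function.update_self, e0]
            by_cases hx : x = B + 9
            · simp [hx]
            · by_cases hx' : x = B + 8
              · by_cases hpj : p j
                · have : μ.bit (0, j) ≠ μ.bit (B + 7, j) := hpj
                  simp [hx', hpj, this]
                · have : μ.bit (0, j) = μ.bit (B + 7, j) := not_not.1 hpj
                  simp [hx', hpj, this]
              · split_ifs <;> simp [hx, hx']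
          · rfl)
      refine ⟨(μ.setC (B + 8) (Nat.count p (μ.ctr 0))).setC (B + 9) (μ.ctr 0),
        Big.ite (t := L * 11 + 6) ?_, ?_⟩
      · have : Test.eval μ (.eq 0 (B + 7)) = true := by simp [Test.eval, hl]
        rw [if_pos this]
        have e : (μ.setC (B + 8) (Nat.count p 0)).setC (B + 9) 0 = μ := by
          rw [Nat.count_zero, Mem.setC_self _ _ hf, Mem.setC_self _ _ hi]
        simp only [e] at h
        exact h.mono (by omega)
      · have : ((μ.setC (B + 8) (Nat.count p (μ.ctr 0))).setC (B + 9) (μ.ctr 0)).ctr (B + 8) =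
          Nat.count p (μ.ctr 0) := by simp
        rw [this, Nat.count_eq_card_filter_range, Finset.card_eq_zero, Finset.filter_eq_empty_iff]
        simp only [Mem.get, hl, List.map_inj_left, hp, Finset.mem_range, List.mem_range, not_not]
    · refine ⟨μ.setC (B + 8) 1, Big.ite (t := L * 11 + 6) ?_, ?_⟩
      · have : ¬ Test.eval μ (.eq 0 (B + 7)) = true := by simp [Test.eval, hl]
        rw [if_neg this]
        refine (big_exec O (.inc (B + 8)) trivial μ v).to (by simp [Prog.size]) ?_
        simp [Prog.exec, Mem.setC, hf]
      · simp only [Mem.setC_ctr, Function.update_self, one_ne_zero, false_iff]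
        intro h
        exact hl (by simpa [Mem.get] using congrArg List.length h)
  obtain ⟨ν, h1, h2⟩ := key
  have h3 := big_exec O (.ite (.isZero (B + 8)) (.seq (.clear 0) (.seq (.write ⟨0, 0⟩ true) (.inc 0)))
    (.clear 0)) (by simp [Prog.Straight]) ν v
  have h4 := (h1.seq_det h3).mono (t' := L * 20 + 20) (by simp [Prog.size]; omega)
  rw [← h2, compareOutput]
  by_cases h : ν.ctr (B + 8) = 0
  · refine ⟨⟨Function.update ν.ctr 0 1, Function.update ν.bit (0, 0) true⟩, h4.to le_rfl ?_, ?_⟩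
    · simp [Prog.exec, Test.eval, h, Addr.cell]
    · simp [h, Mem.get]
  · refine ⟨⟨Function.update ν.ctr 0 0, ν.bit⟩, h4.to le_rfl ?_, ?_⟩
    · simp [Prog.exec, Test.eval, h]
    · simp [h, Mem.get]

/-! ### The distinguishers -/

theorem Val.seq {Q : Type} {O : Oracle Q} {t : ℕ} {P R : Prog Q} {l : List (Prog Q)} {μ : Mem}
    {v : Vec} {g : Mem × Vec → ℝ} {x : ℝ} (h : Val O t (P :: R :: l) μ v g x) :
    Val O (t + 1) (.seq P R :: l) μ v g x :=
  let ⟨M, hM, hx⟩ := h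
  ⟨M, ends_cons_of_step rfl hM, hx⟩

theorem overlay_congr {B : ℕ} (S : Mem) {μ ν : Mem} (h : ∀ x < B, μ.ctr x = ν.ctr x)
    (h' : ∀ q : Cell, q.1 < B → μ.bit q = ν.bit q) : overlay B S μ = overlay B S ν := by
  ext x
  · simp only [overlay]
    split_ifs with hx
    exacts [h x hx, rfl]
  · simp only [overlay]
    split_ifs with hx
    exacts [h' _ hx, rfl]

theorem overlay_get {B t : ℕ} (S μ : Mem) (ht : t < B) : (overlay B S μ).get t = μ.get t :=
  Mem.get_congr (if_pos ht) fun _ => if_pos ht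

theorem overlay_get_of_le {B t : ℕ} (S μ : Mem) (ht : B ≤ t) : (overlay B S μ).get t = S.get t :=
  Mem.get_congr (if_neg (not_lt.2 ht)) fun _ => if_neg (not_lt.2 ht)

theorem overlay_put {B t : ℕ} (S μ : Mem) (ht : t < B) (w : List Bool) :
    (overlay B S μ).put t w = overlay B S (μ.put t w) := by
  ext x
  · simp only [overlay, Mem.put, Function.update_apply]
    by_cases hx : x = t
    · simp [hx, ht]
    · simp [hx]
  · obtain ⟨x, y⟩ := x
    simp only [overlay, Mem.put]
    by_cases hx : x = t
    · simp [hx, ht]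
    · simp [hx]

theorem Ready.overlay {B n : ℕ} {S : Mem} (h : Ready B n S) (μ : Mem) :
    Ready B n (overlay B S μ) := by
  refine ⟨⟨?_, ?_, ?_, ?_⟩, fun k => ?_⟩ <;> simp [QCrypto.overlay, h.len, h.z, h.i, h.j, h.blank]

theorem Mem.put_comm (μ : Mem) {s t : ℕ} (h : s ≠ t) (w w' : List Bool) :
    (μ.put s w).put t w' = (μ.put t w').put s w := by
  ext x
  · exact congrFun (Function.update_comm h _ _ _) x
  · obtain ⟨x, y⟩ := x
    simp only [Mem.put]
    by_cases hx : x = s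
    · simp [hx, h]
    · simp [hx]

/-- Because the number of outputs is written in unary, the side information `h(m)` is no longer than
the description of `h`, and the second phase stays polynomial in `n`. -/
theorem Circuit.length_eval_decode_le (w x : List Bool) :
    ((Circuit.decode w).eval x).length ≤ w.length := by
  have h1 : ∀ C : Circuit, (C.eval x).length ≤ C.outputs := by
    intro C
    simp only [Circuit.eval, List.length_drop]
    omega
  refine (h1 _).trans ?_
  have h2 := blocks_le 0 w
  unfold Circuit.decode
  rcases hb : blocks 0 w with _ | ⟨a, _ | ⟨o, l⟩⟩
  · simp
  · simp
  · simp only [hb, List.sum_cons] at h2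
    show o ≤ _
    omega

/-- A measurement branches into both outcomes whatever the state, even if one of them has norm zero,
and a query touches only the state. So every result of a step is matched, in code and memory, by a
step from any other state under the identity oracle. -/
theorem exists_mem_step_of_eq {Q : Type} (O : Oracle Q) {c d : Config Q} (h : c.code = d.code)
    (h' : c.mem = d.mem) : ∀ c' ∈ step O c, ∃ d' ∈ step (fun _ _ _ v => {v}) d,
      c'.code = d'.code ∧ c'.mem = d'.mem := by
  obtain ⟨code, μ, v⟩ := c
  obtain ⟨_, _, w⟩ := d
  obtain rfl := h
  obtain rfl := h'
  intro c' hc'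
  cases code with
  | nil =>
    obtain rfl := Multiset.mem_singleton.1 hc'
    exact ⟨_, Multiset.mem_singleton_self _, rfl, rfl⟩
  | cons P l =>
    cases P
    case measure a b =>
      simp only [step, Multiset.mem_map] at hc'
      obtain ⟨x, hx, rfl⟩ := hc'
      exact ⟨_, Multiset.mem_map_of_mem (fun x => (⟨l, ⟨μ.ctr, Function.update μ.bit (b.cell μ) x⟩,
        project (a.cell μ) x w⟩ : Config Q)) hx, rfl, rfl⟩
    case query o r s =>
      obtain ⟨x, hx, rfl⟩ := Multiset.mem_map.1 hc'
      exact ⟨_, Multiset.mem_map_of_mem _ (Multiset.mem_singleton_self _), rfl, rfl⟩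
    all_goals
      obtain rfl := Multiset.mem_singleton.1 hc'
      exact ⟨_, Multiset.mem_singleton_self _, rfl, rfl⟩

/-- The classical part of a history does not depend on the quantum state. -/
theorem exists_mem_run_of_eq {Q : Type} (O : Oracle Q) (t : ℕ) : ∀ {c d : Config Q},
    c.code = d.code → c.mem = d.mem → ∀ c' ∈ run O t c,
      ∃ d' ∈ run (fun _ _ _ v => {v}) t d, c'.code = d'.code ∧ c'.mem = d'.mem := by
  induction t with
  | zero =>
    intro c d h h' c' hc'
    obtain rfl := Multiset.mem_singleton.1 hc'
    exact ⟨d, Multiset.mem_singleton_self _, h, h'⟩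
  | succ t ih =>
    intro c d h h' c' hc'
    obtain ⟨c₁, h₁, hc'⟩ := Multiset.mem_bind.1 hc'
    obtain ⟨d₁, hd₁, e, e'⟩ := exists_mem_step_of_eq O h h' c₁ h₁
    obtain ⟨d', hd', e⟩ := ih e e' c' hc'
    exact ⟨d', Multiset.mem_bind.2 ⟨d₁, hd₁, hd'⟩, e⟩

/-- The adversary of the semantic-security game restarts with the challenge `a`, the side information
`w` and the quantum state `v`. -/
noncomputable def resumeVec (P : Prog Unit) (n : ℕ) (μ : Mem) (v : Vec) (a w : List Bool) :
    Config Unit :=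
  ⟨[P], ((μ.put 0 (unary n)).put 1 a).put 2 w, v⟩

/-- The field `halts` speaks of the second phase only from the state in which the first one ended.
Here coin tosses, and queries to an arbitrary oracle, may have altered that state, so halting is
transferred along the classical part of the history. -/
theorem QPTAdversary.halts_post {ℓ : ℕ → ℕ} (A : QPTAdversary ℓ) {n : ℕ} {O : Oracle CCAQuery}
    {c : Config CCAQuery} (hc : c ∈ run O (A.time.eval n) (start A.pre n)) {a w : List Bool}
    (ha : a.length = ℓ n) (v : Vec) (O' : Oracle Unit) :
    ∀ c' ∈ run O' (A.time.eval (n + w.length)) (resumeVec A.post n c.mem v a w), c'.code = [] := by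
  intro c' hc'
  obtain ⟨d, hd, e, -⟩ := exists_mem_run_of_eq O' _
    (c := resumeVec A.post n c.mem v a w) (d := resume A.post n c a w) rfl rfl c' hc'
  exact e.trans ((A.halts n O c hc).2 a w _ ha d hd)

/-- The subroutines that answer the queries of the adversary. -/
def querySub (B : ℕ) : CCAQuery → ℕ → ℕ → Prog Unit
  | .enc => encSub B
  | .dec => decSub B

/-- The effect of `querySub`. -/
noncomputable def querySem (O : Oracle Unit) (B n : ℕ) : Oracle CCAQuery
  | .enc => encSem O B n
  | .dec => decSem O n

/-- A program that writes a challenge on tape `1`. -/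
structure Challenge (B : ℕ) where
  prog : Prog Unit
  sem : Oracle Unit → (n : ℕ) → Bits n → Vec → Multiset (List Bool × Vec)
  big : ∀ O n (m : Bits n) μ v, Ready B n μ → μ.ctr 0 = n →
    (∀ i, μ.bit (B + 6, i) = (List.ofFn m).getD i false) →
    Big O (n * 200 + 200) prog μ v ((sem O n m v).map fun p => (μ.put 1 p.1, p.2))
  length : ∀ O n (m : Bits n) v, ∀ p ∈ sem O n m v, p.1.length = n + n

/-- Play the semantic-security game, and output `1` if the adversary wins. -/
def gameProg (pre : Prog CCAQuery) (post : Prog Unit) (B : ℕ) (chal : Prog Unit) : Prog Unit :=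
  .seq (.copy B 0) (.seq (pre.compile (querySub B)) (.seq (coin B (B + 4) 0) (.seq (challenger B)
    (.seq chal (.seq (post.compile fun _ => encSub B) (compareOutput B))))))

/-- The probability that the adversary wins the game that is played by `gameProg`. -/
noncomputable def gameValue {ℓ : ℕ → ℕ} (A : QPTAdversary ℓ) {B : ℕ} (C : Challenge B) (n : ℕ)
    (O : Oracle Unit) : ℝ :=
  ((run (querySem O B n) (A.time.eval n) (start A.pre n)).map fun c =>
    ((coinLists (c.mem.ctr 0)).map fun l =>
      ((C.sem O n (c.mem.template.msg n l) (coinsVec (B + 2, 0) l c.vec)).map fun p =>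
        prob (run (fun _ => encSem O B n)
          (A.time.eval (n + (c.mem.template.h.eval (List.ofFn (c.mem.template.msg n l))).length))
          (resumeVec A.post n c.mem p.2 p.1
            (c.mem.template.h.eval (List.ofFn (c.mem.template.msg n l)))))
          fun μ => μ.get 0 = c.mem.template.f.eval (List.ofFn (c.mem.template.msg n l))).sum).sum).sum

theorem prob_eq {Q : Type} (H : Multiset (Config Q)) (p : Mem → Prop) [DecidablePred p] :
    prob H p = (H.map fun c => if p c.mem then normSq c.vec else 0).sum := by
  unfold prob
  congr!

theorem eval_mono (p : Polynomial ℕ) {a b : ℕ} (h : a ≤ b) : p.eval a ≤ p.eval b := by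
  simp only [Polynomial.eval_eq_sum, Polynomial.sum]
  gcongr

/-- The running time of `gameProg`. -/
noncomputable def gameTime (p : Polynomial ℕ) : Polynomial ℕ :=
  let L : Polynomial ℕ := Polynomial.X + p
  let T := p.comp (Polynomial.X + L)
  p * (100 * Polynomial.X + 121) + L * 20 + L * (L * 100 + 1000) + Polynomial.X * 200 +
    T * (100 * Polynomial.X + 121) + (2 * Polynomial.X + p + T) * 20 + 2000

/-- One statement serves two purposes: for every oracle it gives the halting required of a
distinguisher, and it expresses the acceptance probability as a sum over histories. The compiled
adversary is chained with the subroutines from the end backwards, through the continuations in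
`Val`. -/
theorem val_game {ℓ : ℕ → ℕ} (A : QPTAdversary ℓ) {B : ℕ} (C : Challenge B) (hB : 3 ≤ B)
    (hℓ : ∀ n, ℓ n = n + n)
    (hpre : A.pre.Below B) (hpost : A.post.Below B) (n : ℕ) (O : Oracle Unit) :
    Val O ((gameTime A.time).eval n) [gameProg A.pre A.post B C.prog]
      (Mem.blank.put 0 (unary n)) vacuum (fun p => if p.1.get 0 = [true] then normSq p.2 else 0)
      (gameValue A C n O) := by
  set TA := A.time.eval n with hTA
  -- After the first phase every counter is at most `L`; this bounds the circuit descriptions and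
  -- `h(m)`, and hence the second phase by `T₂`.
  set L := n + TA with hL
  set T₂ := A.time.eval (n + L) with hT₂
  set S : Mem := (Mem.blank.put 0 (unary n)).setC B n with hS
  set g : Mem × Vec → ℝ := fun p => if p.1.get 0 = [true] then normSq p.2 else 0 with hg
  have hSr : Ready B n S := by
    have h0 : B ≠ 0 := by omega
    refine ⟨⟨?_, ?_, ?_, ?_⟩, fun k => ?_⟩ <;> simp [hS, Mem.put, Mem.blank, h0]
  have hSb : ∀ q : Cell, B ≤ q.1 → S.bit q = false := by
    intro q hq
    have : q.1 ≠ 0 := by omega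
    simp [hS, Mem.put, Mem.blank, this]
  have hSc : ∀ x, B ≤ x → S.ctr x = if x = B then n else 0 := by
    intro x hx
    have : x ≠ 0 := by omega
    simp [hS, Mem.put, Mem.blank, this, Function.update_apply]
  have henc : ∀ S', Ready B n S' → ∀ (o : Unit) r s μ v, r < B → s < B →
      Big O (n * 100 + 120) (encSub B r s) (overlay B S' μ) v
        ((encSem O B n r s v).map fun w => (overlay B S' μ, w)) :=
    fun S' hS' _ r s μ v _ hs => big_encSub O B n r s hs _ v (hS'.overlay μ)
  have hquery : ∀ o r s μ v, r < B → s < B → Big O (n * 100 + 120) (querySub B o r s)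
      (overlay B S μ) v ((querySem O B n o r s v).map fun w => (overlay B S μ, w)) := by
    intro o r s μ v hr hs
    cases o
    · exact big_encSub O B n r s hs _ v (hSr.overlay μ)
    · exact big_decSub O B n r s _ v (hSr.overlay μ)
  have e0 : Prog.exec (Q := Unit) (.copy B 0) (Mem.blank.put 0 (unary n), vacuum) = (S, vacuum) := by
    simp [Prog.exec, hS, Mem.setC, Mem.put, unary]
  have h0 := big_exec O (.copy B 0) trivial (Mem.blank.put 0 (unary n)) vacuum
  rw [e0] at h0
  have eS : overlay B S (Mem.blank.put 0 (unary n)) = S := by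
    conv_rhs => rw [← overlay_self B S]
    refine overlay_congr S (fun x hx => ?_) fun _ _ => rfl
    rw [hS, Mem.setC_ctr, Function.update_of_ne hx.ne]
  have key : ∀ c ∈ run (querySem O B n) TA (start A.pre n), Val O
      (L * 20 + 20 + 1 + (L * (L * 100 + 1000) + 1000 + 1 + (n * 200 + 200 + 1 +
        (T₂ * (n * 100 + 121) + 1 + ((2 * n + TA + T₂) * 20 + 20)))))
      [.seq (coin B (B + 4) 0) (.seq (challenger B)
        (.seq C.prog (.seq (A.post.compile fun _ => encSub B) (compareOutput B))))]
      (overlay B S c.mem) c.vec g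
      ((coinLists (c.mem.ctr 0)).map fun l =>
      ((C.sem O n (c.mem.template.msg n l) (coinsVec (B + 2, 0) l c.vec)).map fun p =>
        prob (run (fun _ => encSem O B n)
          (A.time.eval (n + (c.mem.template.h.eval (List.ofFn (c.mem.template.msg n l))).length))
          (resumeVec A.post n c.mem p.2 p.1
            (c.mem.template.h.eval (List.ofFn (c.mem.template.msg n l)))))
          fun μ => μ.get 0 = c.mem.template.f.eval (List.ofFn (c.mem.template.msg n l))).sum).sum := by
    intro c hc
    have hcL : ∀ x, c.mem.ctr x ≤ L := by
      refine ctr_le_of_mem_run (querySem O B n) TA (start A.pre n) n (fun x => ?_) c hc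
      simp only [start, Mem.put, Mem.blank, Function.update_apply, unary, List.length_replicate]
      split_ifs <;> omega
    -- Counter `0` holds the length of the description of `Samp`. That many coins are tossed, which
    -- is at least its arity.
    have hcoin := big_coin O B (B + 4) 0 (overlay B S c.mem) c.vec (hSr.overlay c.mem).z
      (hSr.overlay c.mem).i (by omega)
    have ec : (overlay B S c.mem).ctr 0 = c.mem.ctr 0 := overlay_ctr S c.mem (by omega)
    rw [ec] at hcoin
    refine (Val.seq ((hcoin.mono (t' := L * 20 + 20) ?_).val_map (T := L * (L * 100 + 1000) + 1000 + 1 + (n * 200 + 200 + 1 +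
        (T₂ * (n * 100 + 121) + 1 + ((2 * n + TA + T₂) * 20 + 20)))) fun l hl => ?_)).mono (by omega)
    · have := hcL 0
      omega
    set m := c.mem.template.msg n l with hm
    set w := c.mem.template.h.eval (List.ofFn m) with hw
    set ν := (overlay B S c.mem).fill (B + 4) l with hν
    have hνget : ∀ t, t < 3 → ν.get t = c.mem.get t := fun t ht =>
      (Mem.get_congr (μ := ν) (ν := overlay B S c.mem) rfl fun i => by
        rw [hν, Mem.fill_bit, if_neg (by dsimp only; omega)]).trans
        (overlay_get S c.mem (ht.trans_le hB))
    have hνt : ν.template = c.mem.template := by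
      simp [Mem.template, hνget]
    have hwL : w.length ≤ L := by
      refine (Circuit.length_eval_decode_le _ _).trans ?_
      simpa [Mem.get] using hcL 1
    obtain ⟨S', hch, hS', hm', hf', h8, h9⟩ := big_challenger O B n L ν
      (coinsVec (B + 2, 0) l c.vec) l hB
      (fun x hx => by
        show (if x < B then _ else _) = _
        rw [if_neg (not_lt.2 hx), hSc x hx])
      (fun q hq => by
        have e : (overlay B S c.mem).bit q = false := (if_neg (not_lt.2 hq)).trans (hSb q hq)
        rw [hν, Mem.fill_bit, e]
        by_cases h4 : q.1 = B + 4
        · by_cases h5 : q.2 < l.length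
          · simp [h4, h5]
          · rw [if_neg (by tauto), if_pos h4, List.getD_eq_default _ _ (not_lt.1 h5)]
        · rw [if_neg (by tauto), if_neg h4])
      (fun x hx => (overlay_ctr S c.mem (by omega)).trans_le (hcL x)) (by omega)
    rw [hνt, ← hm] at hm' hf'
    rw [hνt, ← hm, ← hw] at hch
    have hμ' : overlay B S' ((ν.put 2 w).put 0 (unary n)) =
        overlay B S' ((c.mem.put 2 w).put 0 (unary n)) := by
      rw [← overlay_put _ _ (by omega), ← overlay_put _ _ (by omega),
        ← overlay_put _ _ (by omega), ← overlay_put _ _ (by omega)]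
      congr 2
      refine overlay_congr _ (fun x hx => if_pos hx) fun q hq => ?_
      rw [hν, Mem.fill_bit, if_neg (by omega)]
      exact if_pos hq
    rw [hμ'] at hch
    refine (Val.seq (hch.val_det (T := n * 200 + 200 + 1 +
        (T₂ * (n * 100 + 121) + 1 + ((2 * n + TA + T₂) * 20 + 20))) ?_)).mono (by omega)
    have hC := C.big O n m (overlay B S' ((c.mem.put 2 w).put 0 (unary n)))
      (coinsVec (B + 2, 0) l c.vec) (hS'.overlay _)
      ((overlay_ctr _ _ (by omega)).trans (by simp [Mem.put, unary]))
      (fun i => by rw [← hm' i]; exact if_neg (by dsimp only; omega))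
    refine (Val.seq (hC.val_map (T := T₂ * (n * 100 + 121) + 1 + ((2 * n + TA + T₂) * 20 + 20))
      fun p hp => ?_)).mono (by omega)
    have hlen := C.length O n m _ p hp
    -- The writes to the tapes `0`, `1`, `2` are on different tapes and commute, so this is the
    -- memory in which the adversary expects to resume.
    have er : (overlay B S' ((c.mem.put 2 w).put 0 (unary n))).put 1 p.1 =
        overlay B S' (((c.mem.put 0 (unary n)).put 1 p.1).put 2 w) := by
      rw [overlay_put _ _ (by omega), Mem.put_comm _ (by omega : 2 ≠ 0),
        Mem.put_comm _ (by omega : 2 ≠ 1)]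
    rw [er]
    have hT : A.time.eval (n + w.length) ≤ T₂ := eval_mono _ (by omega)
    have hhalt := A.halts_post hc (a := p.1) (w := w) (hlen.trans (hℓ n).symm) p.2
      (fun _ => encSem O B n)
    simp only [prob_eq]
    refine (Val.seq (val_compile (q := n * 100 + 120) O (fun _ => encSem O B n) (fun _ => encSub B) S'
      (henc S' hS') [compareOutput B] ((2 * n + TA + T₂) * 20 + 20) (A.time.eval (n + w.length)) g
      (fun c₂ => if c₂.mem.get 0 = c.mem.template.f.eval (List.ofFn m) then normSq c₂.vec else 0)
      A.post _ _ hpost hhalt fun c₂ hc₂ => ?_)).mono ?_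
    -- The second phase starts with counters at most `2 * n + TA`: the input, the challenge of
    -- length `2 * n`, the side information and what the first phase left. Each step then adds at
    -- most one.
    · have hc₂L : c₂.mem.ctr 0 ≤ 2 * n + TA + T₂ := by
        refine (ctr_le_of_mem_run (fun _ => encSem O B n) _ _ (2 * n + TA) (fun x => ?_) c₂ hc₂
          0).trans (by omega)
        have := hcL x
        simp only [Mem.put, Function.update_apply, unary, List.length_replicate]
        split_ifs <;> omega
      obtain ⟨μ', hcmp, hiff⟩ := big_compareOutput O B (2 * n + TA + T₂) (overlay B S' c₂.mem) c₂.vec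
        ((overlay_ctr _ _ (by omega)).trans_le hc₂L) (hS'.overlay _).z
        ((if_neg (by omega)).trans h8) ((if_neg (by omega)).trans h9)
      rw [overlay_get _ _ (by omega), overlay_get_of_le _ _ (by omega), hf'] at hiff
      have h := hcmp.val_det (T := 0) (l := []) (g := g) ⟨_, ends_nil O 0 μ' c₂.vec, rfl⟩
      simpa only [hg, Multiset.map_singleton, Multiset.sum_singleton, hiff] using h
    · have h3 : A.time.eval (n + w.length) * (n * 100 + 120 + 1) ≤ T₂ * (n * 100 + 121) :=
        Nat.mul_le_mul_right (n * 100 + 121) hT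
      omega
  have h1 := val_compile (q := n * 100 + 120) O (querySem O B n) (querySub B) S hquery
    _ _ TA g _ A.pre (Mem.blank.put 0 (unary n)) vacuum hpre
    (fun c hc => (A.halts n (querySem O B n) c hc).1) key
  rw [eS] at h1
  refine (Val.seq (h0.val_det (Val.seq h1))).mono ?_
  have e1 : Prog.size (Q := Unit) (.copy B 0) = 1 := rfl
  simp only [gameTime, Polynomial.eval_add, Polynomial.eval_mul, Polynomial.eval_X,
    Polynomial.eval_comp, Polynomial.eval_ofNat, e1, ← hTA, ← hL, ← hT₂]
  have e2 : n * 100 + 120 + 1 = 100 * n + 121 := by ring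
  rw [e2]
  omega

/-- The distinguisher that plays the semantic-security game. -/
noncomputable def gameDistinguisher {ℓ : ℕ → ℕ} (A : QPTAdversary ℓ) {B : ℕ} (C : Challenge B)
    (hB : 3 ≤ B) (hℓ : ∀ n, ℓ n = n + n) (hpre : A.pre.Below B) (hpost : A.post.Below B) :
    QPTDistinguisher where
  prog := gameProg A.pre A.post B C.prog
  time := gameTime A.time
  halts n O c hc := by
    obtain ⟨M, hM, -⟩ := val_game A C hB hℓ hpre hpost n O
    rw [start, show run O _ _ = _ from hM] at hc
    obtain ⟨p, -, rfl⟩ := Multiset.mem_map.1 hc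
    rfl

theorem acceptProb_gameDistinguisher {ℓ : ℕ → ℕ} (A : QPTAdversary ℓ) {B : ℕ} (C : Challenge B)
    (hB : 3 ≤ B) (hℓ : ∀ n, ℓ n = n + n) (hpre : A.pre.Below B) (hpost : A.post.Below B) (n : ℕ)
    (φ : Bits n → Bits n) :
    (gameDistinguisher A C hB hℓ hpre hpost).acceptProb n φ = gameValue A C n (funOracle φ) := by
  obtain ⟨M, hM, hx⟩ := val_game A C hB hℓ hpre hpost n (funOracle φ)
  rw [← hx]
  simp only [QPTDistinguisher.acceptProb, gameDistinguisher, start, prob_eq]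
  rw [show run _ _ _ = _ from hM, Multiset.map_map]
  rfl

/-! ### Norms and linearity -/

theorem normSq_eq_sum {v : Vec} {s : Finset Basis} (h : v.support ⊆ s) :
    normSq v = ∑ e ∈ s, ‖v e‖ ^ 2 :=
  Finsupp.sum_of_support_subset v h _ (by simp)

theorem normSq_nonneg (v : Vec) : 0 ≤ normSq v := Finset.sum_nonneg fun _ _ => by positivity

theorem normSq_smul (a : ℂ) (v : Vec) : normSq (a • v) = ‖a‖ ^ 2 * normSq v := by
  rw [normSq_eq_sum (Finsupp.support_smul (b := a) (g := v)), normSq_eq_sum subset_rfl,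
    Finset.mul_sum]
  simp [mul_pow]

/-- The parallelogram law, used for the unitarity of the Hadamard gate and for the crude bounds on
norms of sums and differences. -/
theorem normSq_add_add_normSq_sub (v w : Vec) :
    normSq (v + w) + normSq (v - w) = 2 * (normSq v + normSq w) := by
  classical
  rw [normSq_eq_sum (s := v.support ∪ w.support) Finsupp.support_add,
    normSq_eq_sum (s := v.support ∪ w.support) Finsupp.support_sub,
    normSq_eq_sum (v := v) (s := v.support ∪ w.support) Finset.subset_union_left,
    normSq_eq_sum (v := w) (s := v.support ∪ w.support) Finset.subset_union_right,
    ← Finset.sum_add_distrib, ← Finset.sum_add_distrib, Finset.mul_sum]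
  refine Finset.sum_congr rfl fun e _ => ?_
  have := parallelogram_law_with_norm ℝ (v e) (w e)
  simp only [Finsupp.add_apply, Finsupp.sub_apply]
  linarith

theorem normSq_filter_add (p : Basis → Prop) [DecidablePred p] (v : Vec) :
    normSq (v.filter p) + normSq (v.filter fun e => ¬ p e) = normSq v := by
  rw [normSq_eq_sum (s := v.support) (by simp), normSq_eq_sum (s := v.support) (by simp),
    normSq_eq_sum subset_rfl, ← Finset.sum_add_distrib]
  refine Finset.sum_congr rfl fun e _ => ?_
  by_cases h : p e <;> simp [h]

theorem normSq_bmap {f : Basis → Basis} (hf : Function.Injective f) (v : Vec) :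
    normSq (bmap f v) = normSq v :=
  Finsupp.sum_mapDomain_index_inj hf

theorem normSq_project_add (q : Cell) (v : Vec) :
    normSq (project q true v) + normSq (project q false v) = normSq v := by
  rw [← normSq_filter_add (fun e => e q = true) v]
  simp [project]

theorem flipFn_injective (cs : List Cell) (q : Cell) : Function.Injective (flipFn cs q) := by
  refine Function.Involutive.injective fun e => ?_
  by_cases h : q ∉ cs ∧ ∀ c ∈ cs, e c = true
  · have h' : q ∉ cs ∧ ∀ c ∈ cs, Function.update e q (!(e q)) c = true :=
      ⟨h.1, fun c hc => by
        rw [Function.update_of_ne (ne_of_mem_of_not_mem hc h.1)]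
        exact h.2 c hc⟩
    have e1 : flipFn cs q e = Function.update e q (!(e q)) := if_pos h
    rw [e1]
    refine (if_pos h').trans ?_
    simp
  · have e1 : flipFn cs q e = e := if_neg h
    rw [e1, e1]

theorem xorFn_injective {a b : ℕ} (F : Bits a → Bits b) (r s : ℕ) :
    Function.Injective (xorFn F r s) := by
  refine Function.Involutive.injective fun e => ?_
  funext q
  by_cases h : r ≠ s ∧ q.1 = s ∧ q.2 < b
  · have h2 : ∀ j : ℕ, xorFn F r s e (r, j) = e (r, j) := fun j => by simp [xorFn, h.1]
    simp only [xorFn] at h2 ⊢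
    simp only [h2]
    rw [dif_pos h, dif_pos h]
    simp
  · simp only [xorFn, dif_neg h]

theorem normSq_tGate (q : Cell) (v : Vec) : normSq (tGate q v) = normSq v := by
  have h : ∀ e, ‖tGate q v e‖ = ‖v e‖ := by
    intro e
    have : tGate q v e = v e * (if e q then Complex.exp (Complex.I * (Real.pi / 4)) else 1) := by
      rw [tGate, Finsupp.linearCombination_apply, Finsupp.sum_apply, Finsupp.sum,
        Finset.sum_eq_single e]
      · simp
      · intro e' _ he'
        simp [he']
      · intro he
        simp [Finsupp.notMem_support_iff.1 he]
    rw [this, norm_mul]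
    split_ifs
    · have : Complex.I * (Real.pi / 4) = ((Real.pi / 4 : ℝ) : ℂ) * Complex.I := by
        push_cast
        ring
      rw [this, Complex.norm_exp_ofReal_mul_I, mul_one]
    · simp
  have hs : (tGate q v).support = v.support := by
    ext e
    rw [Finsupp.mem_support_iff, Finsupp.mem_support_iff, ← norm_ne_zero_iff, h, norm_ne_zero_iff]
  rw [normSq_eq_sum hs.subset, normSq_eq_sum subset_rfl]
  simp [h]

/-- With `v₀`, `v₁` the parts of `v` on the values of qubit `q` and `X` the flip, the image is `(v₀
+ X v₁) + X (v₀ - X v₁)` divided by `√2`. The two summands have disjoint supports, so their squared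
norms add, and the parallelogram law finishes. -/
theorem normSq_hGate (q : Cell) (v : Vec) : normSq (hGate q v) = normSq v := by
  set a : ℂ := (((Real.sqrt 2)⁻¹ : ℝ) : ℂ) with ha
  set v₀ := project q false v with hv₀
  set v₁ := project q true v with hv₁
  set X := bmap (flipFn [] q) with hX
  have hinj := flipFn_injective [] q
  have hXX : ∀ w, X (X w) = w := by
    intro w
    rw [hX, bmap_bmap, bmap_eq_self]
    intro e _
    simp [flipFn_nil]
  have hdec : hGate q v = a • ((v₀ + X v₁) + X (v₀ - X v₁)) := by
    rw [map_sub, hXX]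
    have key : ∀ w : Vec, hGate q w = a • ((project q false w + X (project q true w)) +
        (X (project q false w) - project q true w)) := by
      intro w
      have hl : hGate q = a • ((projectL q false + X ∘ₗ projectL q true) +
          (X ∘ₗ projectL q false - projectL q true)) := by
        refine Finsupp.lhom_ext fun e b => ?_
        have hp : ∀ c, projectL q c (Finsupp.single e b) =
            if e q = c then Finsupp.single e b else 0 := by
          intro c
          split_ifs with hc
          · exact Finsupp.filter_single_of_pos _ hc
          · exact Finsupp.filter_single_of_neg _ hc
        have hXs : X (Finsupp.single e b) = Finsupp.single (Function.update e q !(e q)) b := by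
          rw [hX, bmap, Finsupp.lmapDomain_apply, Finsupp.mapDomain_single, flipFn_nil]
        have hself : ∀ c, e q = c → Function.update e q c = e := fun c hc => by
          rw [← hc, Function.update_eq_self]
        simp only [hGate, Finsupp.linearCombination_single, LinearMap.smul_apply,
          LinearMap.add_apply, LinearMap.sub_apply, LinearMap.comp_apply, hp]
        cases hc : e q
        · simp [hXs, hc, hself _ hc, ← ha, mul_comm]
        · simp [hXs, hc, hself _ hc, ← ha, mul_comm, sub_eq_add_neg, add_comm]
      exact congrFun (congrArg DFunLike.coe hl) w
    exact key v
  have hsupp₀ : ∀ e, e q = true → (v₀ + X v₁) e = 0 ∧ (v₀ - X v₁) e = 0 := by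
    intro e he
    have h0 : v₀ e = 0 := by simp [hv₀, project, he]
    have h1 : (X v₁) e = 0 := by
      by_contra h
      classical
      obtain ⟨e', he', rfl⟩ := Finset.mem_image.1
        (Finsupp.mapDomain_support (Finsupp.mem_support_iff.2 h))
      have := (Finsupp.mem_support_iff.1 he')
      have h' : e' q = true := by
        by_contra h'
        exact this (Finsupp.filter_apply_neg _ _ h')
      simp [flipFn_nil, h'] at he
    simp [h0, h1]
  have hsupp₁ : ∀ e, e q = false → (X (v₀ - X v₁)) e = 0 := by
    intro e he
    by_contra h
    classical
    obtain ⟨e', he', rfl⟩ := Finset.mem_image.1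
      (Finsupp.mapDomain_support (Finsupp.mem_support_iff.2 h))
    have h' : e' q = false := by
      by_contra h'
      exact Finsupp.mem_support_iff.1 he' (hsupp₀ e' (by simpa using h')).2
    simp [flipFn_nil, h'] at he
  have hsum : ∀ y z : Vec, (∀ e, e q = true → y e = 0) → (∀ e, e q = false → z e = 0) →
      normSq (y + z) = normSq y + normSq z := by
    intro y z hy hz
    rw [← normSq_filter_add (fun e => e q = false)]
    congr 2
    · ext e
      by_cases h : e q = false
      · simp [h, hz e h]
      · simp [h, hy e (by simpa using h)]
    · ext e
      by_cases h : e q = false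
      · simp [h, hz e h]
      · simp [h, hy e (by simpa using h)]
  have hn : ‖a‖ ^ 2 = 1 / 2 := by
    rw [ha, Complex.norm_real, Real.norm_eq_abs, sq_abs, inv_pow, Real.sq_sqrt (by norm_num)]
    norm_num
  rw [hdec, normSq_smul, hsum _ _ (fun e he => (hsupp₀ e he).1) hsupp₁, hX, normSq_bmap hinj, ← hX, normSq_add_add_normSq_sub, hn, hX,
    normSq_bmap hinj, ← normSq_project_add q v]
  ring

/-! ### Linearity of runs -/

/-- The possible results of a query depend linearly on the state, and their squared norms add up. -/
def Oracle.IsLinear {Q : Type} (O : Oracle Q) : Prop :=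
  ∀ o r s, ∃ K : Multiset (Vec →ₗ[ℂ] Vec), (∀ v, O o r s v = K.map fun A => A v) ∧
    ∀ v, (K.map fun A => normSq (A v)).sum = normSq v

/-- The results of a computation from `⟨l, μ, v⟩` depend linearly on `v`, and their squared norms add
up. -/
def LinearIn {Q : Type} (H : Vec → Multiset (Config Q)) : Prop :=
  ∃ K : Multiset (List (Prog Q) × Mem × (Vec →ₗ[ℂ] Vec)),
    (∀ v, H v = K.map fun i => ⟨i.1, i.2.1, i.2.2 v⟩) ∧
      ∀ v, (K.map fun i => normSq (i.2.2 v)).sum = normSq v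

theorem linearIn_single {Q : Type} (l : List (Prog Q)) (μ : Mem) (A : Vec →ₗ[ℂ] Vec)
    (hA : ∀ v, normSq (A v) = normSq v) : LinearIn fun v => {⟨l, μ, A v⟩} :=
  ⟨{(l, μ, A)}, fun v => by simp, fun v => by simp [hA]⟩

theorem linearIn_const {Q : Type} (l : List (Prog Q)) (μ : Mem) :
    LinearIn fun v => {⟨l, μ, v⟩} :=
  linearIn_single l μ LinearMap.id fun _ => rfl

theorem linearIn_step {Q : Type} {O : Oracle Q} (hO : O.IsLinear) (l : List (Prog Q)) (μ : Mem) :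
    LinearIn fun v => step O ⟨l, μ, v⟩ := by
  cases l with
  | nil => exact linearIn_const [] μ
  | cons P l =>
    cases P with
    | hadamard a => exact linearIn_single l μ (hGate (a.cell μ)) (normSq_hGate _)
    | phase a => exact linearIn_single l μ (tGate (a.cell μ)) (normSq_tGate _)
    | flip cs a =>
      simp only [step]
      exact linearIn_single l μ _ fun v => by
        rw [flipGate_eq, normSq_bmap (flipFn_injective _ _)]
    | measure a d =>
      refine ⟨(Finset.univ : Finset Bool).val.map fun b =>
        (l, ⟨μ.ctr, Function.update μ.bit (d.cell μ) b⟩, projectL (a.cell μ) b), fun v => ?_,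
        fun v => ?_⟩
      · simp only [step, Multiset.map_map]
        rfl
      · rw [Multiset.map_map]
        show ∑ b : Bool, normSq (project (a.cell μ) b v) = _
        rw [Fintype.sum_bool, normSq_project_add]
    | query o r s =>
      obtain ⟨K, h1, h2⟩ := hO o r s
      exact ⟨K.map fun A => (l, μ, A), fun v => by simp [step, h1], fun v => by simp [h2]⟩
    | ite t P R | loop t P =>
      cases h : t.eval μ <;> simp only [step, h, if_true, Bool.false_eq_true, if_false] <;>
        exact linearIn_const _ _
    | _ =>
      simp only [step]
      exact linearIn_const _ _

/-- Each step is a family of linear maps whose squared norms sum to that of the input, like Kraus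
operators, and such families compose. The control flow depends only on code and memory, which are
the same for all initial states. -/
theorem linearIn_run {Q : Type} {O : Oracle Q} (hO : O.IsLinear) (t : ℕ) (l : List (Prog Q))
    (μ : Mem) : LinearIn fun v => run O t ⟨l, μ, v⟩ := by
  induction t generalizing l μ with
  | zero => exact linearIn_const l μ
  | succ t ih =>
    obtain ⟨K, h1, h2⟩ := linearIn_step hO l μ
    choose N hN1 hN2 using ih
    refine ⟨K.bind fun i => (N i.1 i.2.1).map fun j => (j.1, j.2.1, j.2.2 ∘ₗ i.2.2), fun v => ?_,
      fun v => ?_⟩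
    · simp only [run, h1, Multiset.bind_map, Multiset.map_bind, Multiset.map_map]
      exact Multiset.bind_congr fun i _ => hN1 _ _ _
    · simp only [Multiset.map_bind, Multiset.sum_bind, Multiset.map_map]
      rw [← h2 v]
      exact congrArg _ (Multiset.map_congr rfl fun i _ => hN2 _ _ _)

/-- This turns the amplitudes left by coin tosses into the weights of an average. -/
theorem prob_run_smul {Q : Type} {O : Oracle Q} (hO : O.IsLinear) (t : ℕ) (l : List (Prog Q))
    (μ : Mem) (p : Mem → Prop) (a : ℂ) (v : Vec) :
    prob (run O t ⟨l, μ, a • v⟩) p = ‖a‖ ^ 2 * prob (run O t ⟨l, μ, v⟩) p := by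
  classical
  obtain ⟨K, h, -⟩ := linearIn_run hO t l μ
  simp only [prob_eq, h, Multiset.map_map]
  rw [← Multiset.sum_map_mul_left]
  refine congrArg _ (Multiset.map_congr rfl fun i _ => ?_)
  simp only [Function.comp, map_smul, normSq_smul]
  split_ifs <;> simp

/-- The oracles of the pre-challenge phase, for the function `φ`. -/
noncomputable def funCCA {n : ℕ} (φ : Bits n → Bits n) : Oracle CCAQuery
  | .enc, r, s, v => encQ φ r s v
  | .dec, r, s, v => {xorOracle (decFn φ) r s v}

/-- The encryption oracle for the function `φ`. -/
noncomputable def funEnc {n : ℕ} (φ : Bits n → Bits n) : Oracle Unit := fun _ r s v => encQ φ r s v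

theorem norm_inv_sqrt_two_pow (n : ℕ) : ‖(((Real.sqrt (2 ^ n))⁻¹ : ℝ) : ℂ)‖ ^ 2 = (2 ^ n : ℝ)⁻¹ := by
  rw [Complex.norm_real, Real.norm_eq_abs, sq_abs, inv_pow, Real.sq_sqrt (by positivity)]

theorem isLinear_encQ {n : ℕ} (φ : Bits n → Bits n) (r s : ℕ) :
    ∃ K : Multiset (Vec →ₗ[ℂ] Vec), (∀ v, encQ φ r s v = K.map fun A => A v) ∧
      ∀ v, (K.map fun A => normSq (A v)).sum = normSq v := by
  refine ⟨(Finset.univ : Finset (Bits n)).val.map fun ρ =>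
    (((Real.sqrt (2 ^ n))⁻¹ : ℝ) : ℂ) • xorOracle (fun m => encFn φ m ρ) r s, fun v => ?_,
    fun v => ?_⟩
  · rw [Multiset.map_map]
    rfl
  · rw [Multiset.map_map]
    show ∑ ρ : Bits n, normSq ((((Real.sqrt (2 ^ n))⁻¹ : ℝ) : ℂ) • xorOracle _ r s v) = _
    simp only [normSq_smul, norm_inv_sqrt_two_pow, xorOracle_eq, normSq_bmap (xorFn_injective _ _ _)]
    simp

theorem isLinear_funEnc {n : ℕ} (φ : Bits n → Bits n) : (funEnc φ).IsLinear :=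
  fun _ r s => isLinear_encQ φ r s

theorem isLinear_funCCA {n : ℕ} (φ : Bits n → Bits n) : (funCCA φ).IsLinear
  | .enc, r, s => isLinear_encQ φ r s
  | .dec, r, s => ⟨{xorOracle (decFn φ) r s}, fun v => by simp [funCCA], fun v => by
      simp [xorOracle_eq, normSq_bmap (xorFn_injective _ _ _)]⟩

/-! ### The games for a function `φ` -/

/-- The probability that the adversary, after a history of the pre-challenge phase with memory `μ` and
state `v`, outputs `f(m)` when its challenge is `a`. -/
noncomputable def postProb {ℓ : ℕ → ℕ} (A : QPTAdversary ℓ) {n : ℕ} (φ : Bits n → Bits n) (μ : Mem)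
    (v : Vec) (m : Bits n) (a : List Bool) : ℝ :=
  prob (run (funEnc φ) (A.time.eval (n + (μ.template.h.eval (List.ofFn m)).length))
    (resumeVec A.post n μ v a (μ.template.h.eval (List.ofFn m))))
    fun ν => ν.get 0 = μ.template.f.eval (List.ofFn m)

/-- The probability that the adversary wins if the function is `φ` before and `φ'` after the challenge
`α m`. -/
noncomputable def gameExp {ℓ : ℕ → ℕ} (A : QPTAdversary ℓ) {n : ℕ} (φ φ' : Bits n → Bits n)
    (α : Bits n → List Bool) : ℝ :=
  ((run (funCCA φ) (A.time.eval n) (start A.pre n)).map fun c =>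
    𝔼 σ : Bits c.mem.template.samp.arity, postProb A φ' c.mem c.vec (c.mem.template.message n σ)
      (α (c.mem.template.message n σ))).sum

theorem postProb_smul {ℓ : ℕ → ℕ} (A : QPTAdversary ℓ) {n : ℕ} (φ : Bits n → Bits n) (μ : Mem)
    (a : ℂ) (v : Vec) (m : Bits n) (w : List Bool) :
    postProb A φ μ (a • v) m w = ‖a‖ ^ 2 * postProb A φ μ v m w :=
  prob_run_smul (isLinear_funEnc φ) _ _ _ _ a v

/-! ### Averages over bit strings -/

/-- Concatenation of bit strings. -/
def bitsProd (k j : ℕ) : Bits k × Bits j ≃ Bits (k + j) where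
  toFun p := Fin.append p.1 p.2
  invFun x := (fun i => x (Fin.castAdd j i), fun i => x (Fin.natAdd k i))
  left_inv p := by simp
  right_inv x := Fin.append_castAdd_natAdd

theorem expect_append {k j : ℕ} (f : Bits (k + j) → ℝ) :
    𝔼 u : Bits (k + j), f u = 𝔼 x : Bits k, 𝔼 y : Bits j, f (Fin.append x y) := by
  rw [← Finset.expect_product', Finset.univ_product_univ]
  exact (Fintype.expect_equiv (bitsProd k j) (fun p => f (Fin.append p.1 p.2)) f fun _ => rfl).symm

theorem expect_multiset_sum {ι α : Type*} [Fintype ι] (M : Multiset α) (f : ι → α → ℝ) :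
    𝔼 i, (M.map (f i)).sum = (M.map fun c => 𝔼 i, f i c).sum := by
  induction M using Multiset.induction with
  | empty => simp
  | cons a M ih => simp [Finset.expect_add_distrib, ih]

/-- Surplus coins average out. This is needed because the number of coins tossed is the length of
the description of `Samp` and not its arity. -/
theorem expect_restrict {k L : ℕ} (h : k ≤ L) (f : Bits k → ℝ) :
    𝔼 x : Bits L, f (fun i => x (Fin.castLE h i)) = 𝔼 y, f y := by
  obtain ⟨j, rfl⟩ := Nat.exists_eq_add_of_le h
  rw [expect_append]
  refine Finset.expect_congr rfl fun x _ => ?_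
  simp

theorem Circuit.eval_congr (C : Circuit) {x y : List Bool}
    (h : ∀ i < C.arity, x.getD i false = y.getD i false) : C.eval x = C.eval y := by
  unfold Circuit.eval
  rw [List.map_congr_left fun i hi => h i (List.mem_range.1 hi)]

theorem Circuit.arity_decode_le (w : List Bool) : (Circuit.decode w).arity ≤ w.length := by
  have h2 := blocks_le 0 w
  unfold Circuit.decode
  rcases hb : blocks 0 w with _ | ⟨a, _ | ⟨o, l⟩⟩
  · simp
  · simp
  · simp only [hb, List.sum_cons] at h2
    show a ≤ _
    omega

theorem sum_coinLists (k : ℕ) (f : List Bool → ℝ) :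
    ((coinLists k).map f).sum = ∑ u : Bits k, f (List.ofFn u) := by
  rw [coinLists_eq, Multiset.map_map]
  rfl

theorem norm_inv_sqrt_pow (k : ℕ) : ‖(((Real.sqrt 2)⁻¹ ^ k : ℝ) : ℂ)‖ ^ 2 = (2 ^ k : ℝ)⁻¹ := by
  rw [Complex.norm_real, Real.norm_eq_abs, sq_abs, ← pow_mul, mul_comm, pow_mul, inv_pow,
    Real.sq_sqrt (by norm_num), inv_pow]

theorem expect_bits (k : ℕ) (f : Bits k → ℝ) : 𝔼 u, f u = (2 ^ k : ℝ)⁻¹ * ∑ u, f u := by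
  rw [Fintype.expect_eq_sum_div_card, div_eq_inv_mul]
  simp

theorem Blank.coinsVec {B : ℕ} {v : Vec} (h : Blank B v) (j k : ℕ) (l : List Bool) :
    coinsVec (B + j, k) l v = (((Real.sqrt 2)⁻¹ ^ l.length : ℝ) : ℂ) • v :=
  coinsVec_eq _ _ fun e he => h e he _ (by simp)

/-- The challenge `C` yields the challenges `a i` for uniform `i`, when the function is `φ`. -/
def Challenge.Yields {B : ℕ} (C : Challenge B) {n : ℕ} (φ : Bits n → Bits n) {ι : Type} [Fintype ι]
    (a : ι → Bits n → List Bool) : Prop :=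
  ∀ m v, Blank B v → (∀ p ∈ C.sem (funOracle φ) n m v, ∃ c : ℂ, p.2 = c • v) ∧
    ∀ H : List Bool → Vec → ℝ, (∀ b (c : ℂ) w, H b (c • w) = ‖c‖ ^ 2 * H b w) →
      ((C.sem (funOracle φ) n m v).map fun p => H p.1 p.2).sum = 𝔼 i, H (a i m) v

/-- For a function oracle the subroutines are exact on states with blank scratch qubits, and the
adversary's own code keeps these blank. So the simulated oracles can be exchanged for the true ones,
and the coin amplitudes become uniform averages. -/
theorem gameValue_eq {ℓ : ℕ → ℕ} (A : QPTAdversary ℓ) {B : ℕ} (C : Challenge B)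
    (hpre : A.pre.Below B) (hpost : A.post.Below B) {n : ℕ} (φ : Bits n → Bits n)
    {ι : Type} [Fintype ι] {a : ι → Bits n → List Bool} (hC : C.Yields φ a) :
    gameValue A C n (funOracle φ) = 𝔼 i, gameExp A φ φ (a i) := by
  have hencb : ∀ r s v, r < B → s < B → Blank B v → ∀ w ∈ encQ φ r s v, Blank B w :=
    fun r s v _ hs hv => blank_encQ hs φ hv
  have hccab : ∀ o r s v, r < B → s < B → Blank B v → ∀ w ∈ funCCA φ o r s v, Blank B w := by
    intro o r s v hr hs hv w hw
    cases o
    · exact hencb r s v hr hs hv w hw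
    · obtain rfl := Multiset.mem_singleton.1 hw
      exact hv.xorOracle hs _
  have hcode : ∀ P ∈ (start A.pre n).code, P.Below B := by simpa [start] using hpre
  have hrun : run (querySem (funOracle φ) B n) (A.time.eval n) (start A.pre n) =
      run (funCCA φ) (A.time.eval n) (start A.pre n) := by
    refine run_congr_blank (B := B) hccab (fun o r s v hr hs hv => ?_) _ _ hcode (blank_vacuum B)
    cases o
    · exact encSem_funOracle hr hs φ hv
    · exact decSem_funOracle φ v
  have hswap : 𝔼 i, gameExp A φ φ (a i) =
      ((run (funCCA φ) (A.time.eval n) (start A.pre n)).map fun c =>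
        𝔼 σ : Bits c.mem.template.samp.arity, 𝔼 i, postProb A φ c.mem c.vec
          (c.mem.template.message n σ) (a i (c.mem.template.message n σ))).sum := by
    simp only [gameExp, expect_multiset_sum]
    refine congrArg _ (Multiset.map_congr rfl fun c _ => Finset.expect_comm _ _ _)
  rw [hswap, gameValue, hrun]
  refine congrArg _ (Multiset.map_congr rfl fun c hc => ?_)
  have hv : Blank B c.vec := blank_of_mem_run hccab _ _ hcode (blank_vacuum B) c hc
  set t := c.mem.template with ht
  set F : Bits n → ℝ := fun m => 𝔼 i, postProb A φ c.mem c.vec m (a i m) with hF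
  have hl : ∀ l ∈ coinLists (c.mem.ctr 0),
      ((C.sem (funOracle φ) n (t.msg n l) (coinsVec (B + 2, 0) l c.vec)).map fun p =>
        prob (run (fun _ => encSem (funOracle φ) B n)
          (A.time.eval (n + (t.h.eval (List.ofFn (t.msg n l))).length))
          (resumeVec A.post n c.mem p.2 p.1 (t.h.eval (List.ofFn (t.msg n l)))))
          fun μ => μ.get 0 = t.f.eval (List.ofFn (t.msg n l))).sum =
      (2 ^ c.mem.ctr 0 : ℝ)⁻¹ * F (t.msg n l) := by
    intro l hl
    rw [hv.coinsVec, length_of_mem_coinLists hl]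
    set s : ℂ := (((Real.sqrt 2)⁻¹ ^ c.mem.ctr 0 : ℝ) : ℂ) with hs
    obtain ⟨h1, h2⟩ := hC (t.msg n l) (s • c.vec) (hv.smul _)
    have h3 := h2 (fun b w => postProb A φ c.mem w (t.msg n l) b)
      (fun b x w => postProb_smul A φ c.mem x w _ b)
    have h4 : 𝔼 i, postProb A φ c.mem (s • c.vec) (t.msg n l) (a i (t.msg n l)) =
        (2 ^ c.mem.ctr 0 : ℝ)⁻¹ * F (t.msg n l) := by
      simp only [postProb_smul, hs, norm_inv_sqrt_pow, hF, Finset.mul_expect]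
    rw [← h4, ← h3]
    refine congrArg _ (Multiset.map_congr rfl fun p hp => ?_)
    obtain ⟨x, hx⟩ := h1 p hp
    unfold postProb
    -- The challenge has only multiplied the state by a scalar, so the scratch qubits are still
    -- blank in the second phase.
    rw [run_congr_blank (B := B) (O := funEnc φ) (fun _ r s v => hencb r s v)
      (fun _ r s v hr hs hv => encSem_funOracle hr hs φ hv) _ _
      (by simpa [resumeVec] using hpost) (by
        show Blank B p.2
        rw [hx]
        exact (hv.smul _).smul _)]
  rw [Multiset.map_congr rfl hl, sum_coinLists, ← Finset.mul_sum, ← expect_bits]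
  -- The coins beyond the arity of `Samp` are not read, and averaging removes them.
  have har : t.samp.arity ≤ c.mem.ctr 0 :=
    (Circuit.arity_decode_le _).trans_eq (by simp [Mem.get])
  refine Eq.trans ?_ (expect_restrict har fun σ => F (t.message n σ))
  refine Finset.expect_congr rfl fun x _ => congrArg F ?_
  funext i
  simp only [Template.msg, Template.message]
  congr 1
  refine Circuit.eval_congr _ fun i hi => ?_
  simp [hi, hi.trans_le har]

/-! ### The two challenges: random string and true encryption -/

/-- The uniformly random challenge. -/
noncomputable def uniformChal (B : ℕ) (hB : 3 ≤ B) : Challenge B where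
  prog := uniformChallenge B
  sem _ n _ v := (coinLists (n + n)).map fun l => (l, coinsVec (B + 2, 0) l v)
  big O n m μ v h h0 _ := by
    rw [Multiset.map_map]
    exact (big_uniformChallenge O B n μ v hB h0 h.z h.i).mono (by omega)
  length O n m v p hp := by
    obtain ⟨l, hl, rfl⟩ := Multiset.mem_map.1 hp
    exact length_of_mem_coinLists hl

theorem uniformChal_yields {B : ℕ} (hB : 3 ≤ B) {n : ℕ} (φ : Bits n → Bits n) :
    (uniformChal B hB).Yields φ fun (u : Bits (n + n)) _ => List.ofFn u := by
  intro m v hv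
  refine ⟨fun p hp => ?_, fun H hH => ?_⟩
  · obtain ⟨l, -, rfl⟩ := Multiset.mem_map.1 hp
    exact ⟨_, hv.coinsVec _ _ l⟩
  · simp only [uniformChal, Multiset.map_map, Function.comp_def]
    rw [sum_coinLists]
    simp only [hv.coinsVec, hH, List.length_ofFn, norm_inv_sqrt_pow]
    rw [← Finset.mul_sum, ← expect_bits]

theorem measBit_eq {q : Cell} {x : Bool} {v : Vec} (hv : ∀ e ∈ v.support, e q = x) (b : Bool) :
    measBit q v b = if b = x then bmap (fun e => Function.update e q false) v else 0 := by
  have h1 : project q b v = if b = x then v else 0 := by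
    split_ifs with h
    · exact Finsupp.filter_eq_self_iff _ _ |>.2 fun e he =>
        (hv e (Finsupp.mem_support_iff.2 he)).trans h.symm
    · refine Finsupp.filter_eq_zero_iff _ _ |>.2 fun e he => ?_
      by_contra h'
      exact h (he.symm.trans (hv e (Finsupp.mem_support_iff.2 h')))
  rw [measBit, h1]
  by_cases h : b = x
  · subst h
    simp only [if_true]
    cases b
    · rw [if_neg (by simp)]
      refine (bmap_eq_self fun e he => ?_).symm
      rw [← hv e he, Function.update_eq_self]
    · rw [if_pos rfl, flipGate_eq]
      refine bmap_congr fun e he => ?_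
      rw [flipFn_nil, hv e he]
      rfl
  · simp [h]

theorem measVec_zero (Y k : ℕ) (l : List Bool) : measVec Y k l 0 = 0 := by
  induction l generalizing k with
  | nil => rfl
  | cons b l ih =>
    have : measBit (Y, k) 0 b = 0 := by
      rw [measBit_eq (x := b) (by simp)]
      simp
    rw [measVec, this, ih]

/-- If the qubits have definite values, every outcome list but the true one annihilates the state;
the true one merely resets the qubits. -/
theorem measVec_eq {Y : ℕ} {x : ℕ → Bool} (l : List Bool) (k : ℕ) {v : Vec}
    (hv : ∀ e ∈ v.support, ∀ i, k ≤ i → i < k + l.length → e (Y, i) = x i) :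
    measVec Y k l v = if l = (List.range' k l.length).map x then
      bmap (fun e q => if q.1 = Y ∧ k ≤ q.2 ∧ q.2 < k + l.length then false else e q) v else 0 := by
  induction l generalizing k v with
  | nil =>
    simp only [measVec, List.length_nil, List.range'_zero, List.map_nil, if_true]
    refine (bmap_eq_self fun e _ => ?_).symm
    funext q
    rw [if_neg (by omega)]
  | cons b l ih =>
    rw [measVec, measBit_eq (x := x k) (fun e he => hv e he k le_rfl (by simp))]
    simp only [List.length_cons, List.range'_succ, List.map_cons, List.cons.injEq]
    by_cases hb : b = x k
    · rw [if_pos hb, ih]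
      · simp only [hb, true_and]
        split_ifs
        · rw [bmap_bmap]
          refine bmap_congr fun e _ => ?_
          funext q
          obtain ⟨q1, q2⟩ := q
          simp only [Function.comp, Function.update_apply, Prod.mk.injEq]
          by_cases h1 : q1 = Y
          · rcases lt_trichotomy q2 k with h2 | h2 | h2
            · simp only [h1, true_and]
              rw [if_neg (by omega), if_neg (by omega), if_neg (by omega)]
            · simp [h1, h2]
            · simp only [h1, true_and]
              by_cases h3 : q2 < k + (l.length + 1)
              · rw [if_pos (by omega), if_pos (by omega)]
              · rw [if_neg (by omega), if_neg (by omega), if_neg (by omega)]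
          · simp [h1]
        · rfl
      · intro e he i hi hi'
        classical
        obtain ⟨e', he', rfl⟩ := Finset.mem_image.1 (Finsupp.mapDomain_support he)
        have : ((Y, i) : Cell) ≠ (Y, k) := by
          simp only [ne_eq, Prod.mk.injEq, true_and]
          omega
        rw [Function.update_of_ne this]
        exact hv e' he' i (by omega) (by simp only [List.length_cons]; omega)
    · simp [hb, measVec_zero]

theorem mask_ofFn {n : ℕ} (m u : Bits n) :
    mask (fun i => (List.ofFn m).getD i false) 0 (List.ofFn u) =
      List.ofFn fun i => xor (u i) (m i) := by
  have key : ∀ (g : ℕ → Bool) (l : List Bool) (k i : ℕ) (h : i < (mask g k l).length),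
      (mask g k l)[i] = xor (l[i]'(by simpa [length_mask] using h)) (g (k + i)) := by
    intro g l
    induction l with
    | nil => intro k i h; simp [mask] at h
    | cons b l ih =>
      intro k i h
      cases i with
      | zero => simp [mask]
      | succ i =>
        simp only [mask, List.getElem_cons_succ]
        rw [ih]
        congr 2
        omega
  refine List.ext_getElem (by simp [length_mask]) fun i h1 h2 => ?_
  rw [key]
  have : i < n := by simpa using h2
  simp [this]

/-- The encryption of the plaintext as challenge. -/
noncomputable def realChal (B : ℕ) (hB : 3 ≤ B) : Challenge B where
  prog := realChallenge B
  sem O n m v := realSem O B n (fun i => (List.ofFn m).getD i false) v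
  big O n m μ v h h0 hm := by
    have := big_realChallenge O B n μ v hB h.toCounters h0
    rwa [funext hm] at this
  length O n m v p hp := by
    simp only [realSem, Multiset.mem_bind, Multiset.mem_map] at hp
    obtain ⟨ρ, hρ, w, -, u, hu, rfl⟩ := hp
    simp [length_mask, length_of_mem_coinLists hρ, length_of_mem_coinLists hu]

/-- On loaded coins the query writes the definite value `φ ρ` into the blank pad register. The
outcome `u = φ ρ` occurs with certainty, and after reset and unloading the state is again `v`. -/
theorem loadVec_measVec {B n : ℕ} (φ : Bits n → Bits n) {v : Vec} (hv : Blank B v) (ρ u : Bits n) :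
    loadVec B (List.ofFn ρ) (measVec (B + 3) 0 (List.ofFn u)
      (xorOracle φ (B + 2) (B + 3) (loadVec B (List.ofFn ρ) v))) = if u = φ ρ then v else 0 := by
  have hload : ∀ e : Basis, (∀ q : Cell, B ≤ q.1 → e q = false) → ∀ j : Fin n,
      loadFn (B + 2) (fun i => (List.ofFn ρ).getD i false) (List.ofFn ρ).length e (B + 2, (j : ℕ)) =
        ρ j := by
    intro e he j
    simp [loadFn, he (B + 2, (j : ℕ)) (Nat.le_add_right B 2)]
  set x : ℕ → Bool := fun i => (List.ofFn (φ ρ)).getD i false with hx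
  have hsupp : ∀ e ∈ (xorOracle φ (B + 2) (B + 3) (loadVec B (List.ofFn ρ) v)).support, ∀ i, 0 ≤ i →
      i < 0 + (List.ofFn u).length → e (B + 3, i) = x i := by
    classical
    intro e he i _ hi
    rw [xorOracle_eq, loadVec, bmap_bmap] at he
    obtain ⟨e', he', rfl⟩ := Finset.mem_image.1 (Finsupp.mapDomain_support he)
    have hi' : i < n := by simpa using hi
    simp only [Function.comp, xorFn]
    rw [dif_pos ⟨by omega, trivial, hi'⟩]
    have h1 : loadFn (B + 2) (fun i => (List.ofFn ρ).getD i false) (List.ofFn ρ).length e'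
        (B + 3, i) = false := by
      simp only [loadFn]
      rw [if_neg (by omega)]
      exact hv e' he' (B + 3, i) (Nat.le_add_right B 3)
    rw [h1, funext (hload e' (hv e' he'))]
    simp [hx, hi']
  rw [measVec_eq _ _ hsupp]
  have hcond : List.ofFn u = (List.range' 0 (List.ofFn u).length).map x ↔ u = φ ρ := by
    have : (List.range' 0 (List.ofFn u).length).map x = List.ofFn (φ ρ) := by
      refine List.ext_getElem (by simp) fun i h1 h2 => ?_
      have : i < n := by simpa using h2
      simp [hx, this]
    rw [this]
    exact List.ofFn_injective.eq_iff
  simp only [hcond]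
  split_ifs with h
  · rw [xorOracle_eq, loadVec, loadVec, bmap_bmap, bmap_bmap, bmap_bmap]
    refine bmap_eq_self fun e he => ?_
    have he' := hv e he
    funext q
    obtain ⟨q1, q2⟩ := q
    simp only [Function.comp, List.length_ofFn]
    by_cases h2 : q1 = B + 2
    · subst h2
      by_cases hq : q2 < n
      · simp [loadFn, xorFn, hq, he' (B + 2, q2) (Nat.le_add_right B 2)]
      · simp [loadFn, xorFn, hq]
    · by_cases h3 : q1 = B + 3
      · subst h3
        by_cases hq : q2 < n
        · simp [loadFn, hq, he' (B + 3, q2) (Nat.le_add_right B 3)]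
        · simp [loadFn, xorFn, hq]
      · simp [loadFn, xorFn, h2, h3]
  · simp [loadVec]

theorem realChal_yields {B : ℕ} (hB : 3 ≤ B) {n : ℕ} (φ : Bits n → Bits n) :
    (realChal B hB).Yields φ fun (ρ : Bits n) m => List.ofFn (encFn φ m ρ) := by
  intro m v hv
  have key : realSem (funOracle φ) B n (fun i => (List.ofFn m).getD i false) v =
      (Finset.univ : Finset (Bits n)).val.bind fun ρ => (Finset.univ : Finset (Bits n)).val.map
        fun u => (List.ofFn ρ ++ List.ofFn (fun i => xor (u i) (m i)),
          if u = φ ρ then (((Real.sqrt 2)⁻¹ ^ n : ℝ) : ℂ) • v else 0) := by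
    simp only [realSem, funOracle, Multiset.singleton_bind, coinLists_eq, Multiset.bind_map,
      Multiset.map_map]
    refine Multiset.bind_congr fun ρ _ => Multiset.map_congr rfl fun u _ => ?_
    simp only [Function.comp, mask_ofFn, hv.coinsVec, loadVec_measVec φ (hv.smul _),
      List.length_ofFn]
  refine ⟨fun p hp => ?_, fun H hH => ?_⟩
  · simp only [realChal, key, Multiset.mem_bind, Multiset.mem_map] at hp
    obtain ⟨ρ, -, u, -, rfl⟩ := hp
    by_cases h : u = φ ρ
    · exact ⟨_, if_pos h⟩
    · exact ⟨0, by simp [h]⟩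
  -- The impossible outcomes leave the zero vector, on which a quadratically homogeneous function
  -- vanishes.
  · have hH0 : ∀ b, H b 0 = 0 := fun b => by simpa using hH b 0 0
    simp only [realChal, key, Multiset.map_bind, Multiset.map_map, Multiset.sum_bind]
    show ∑ ρ : Bits n, ∑ u : Bits n, H _ (if u = φ ρ then _ else 0) = _
    rw [expect_bits, Finset.mul_sum]
    refine Finset.sum_congr rfl fun ρ _ => ?_
    rw [Finset.sum_eq_single (φ ρ)]
    · rw [if_pos rfl, hH, norm_inv_sqrt_pow]
      congr 2
      rw [encFn, List.ofFn_fin_append]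
    · intro u _ hu
      rw [if_neg hu, hH0]
    · simp

/-! ### The simulator -/

/-- The simulator has a larger time polynomial than the adversary; extra steps after halting leave
the histories of the first phase unchanged. -/
theorem run_of_halts {Q : Type} {O : Oracle Q} {s t : ℕ} {c : Config Q}
    (h : ∀ d ∈ run O s c, d.code = []) (hst : s ≤ t) : run O t c = run O s c := by
  obtain ⟨j, rfl⟩ := Nat.exists_eq_add_of_le hst
  rw [run_add]
  refine (Multiset.bind_congr fun d hd => ?_).trans (Multiset.bind_pure _)
  obtain ⟨l, μ, v⟩ := d
  obtain rfl : l = [] := h _ hd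
  exact run_nil O j μ v

theorem ends_of_halts {Q : Type} {O : Oracle Q} {t : ℕ} {l : List (Prog Q)} {μ : Mem} {v : Vec}
    (h : ∀ c ∈ run O t ⟨l, μ, v⟩, c.code = []) :
    Ends O t l μ v ((run O t ⟨l, μ, v⟩).map fun c => (c.mem, c.vec)) := by
  rw [Ends, Multiset.map_map]
  refine (Multiset.map_id _).symm.trans (Multiset.map_congr rfl fun c hc => ?_)
  obtain ⟨l', ν, w⟩ := c
  obtain rfl : l' = [] := h _ hc
  rfl

/-- The scratch counters are still zero when the second phase starts, since the first phase only
uses registers below `B`. Halting holds for an arbitrary oracle, as `QPTAdversary` demands. -/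
theorem run_simulator {ℓ : ℕ → ℕ} (A : QPTAdversary ℓ) {B n t : ℕ} (hB : 3 ≤ B)
    (hℓ : ℓ n = n + n) (hpre : A.pre.Below B) {O : Oracle CCAQuery} {c : Config CCAQuery}
    (hc : c ∈ run O (A.time.eval n) (start A.pre n)) {a w : List Bool} (ha : a.length = n)
    (O' : Oracle Unit) (ht : n * 100 + 101 + A.time.eval (n + w.length) ≤ t) :
    (∀ c' ∈ run O' t (resume (.seq (uniformChallenge B) A.post) n c a w), c'.code = []) ∧
    ∀ p : Mem → Prop, prob (run O' t (resume (.seq (uniformChallenge B) A.post) n c a w)) p =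
      ((coinLists (n + n)).map fun l => prob (run O' (A.time.eval (n + w.length))
        (resumeVec A.post n c.mem (coinsVec (B + 2, 0) l c.vec) l w)) p).sum := by
  have hctr : ∀ x, B ≤ x → (((c.mem.put 0 (unary n)).put 1 a).put 2 w).ctr x = 0 := by
    intro x hx
    have h1 : c.mem.ctr x = (start A.pre n).mem.ctr x :=
      mem_ctr_of_mem_run O _ _ (by simpa [start] using hpre) c hc x hx
    have h2 : x ≠ 0 := by omega
    have h3 : x ≠ 1 := by omega
    have h4 : x ≠ 2 := by omega
    simp [Mem.put, h1, start, Mem.blank, h2, h3, h4]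
  have h1 := big_uniformChallenge O' B n (((c.mem.put 0 (unary n)).put 1 a).put 2 w) c.vec hB
    (by simp [Mem.put, unary]) (hctr _ (by omega)) (hctr _ (by omega))
  -- The fake ciphertext has length `2n` and overwrites all `n` symbols of the length challenge, so
  -- no trace of it remains in the memory.
  have hput : ∀ l ∈ coinLists (n + n), (((c.mem.put 0 (unary n)).put 1 a).put 2 w).put 1 l =
      ((c.mem.put 0 (unary n)).put 1 l).put 2 w := by
    intro l hl
    have hl := length_of_mem_coinLists hl
    rw [Mem.put_comm _ (by omega : 2 ≠ 1)]
    congr 1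
    ext x
    · simp [Mem.put]
    · simp only [Mem.put]
      by_cases h : x.1 = 1 ∧ x.2 < l.length
      · simp [h]
      · rw [if_neg h, if_neg h, if_neg (by omega)]
  have h2 := h1 [A.post] (A.time.eval (n + w.length))
    (fun p => (run O' (A.time.eval (n + w.length)) ⟨[A.post], p.1, p.2⟩).map fun c => (c.mem, c.vec))
    (by
      intro p hp
      obtain ⟨l, hl, rfl⟩ := Multiset.mem_map.1 hp
      refine ends_of_halts ?_
      rw [hput l hl]
      exact A.halts_post hc ((length_of_mem_coinLists hl).trans hℓ.symm) _ O')
  have h3 := (ends_cons_of_step (P := .seq (uniformChallenge B) A.post) (l := []) rfl h2).mono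
    (t' := t) (by omega)
  have h4 : run O' t (resume (.seq (uniformChallenge B) A.post) n c a w) = _ := h3
  refine ⟨fun c' hc' => ?_, fun p => ?_⟩
  · rw [h4] at hc'
    obtain ⟨p, -, rfl⟩ := Multiset.mem_map.1 hc'
    rfl
  · classical
    simp only [h4, prob_eq, Multiset.map_bind, Multiset.sum_bind, Multiset.map_map,
      Function.comp_def]
    refine congrArg _ (Multiset.map_congr rfl fun l hl => ?_)
    simp only [hput l hl]
    rfl

/-- The simulator runs the adversary and gives it a uniformly random string as ciphertext. -/
noncomputable def simulator {ℓ ℓ' : ℕ → ℕ} (A : QPTAdversary ℓ) {B : ℕ} (hB : 3 ≤ B)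
    (hℓ : ∀ n, ℓ n = n + n) (hℓ' : ∀ n, ℓ' n = n) (hpre : A.pre.Below B) : QPTAdversary ℓ' where
  pre := A.pre
  post := .seq (uniformChallenge B) A.post
  time := A.time + 100 * Polynomial.X + 101
  halts n O c hc := by
    rw [run_of_halts (fun d hd => (A.halts n O d hd).1) (by simp; omega)] at hc
    refine ⟨(A.halts n O c hc).1, fun a w O' ha => ?_⟩
    refine (run_simulator A hB (hℓ n) hpre hc (ha.trans (hℓ' n)) O' ?_).1
    simp only [Polynomial.eval_add, Polynomial.eval_mul, Polynomial.eval_X, Polynomial.eval_ofNat]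
    omega

/-! ### Winning probabilities for the scheme in terms of its function -/

/-- The probability that the adversary wins the game for the function `φ`. -/
noncomputable def realValue {ℓ : ℕ → ℕ} (A : QPTAdversary ℓ) {n : ℕ} (φ : Bits n → Bits n) : ℝ :=
  𝔼 ρ : Bits n, gameExp A φ φ fun m => List.ofFn (encFn φ m ρ)

/-- The probability that the simulator wins the game for the function `φ`. -/
noncomputable def idealValue {ℓ : ℕ → ℕ} (A : QPTAdversary ℓ) {n : ℕ} (φ : Bits n → Bits n) : ℝ :=
  𝔼 u : Bits (n + n), gameExp A φ φ fun _ => List.ofFn u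

theorem ccaOracle_prfScheme (F : KeyedFamily) (n : ℕ) (k : Bits n) :
    (prfScheme F).ccaOracle n k = funCCA (F n k) := by
  funext o
  cases o <;> rfl

theorem semWinProb_prfScheme (F : KeyedFamily) (b : Bool)
    (A : QPTAdversary ((prfScheme F).chalLen b)) (n : ℕ) :
    (prfScheme F).semWinProb b A n = 𝔼 k : Bits n,
      ((run (funCCA (F n k)) (A.time.eval n) (start A.pre n)).map fun c =>
        𝔼 σ : Bits c.mem.template.samp.arity, 𝔼 ρ : Bits n,
          postProb A (F n k) c.mem c.vec (c.mem.template.message n σ)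
            (if b then List.ofFn (encFn (F n k) (c.mem.template.message n σ) ρ) else unary n)).sum := by
  refine Finset.expect_congr rfl fun (k : Bits n) _ => ?_
  rw [← ccaOracle_prfScheme F n k]
  rfl

theorem semWinProb_real (F : KeyedFamily) (A : QPTAdversary ((prfScheme F).chalLen true)) (n : ℕ) :
    (prfScheme F).semWinProb true A n = 𝔼 k : Bits n, realValue A (F n k) := by
  rw [semWinProb_prfScheme]
  refine Finset.expect_congr rfl fun k _ => ?_
  simp only [realValue, gameExp, expect_multiset_sum]
  exact congrArg _ (Multiset.map_congr rfl fun c _ => Finset.expect_comm _ _ _)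

theorem preRun_simulator {ℓ ℓ' : ℕ → ℕ} (S : SKES) (A : QPTAdversary ℓ) {B : ℕ} (hB : 3 ≤ B)
    (hℓ : ∀ n, ℓ n = n + n) (hℓ' : ∀ n, ℓ' n = n) (hpre : A.pre.Below B) (n : ℕ)
    (k : Bits (S.keyLen n)) :
    S.preRun (simulator (ℓ' := ℓ') A hB hℓ hℓ' hpre) n k = S.preRun A n k :=
  run_of_halts (fun d hd => (A.halts n _ d hd).1) (by simp [simulator]; omega)

theorem blank_of_mem_run_funCCA {B n t : ℕ} (φ : Bits n → Bits n) {P : Prog CCAQuery}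
    (hP : P.Below B) : ∀ c ∈ run (funCCA φ) t (start P n), Blank B c.vec := by
  refine blank_of_mem_run (O := funCCA φ) (fun o r s v hr hs hv w hw => ?_) _ _
    (by simpa [start] using hP) (blank_vacuum B)
  cases o
  · exact blank_encQ hs _ hv w hw
  · obtain rfl := Multiset.mem_singleton.1 hw
    exact hv.xorOracle hs _

/-- The `2n` tosses scale the state without otherwise changing it, so the simulator's winning
probability is the adversary's, averaged over a uniform challenge. -/
theorem postProb_simulator {ℓ ℓ' : ℕ → ℕ} (A : QPTAdversary ℓ) {B : ℕ} (hB : 3 ≤ B)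
    (hℓ : ∀ n, ℓ n = n + n) (hℓ' : ∀ n, ℓ' n = n) (hpre : A.pre.Below B) {n : ℕ}
    (φ : Bits n → Bits n) {c : Config CCAQuery}
    (hc : c ∈ run (funCCA φ) (A.time.eval n) (start A.pre n)) (m : Bits n) :
    postProb (simulator (ℓ' := ℓ') A hB hℓ hℓ' hpre) φ c.mem c.vec m (unary n) =
      𝔼 u : Bits (n + n), postProb A φ c.mem c.vec m (List.ofFn u) := by
  have hv := blank_of_mem_run_funCCA φ hpre c hc
  have h := (run_simulator A (w := c.mem.template.h.eval (List.ofFn m)) (a := unary n)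
    (t := (simulator (ℓ' := ℓ') A hB hℓ hℓ' hpre).time.eval
      (n + (c.mem.template.h.eval (List.ofFn m)).length)) hB (hℓ n) hpre hc (by simp [unary])
    (funEnc φ) (by
      simp only [simulator, Polynomial.eval_add, Polynomial.eval_mul, Polynomial.eval_X,
        Polynomial.eval_ofNat]
      omega)).2 (fun μ => μ.get 0 = c.mem.template.f.eval (List.ofFn m))
  have e : postProb (simulator (ℓ' := ℓ') A hB hℓ hℓ' hpre) φ c.mem c.vec m (unary n) = _ := h
  rw [e, sum_coinLists, expect_bits, Finset.mul_sum]
  refine Finset.sum_congr rfl fun u _ => ?_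
  rw [hv.coinsVec, List.length_ofFn, ← norm_inv_sqrt_pow]
  exact postProb_smul A φ c.mem _ c.vec m (List.ofFn u)

theorem semWinProb_simulator (F : KeyedFamily) {ℓ : ℕ → ℕ} (A : QPTAdversary ℓ) {B : ℕ}
    (hB : 3 ≤ B) (hℓ : ∀ n, ℓ n = n + n) (hℓ' : ∀ n, (prfScheme F).chalLen false n = n)
    (hpre : A.pre.Below B) (n : ℕ) :
    (prfScheme F).semWinProb false (simulator A hB hℓ hℓ' hpre) n =
      𝔼 k : Bits n, idealValue A (F n k) := by
  rw [semWinProb_prfScheme]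
  refine Finset.expect_congr rfl fun k _ => ?_
  have hrun : run (funCCA (F n k)) ((simulator (ℓ' := (prfScheme F).chalLen false) A hB hℓ hℓ'
      hpre).time.eval n) (start A.pre n) = run (funCCA (F n k)) (A.time.eval n) (start A.pre n) :=
    run_of_halts (fun d hd => (A.halts n _ d hd).1) (by simp [simulator]; omega)
  simp only [idealValue, gameExp, expect_multiset_sum]
  rw [show (simulator (ℓ' := (prfScheme F).chalLen false) A hB hℓ hℓ' hpre).pre = A.pre from rfl,
    hrun]
  refine congrArg Multiset.sum (Multiset.map_congr rfl fun c hc => ?_)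
  refine Eq.trans ?_ (Finset.expect_comm _ _ _)
  refine Finset.expect_congr rfl fun σ _ => ?_
  have h := postProb_simulator (ℓ' := (prfScheme F).chalLen false) A hB hℓ hℓ' hpre (F n k) hc
    (c.mem.template.message n σ)
  rw [← h]
  simp only [Bool.false_eq_true, if_false]
  -- With `b = 0` the challenge does not depend on the encryption coins, and averaging over them has
  -- no effect.
  exact Fintype.expect_const (ι := Bits n) _

/-! ### Quantum query bounds -/

/-- Nonnegative functions of the state that behave like probabilities. -/
structure ProbLike (P : Vec → ℝ) : Prop where
  nonneg : ∀ v, 0 ≤ P v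
  le : ∀ v, P v ≤ normSq v
  abs_sub_le : ∀ κ : ℝ, 0 < κ → ∀ v w,
    |P v - P w| ≤ κ / 2 * normSq (v - w) + 1 / (2 * κ) * normSq (v + w)

/-- Weighted AM-GM, from the square of `κ * s - t`. -/
theorem abs_mul_le {κ : ℝ} (hκ : 0 < κ) (s t : ℝ) :
    |s * t| ≤ κ / 2 * s ^ 2 + 1 / (2 * κ) * t ^ 2 := by
  have h : ∀ s t : ℝ, s * t ≤ κ / 2 * s ^ 2 + 1 / (2 * κ) * t ^ 2 := by
    intro s t
    have e : κ / 2 * s ^ 2 + 1 / (2 * κ) * t ^ 2 - s * t = 1 / (2 * κ) * (κ * s - t) ^ 2 := by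
      field_simp
      ring
    have : 0 ≤ 1 / (2 * κ) * (κ * s - t) ^ 2 := by positivity
    linarith
  refine abs_le.2 ⟨?_, h s t⟩
  have := h (-s) t
  simp only [neg_mul, neg_sq] at this
  linarith

/-- The difference of squares is the real part of a product of `a - b` with the conjugate of `a +
b`, bounded by AM-GM. Unlike the product of two norms, the linearised bound adds up over coordinates
and histories; `κ` is chosen only at the end. -/
theorem abs_sq_norm_sub_le {κ : ℝ} (hκ : 0 < κ) (a b : ℂ) :
    |‖a‖ ^ 2 - ‖b‖ ^ 2| ≤ κ / 2 * ‖a - b‖ ^ 2 + 1 / (2 * κ) * ‖a + b‖ ^ 2 := by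
  simp only [← Complex.normSq_eq_norm_sq, Complex.normSq_apply, Complex.sub_re, Complex.sub_im,
    Complex.add_re, Complex.add_im]
  have h1 := abs_le.1 (abs_mul_le hκ (a.re - b.re) (a.re + b.re))
  have h2 := abs_le.1 (abs_mul_le hκ (a.im - b.im) (a.im + b.im))
  refine abs_le.2 ⟨?_, ?_⟩ <;> nlinarith

theorem normSq_sub_le (v w : Vec) : normSq (v - w) ≤ 2 * (normSq v + normSq w) := by
  have := normSq_add_add_normSq_sub v w
  have := normSq_nonneg (v + w)
  linarith

theorem normSq_add_le (v w : Vec) : normSq (v + w) ≤ 2 * (normSq v + normSq w) := by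
  have := normSq_add_add_normSq_sub v w
  have := normSq_nonneg (v - w)
  linarith

theorem probLike_normSq : ProbLike normSq where
  nonneg := normSq_nonneg
  le _ := le_rfl
  abs_sub_le κ hκ v w := by
    classical
    rw [normSq_eq_sum (v := v + w) (s := v.support ∪ w.support) Finsupp.support_add,
      normSq_eq_sum (v := v - w) (s := v.support ∪ w.support) Finsupp.support_sub,
      normSq_eq_sum (v := v) (s := v.support ∪ w.support) Finset.subset_union_left,
      normSq_eq_sum (v := w) (s := v.support ∪ w.support) Finset.subset_union_right,
      ← Finset.sum_sub_distrib, Finset.mul_sum, Finset.mul_sum, ← Finset.sum_add_distrib]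
    exact (Finset.abs_sum_le_sum_abs _ _).trans
      (Finset.sum_le_sum fun e _ => abs_sq_norm_sub_le hκ (v e) (w e))

theorem probLike_zero : ProbLike fun _ => 0 where
  nonneg _ := le_rfl
  le := normSq_nonneg
  abs_sub_le κ hκ v w := by
    have := normSq_nonneg (v - w)
    have := normSq_nonneg (v + w)
    simp only [sub_self, abs_zero]
    positivity

theorem ProbLike.expect {ι : Type*} [Fintype ι] [Nonempty ι] {P : ι → Vec → ℝ}
    (h : ∀ i, ProbLike (P i)) : ProbLike fun v => 𝔼 i, P i v where
  nonneg v := Finset.expect_nonneg fun i _ => (h i).nonneg v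
  le v := Finset.expect_le Finset.univ_nonempty fun i _ => (h i).le v
  abs_sub_le κ hκ v w := by
    rw [← Finset.expect_sub_distrib]
    exact (Finset.abs_expect_le _ _).trans
      (Finset.expect_le Finset.univ_nonempty fun i _ => (h i).abs_sub_le κ hκ v w)

theorem _root_.Multiset.abs_sum_map_sub_le {α : Type*} (M : Multiset α) (f g b : α → ℝ)
    (h : ∀ a ∈ M, |f a - g a| ≤ b a) : |(M.map f).sum - (M.map g).sum| ≤ (M.map b).sum := by
  induction M using Multiset.induction with
  | empty => simp
  | cons a M ih =>
    simp only [Multiset.map_cons, Multiset.sum_cons]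
    have h1 := abs_le.1 (h a (Multiset.mem_cons_self a M))
    have h2 := abs_le.1 (ih fun b hb => h b (Multiset.mem_cons_of_mem hb))
    exact abs_le.2 ⟨by linarith, by linarith⟩

/-- By linearity the differences and sums of the results are the results for `v - w` and `v + w`,
whose squared norms add up to those of `v - w` and `v + w`. -/
theorem ProbLike.of_linearIn {Q : Type} {H : Vec → Multiset (Config Q)} (hH : LinearIn H)
    {g : Config Q → ℝ} (hg : ∀ l μ, ProbLike fun v => g ⟨l, μ, v⟩) :
    ProbLike fun v => ((H v).map g).sum := by
  obtain ⟨K, h1, h2⟩ := hH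
  simp only [h1, Multiset.map_map, Function.comp_def]
  refine ⟨fun v => ?_, fun v => ?_, fun κ hκ v w => ?_⟩
  · refine Multiset.sum_nonneg fun x hx => ?_
    obtain ⟨i, -, rfl⟩ := Multiset.mem_map.1 hx
    exact (hg _ _).nonneg _
  · rw [← h2 v]
    exact Multiset.sum_map_le_sum_map _ _ fun i _ => (hg _ _).le _
  · refine (Multiset.abs_sum_map_sub_le K _ _ (fun i => κ / 2 * normSq (i.2.2 v - i.2.2 w) +
      1 / (2 * κ) * normSq (i.2.2 v + i.2.2 w)) fun i _ => (hg _ _).abs_sub_le κ hκ _ _).trans_eq ?_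
    rw [Multiset.sum_map_add, Multiset.sum_map_mul_left, Multiset.sum_map_mul_left,
      ← h2 (v - w), ← h2 (v + w)]
    simp

theorem ProbLike.run {Q : Type} {O : Oracle Q} (hO : O.IsLinear) {g : Config Q → ℝ}
    (hg : ∀ l μ, ProbLike fun v => g ⟨l, μ, v⟩) (t : ℕ) (l : List (Prog Q)) (μ : Mem) :
    ProbLike fun v => ((run O t ⟨l, μ, v⟩).map g).sum :=
  ProbLike.of_linearIn (linearIn_run hO t l μ) hg

theorem sum_normSq_step {Q : Type} {O : Oracle Q} (hO : O.IsLinear) (c : Config Q) :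
    ((step O c).map fun d => normSq d.vec).sum = normSq c.vec := by
  obtain ⟨K, h1, h2⟩ := linearIn_step hO c.code c.mem
  have h3 : step O c = _ := h1 c.vec
  rw [h3, Multiset.map_map, ← h2 c.vec]
  rfl

theorem sum_normSq_run {Q : Type} {O : Oracle Q} (hO : O.IsLinear) (t : ℕ) (c : Config Q) :
    ((run O t c).map fun d => normSq d.vec).sum = normSq c.vec := by
  obtain ⟨K, h1, h2⟩ := linearIn_run hO t c.code c.mem
  have h3 : run O t c = _ := h1 c.vec
  rw [h3, Multiset.map_map, ← h2 c.vec]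
  rfl

theorem step_eq_or_query {Q : Type} (c : Config Q) : (∀ O O' : Oracle Q, step O c = step O' c) ∨
    ∃ o r s l, ∀ O : Oracle Q, step O c = (O o r s c.vec).map fun v => ⟨l, c.mem, v⟩ := by
  obtain ⟨l, μ, v⟩ := c
  cases l with
  | nil => exact Or.inl fun _ _ => rfl
  | cons P l =>
    cases P with
    | query o r s => exact Or.inr ⟨o, r, s, l, fun _ => rfl⟩
    | _ => exact Or.inl fun _ _ => rfl

/-- If the oracles `O' i` are, in total over `i`, hard to distinguish from `O` with one query, then so
they are with `t` steps. -/
theorem sum_abs_run_sub_le {Q : Type} {ι : Type*} [Fintype ι] {O : Oracle Q} {O' : ι → Oracle Q}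
    (hO : O.IsLinear) (hO' : ∀ i, (O' i).IsLinear) {K : ℝ} (hK : 0 ≤ K)
    (hq : ∀ o r s v (P : ι → Vec → ℝ), (∀ i, ProbLike (P i)) →
      ∑ i, |((O o r s v).map (P i)).sum - ((O' i o r s v).map (P i)).sum| ≤ K * normSq v)
    {g : ι → Config Q → ℝ} (hg : ∀ i l μ, ProbLike fun v => g i ⟨l, μ, v⟩) (t : ℕ) (c : Config Q) :
    ∑ i, |((run O t c).map (g i)).sum - ((run (O' i) t c).map (g i)).sum| ≤
      t * K * normSq c.vec := by
  induction t generalizing c with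
  | zero => simp [run]
  | succ t ih =>
    set G : ι → Config Q → ℝ := fun i d => ((run O t d).map (g i)).sum with hG
    set G' : ι → Config Q → ℝ := fun i d => ((run (O' i) t d).map (g i)).sum with hG'
    have h1 : ∀ i, ((run O (t + 1) c).map (g i)).sum = ((step O c).map (G i)).sum := fun i => by
      rw [run, Multiset.map_bind, Multiset.sum_bind]
    have h2 : ∀ i, ((run (O' i) (t + 1) c).map (g i)).sum = ((step (O' i) c).map (G' i)).sum :=
      fun i => by rw [run, Multiset.map_bind, Multiset.sum_bind]
    -- Hybrid argument: the oracle is exchanged first in the last `t` steps. The induction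
    -- hypothesis applies in each branch, and the squared norms of the branches add up to that of
    -- `c.vec`.
    have h3 : ∑ i, |((step O c).map (G i)).sum - ((step O c).map (G' i)).sum| ≤
        t * K * normSq c.vec := by
      calc ∑ i, |((step O c).map (G i)).sum - ((step O c).map (G' i)).sum|
          ≤ ∑ i, ((step O c).map fun d => |G i d - G' i d|).sum :=
            Finset.sum_le_sum fun i _ => Multiset.abs_sum_map_sub_le _ _ _ _ fun _ _ => le_rfl
        _ = ((step O c).map fun d => ∑ i, |G i d - G' i d|).sum := by
            rw [Multiset.sum_map_sum]
        _ ≤ ((step O c).map fun d => t * K * normSq d.vec).sum :=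
            Multiset.sum_map_le_sum_map _ _ fun d _ => ih d
        _ = t * K * normSq c.vec := by
            rw [Multiset.sum_map_mul_left, sum_normSq_step hO]
    -- Then in the first step, where only a query matters. What follows it is a probability-like
    -- function of its result, so `hq` applies.
    have h4 : ∑ i, |((step O c).map (G' i)).sum - ((step (O' i) c).map (G' i)).sum| ≤
        K * normSq c.vec := by
      rcases step_eq_or_query c with h | ⟨o, r, s, l, h⟩
      · simp only [h (O' _) O, sub_self, abs_zero, Finset.sum_const_zero]
        exact mul_nonneg hK (normSq_nonneg _)
      · simp only [h, Multiset.map_map]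
        exact hq o r s c.vec _ fun i => ProbLike.run (hO' i) (hg i) t l c.mem
    calc ∑ i, |((run O (t + 1) c).map (g i)).sum - ((run (O' i) (t + 1) c).map (g i)).sum|
        ≤ ∑ i, (|((step O c).map (G i)).sum - ((step O c).map (G' i)).sum| +
            |((step O c).map (G' i)).sum - ((step (O' i) c).map (G' i)).sum|) := by
          refine Finset.sum_le_sum fun i _ => ?_
          rw [h1, h2]
          exact abs_sub_le _ _ _
      _ ≤ t * K * normSq c.vec + K * normSq c.vec := by
          rw [Finset.sum_add_distrib]
          exact add_le_add h3 h4
      _ = (t + 1 : ℕ) * K * normSq c.vec := by push_cast; ring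

/-- The coins are classical, so the oracles differ only in the branch with coins `x`, which has
weight `2^(-n)`. Superpositions of plaintexts do not help. -/
theorem abs_encQ_sub_le {n : ℕ} (φ : Bits n → Bits n) (x y : Bits n) (r s : ℕ) (v : Vec)
    {P : Vec → ℝ} (hP : ProbLike P) :
    |((encQ φ r s v).map P).sum - ((encQ (Function.update φ x y) r s v).map P).sum| ≤
      (2 ^ n : ℝ)⁻¹ * normSq v := by
  have hb : ∀ (ψ : Bits n → Bits n) ρ, P ((((Real.sqrt (2 ^ n))⁻¹ : ℝ) : ℂ) •
      xorOracle (fun m => encFn ψ m ρ) r s v) ≤ (2 ^ n : ℝ)⁻¹ * normSq v := by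
    intro ψ ρ
    refine (hP.le _).trans_eq ?_
    rw [normSq_smul, norm_inv_sqrt_two_pow, xorOracle_eq, normSq_bmap (xorFn_injective _ _ _)]
  simp only [encQ, Multiset.map_map]
  show |∑ ρ : Bits n, P (_ • xorOracle (fun m => encFn φ m ρ) r s v) -
    ∑ ρ : Bits n, P (_ • xorOracle (fun m => encFn (Function.update φ x y) m ρ) r s v)| ≤ _
  rw [← Finset.sum_sub_distrib, Finset.sum_eq_single x]
  · have h1 := hb φ x
    have h2 := hb (Function.update φ x y) x
    have h3 := hP.nonneg ((((Real.sqrt (2 ^ n))⁻¹ : ℝ) : ℂ) • xorOracle (fun m => encFn φ m x) r s v)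
    have h4 := hP.nonneg ((((Real.sqrt (2 ^ n))⁻¹ : ℝ) : ℂ) •
      xorOracle (fun m => encFn (Function.update φ x y) m x) r s v)
    exact abs_le.2 ⟨by linarith, by linarith⟩
  · intro ρ _ hρ
    have : ∀ m, encFn (Function.update φ x y) m ρ = encFn φ m ρ := fun m => by
      simp [encFn, Function.update_of_ne hρ]
    simp [this]
  · simp

/-! ### The weight of a decryption query on a point -/

/-- The part of the state in which the first `n` qubits of tape `r` hold `x`. -/
noncomputable def inputPart {n : ℕ} (r : ℕ) (x : Bits n) (v : Vec) : Vec :=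
  v.filter fun e => (fun j : Fin n => e (r, (j : ℕ))) = x

theorem sum_normSq_inputPart {n : ℕ} (r : ℕ) (v : Vec) :
    ∑ x : Bits n, normSq (inputPart r x v) = normSq v := by
  have h : ∀ x : Bits n, normSq (inputPart r x v) = ∑ e ∈ v.support,
      if (fun j : Fin n => e (r, (j : ℕ))) = x then ‖v e‖ ^ 2 else 0 := by
    intro x
    rw [normSq_eq_sum (s := v.support) (by simp [inputPart])]
    refine Finset.sum_congr rfl fun e _ => ?_
    simp only [inputPart, Finsupp.filter_apply]
    split_ifs <;> simp
  simp only [h]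
  rw [Finset.sum_comm, normSq_eq_sum subset_rfl]
  simp

/-- Decryption evaluates the function only at the first half of the ciphertext, so the two oracles
agree on the part of the state where that half differs from `x`. -/
theorem xorOracle_dec_sub {n : ℕ} (φ : Bits n → Bits n) (x y : Bits n) (r s : ℕ) (v : Vec) :
    xorOracle (decFn φ) r s v - xorOracle (decFn (Function.update φ x y)) r s v =
      xorOracle (decFn φ) r s (inputPart r x v) -
        xorOracle (decFn (Function.update φ x y)) r s (inputPart r x v) := by
  set w := v.filter fun e => ¬ (fun j : Fin n => e (r, (j : ℕ))) = x with hw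
  have hv : v = inputPart r x v + w := (Finsupp.filter_add_filter_not v _).symm
  have h : xorOracle (decFn φ) r s w = xorOracle (decFn (Function.update φ x y)) r s w := by
    rw [xorOracle_eq, xorOracle_eq]
    refine bmap_congr fun e he => ?_
    have he' : ¬ (fun j : Fin n => e (r, (j : ℕ))) = x := by
      rw [hw, Finsupp.support_filter, Finset.mem_filter] at he
      exact he.2
    funext q
    simp only [xorFn, decFn]
    rw [Function.update_of_ne]
    exact he'
  conv_lhs => rw [hv, map_add, map_add, h]
  abel

/-- The parts of the state on the different points have total squared norm `normSq v`, so only few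
points can carry much weight. Summed over all `2^n` points, the two terms of the continuity estimate
are `2 * κ` and `2 * 2^n / κ` times `normSq v`; they balance at `κ = √(2^n)`. -/
theorem sum_abs_dec_sub_le {n : ℕ} (φ : Bits n → Bits n) (y : Bits n) (r s : ℕ) (v : Vec)
    {P : Bits n → Vec → ℝ} (hP : ∀ x, ProbLike (P x)) :
    ∑ x, |P x (xorOracle (decFn φ) r s v) - P x (xorOracle (decFn (Function.update φ x y)) r s v)| ≤
      4 * Real.sqrt (2 ^ n) * normSq v := by
  set κ := Real.sqrt (2 ^ n) with hκ
  have hκ0 : 0 < κ := Real.sqrt_pos.2 (by positivity)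
  have hκ2 : κ * κ = 2 ^ n := Real.mul_self_sqrt (by positivity)
  have hn : ∀ (ψ : Bits n → Bits n) (w : Vec), normSq (xorOracle (decFn ψ) r s w) = normSq w := by
    intro ψ w
    rw [xorOracle_eq, normSq_bmap (xorFn_injective _ _ _)]
  calc _ ≤ ∑ x : Bits n, (κ / 2 * (4 * normSq (inputPart r x v)) +
        1 / (2 * κ) * (4 * normSq v)) := by
        refine Finset.sum_le_sum fun x _ => ((hP x).abs_sub_le κ hκ0 _ _).trans ?_
        have h1 := normSq_sub_le (xorOracle (decFn φ) r s (inputPart r x v))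
          (xorOracle (decFn (Function.update φ x y)) r s (inputPart r x v))
        have h2 := normSq_add_le (xorOracle (decFn φ) r s v)
          (xorOracle (decFn (Function.update φ x y)) r s v)
        rw [← xorOracle_dec_sub, hn, hn] at h1
        rw [hn, hn] at h2
        gcongr
        · linarith
        · linarith
    _ = 4 * κ * normSq v := by
        rw [Finset.sum_add_distrib, ← Finset.mul_sum, ← Finset.mul_sum, sum_normSq_inputPart,
          Finset.sum_const, Finset.card_univ]
        simp only [Fintype.card_fun, Fintype.card_bool, Fintype.card_fin, nsmul_eq_mul]
        push_cast
        rw [← hκ2]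
        field_simp
        ring

/-- Encryption queries contribute a total of only `1` over all points, so the decryption queries
determine the constant. -/
theorem sum_abs_run_funCCA_sub_le {n : ℕ} (φ : Bits n → Bits n) (y : Bits n)
    {g : Bits n → Config CCAQuery → ℝ} (hg : ∀ x l μ, ProbLike fun v => g x ⟨l, μ, v⟩) (t : ℕ)
    (c : Config CCAQuery) :
    ∑ x, |((run (funCCA φ) t c).map (g x)).sum -
        ((run (funCCA (Function.update φ x y)) t c).map (g x)).sum| ≤
      t * (4 * Real.sqrt (2 ^ n)) * normSq c.vec := by
  refine sum_abs_run_sub_le (isLinear_funCCA φ) (fun x => isLinear_funCCA _) (by positivity)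
    (fun o r s v P hP => ?_) hg t c
  cases o
  · calc _ ≤ ∑ x : Bits n, (2 ^ n : ℝ)⁻¹ * normSq v :=
          Finset.sum_le_sum fun x _ => abs_encQ_sub_le φ x y r s v (hP x)
      _ = 1 * normSq v := by simp
      _ ≤ 4 * Real.sqrt (2 ^ n) * normSq v := by
          have : (1 : ℝ) ≤ Real.sqrt (2 ^ n) := Real.one_le_sqrt.2 (one_le_pow₀ (by norm_num))
          exact mul_le_mul_of_nonneg_right (by linarith) (normSq_nonneg v)
  · simpa [funCCA] using sum_abs_dec_sub_le φ y r s v hP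

/-- Without decryption the bound holds for every single point, not just on average. This is needed
after the challenge, when the adversary knows the point. -/
theorem abs_run_funEnc_sub_le {n : ℕ} (φ : Bits n → Bits n) (x y : Bits n)
    {g : Config Unit → ℝ} (hg : ∀ l μ, ProbLike fun v => g ⟨l, μ, v⟩) (t : ℕ) (c : Config Unit) :
    |((run (funEnc φ) t c).map g).sum - ((run (funEnc (Function.update φ x y)) t c).map g).sum| ≤
      t * (2 ^ n : ℝ)⁻¹ * normSq c.vec := by
  have := sum_abs_run_sub_le (ι := Unit) (O := funEnc φ)
    (O' := fun _ => funEnc (Function.update φ x y)) (g := fun _ => g) (K := (2 ^ n : ℝ)⁻¹)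
    (isLinear_funEnc φ) (fun _ => isLinear_funEnc _) (by positivity)
    (fun o r s v P hP => by simpa [funEnc] using abs_encQ_sub_le φ x y r s v (hP ()))
    (fun _ => hg) t c
  simpa using this

/-! ### The games for a random function -/

theorem probLike_postProb {ℓ : ℕ → ℕ} (A : QPTAdversary ℓ) {n : ℕ} (φ : Bits n → Bits n) (μ : Mem)
    (m : Bits n) (a : List Bool) : ProbLike fun v => postProb A φ μ v m a := by
  classical
  simp only [postProb, prob_eq]
  refine ProbLike.run (isLinear_funEnc φ) (fun l ν => ?_) _ _ _
  by_cases h : ν.get 0 = μ.template.f.eval (List.ofFn m)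
  · simpa only [h, if_true] using probLike_normSq
  · simpa only [h, if_false] using probLike_zero

theorem normSq_vacuum : normSq vacuum = 1 := by
  simp [normSq, vacuum]

/-- The map that exchanges the stored value `φ r` with the fresh value `y` is an involution of the
pairs `(φ, y)`, so it preserves the uniform distribution. -/
theorem expect_resample {α β : Type*} [Fintype α] [DecidableEq α] [Fintype β] [Nonempty β] (r : α)
    (f : (α → β) → ℝ) : 𝔼 φ, 𝔼 y, f (Function.update φ r y) = 𝔼 φ, f φ := by
  have e : Function.Involutive fun p : (α → β) × β => (Function.update p.1 r p.2, p.1 r) := by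
    rintro ⟨φ, y⟩
    simp
  calc 𝔼 φ, 𝔼 y, f (Function.update φ r y)
      = 𝔼 p : (α → β) × β, f (Function.update p.1 r p.2) := by
        rw [← Finset.univ_product_univ,
          Finset.expect_product' _ _ fun φ y => f (Function.update φ r y)]
    _ = 𝔼 p : (α → β) × β, f p.1 :=
        Fintype.expect_equiv e.toPerm _ _ fun _ => rfl
    _ = 𝔼 φ, f φ := by
        rw [← Finset.univ_product_univ, Finset.expect_product' _ _ fun φ _ => f φ]
        exact Finset.expect_congr rfl fun φ _ => Fintype.expect_const _

theorem postProb_update_sub_le {ℓ : ℕ → ℕ} (A : QPTAdversary ℓ) {n : ℕ} (φ : Bits n → Bits n)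
    (x y : Bits n) (μ : Mem) (v : Vec) (m : Bits n) (a : List Bool) :
    |postProb A (Function.update φ x y) μ v m a - postProb A φ μ v m a| ≤
      A.time.eval (n + (μ.template.h.eval (List.ofFn m)).length) * (2 ^ n : ℝ)⁻¹ * normSq v := by
  classical
  rw [abs_sub_comm]
  simp only [postProb, prob_eq]
  refine abs_run_funEnc_sub_le φ x y (g := fun c : Config Unit =>
    if c.mem.get 0 = μ.template.f.eval (List.ofFn m) then normSq c.vec else 0) (fun l ν => ?_) _
    (resumeVec A.post n μ v a _)
  by_cases h : ν.get 0 = μ.template.f.eval (List.ofFn m)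
  · simpa only [h, if_true] using probLike_normSq
  · simpa only [h, if_false] using probLike_zero

/-- The function can be changed at a random point after the first phase. -/
theorem expect_gameExp_update_pre_sub_le {ℓ : ℕ → ℕ} (A : QPTAdversary ℓ) {n : ℕ}
    (φ : Bits n → Bits n) (y : Bits n) (α : Bits n → Bits n → List Bool) :
    𝔼 r : Bits n, |gameExp A (Function.update φ r y) (Function.update φ r y) (α r) -
      gameExp A φ (Function.update φ r y) (α r)| ≤
        4 * A.time.eval n * (Real.sqrt (2 ^ n))⁻¹ := by
  have hg : ∀ (r : Bits n) (l : List (Prog CCAQuery)) (μ : Mem), ProbLike fun v =>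
      𝔼 σ : Bits μ.template.samp.arity, postProb A (Function.update φ r y) μ v
        (μ.template.message n σ) (α r (μ.template.message n σ)) := fun r l μ =>
    ProbLike.expect (P := fun (σ : Bits μ.template.samp.arity) v =>
      postProb A (Function.update φ r y) μ v (μ.template.message n σ)
        (α r (μ.template.message n σ))) fun σ => probLike_postProb A _ μ _ _
  have h := sum_abs_run_funCCA_sub_le φ y (g := fun r c =>
    𝔼 σ : Bits c.mem.template.samp.arity, postProb A (Function.update φ r y) c.mem c.vec
      (c.mem.template.message n σ) (α r (c.mem.template.message n σ))) hg (A.time.eval n)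
    (start A.pre n)
  have hκ0 : 0 < Real.sqrt (2 ^ n) := Real.sqrt_pos.2 (by positivity)
  have hκ2 : Real.sqrt (2 ^ n) * Real.sqrt (2 ^ n) = 2 ^ n := Real.mul_self_sqrt (by positivity)
  -- Averaging divides the total over all points, of order `√(2^n)`, by `2^n`.
  rw [expect_bits]
  calc _ ≤ (2 ^ n : ℝ)⁻¹ * (A.time.eval n * (4 * Real.sqrt (2 ^ n)) * normSq vacuum) := by
        refine mul_le_mul_of_nonneg_left (le_trans (le_of_eq ?_) h) (by positivity)
        exact Finset.sum_congr rfl fun r _ => abs_sub_comm _ _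
    _ = _ := by
        generalize Real.sqrt (2 ^ n) = κ at hκ0 hκ2
        rw [normSq_vacuum, ← hκ2]
        field_simp

/-- The change of the function at the point used by the challenge is not noticed in the second phase. -/
theorem gameExp_update_post_sub_le {ℓ : ℕ → ℕ} (A : QPTAdversary ℓ) {n : ℕ} (φ : Bits n → Bits n)
    (r : Bits n) :
    |(𝔼 y : Bits n, gameExp A φ (Function.update φ r y) fun m =>
        List.ofFn (encFn (Function.update φ r y) m r)) -
      𝔼 u : Bits n, gameExp A φ φ fun _ => List.ofFn (Fin.append r u : Bits (n + n))| ≤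
        A.time.eval (n + (n + A.time.eval n)) * (2 ^ n : ℝ)⁻¹ := by
  simp only [gameExp, expect_multiset_sum]
  set T : ℝ := A.time.eval (n + (n + A.time.eval n)) * (2 ^ n : ℝ)⁻¹ with hT
  calc _ ≤ ((run (funCCA φ) (A.time.eval n) (start A.pre n)).map fun c => T * normSq c.vec).sum := by
        refine Multiset.abs_sum_map_sub_le _ _ _ _ fun c hc => ?_
        -- The running time of the second phase depends on the length of `h(m)`, which is bounded
        -- through the counters after the first phase.
        have hlen : ∀ m : Bits n, (c.mem.template.h.eval (List.ofFn m)).length ≤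
            n + A.time.eval n := by
          intro m
          have h1 := Circuit.length_eval_decode_le (c.mem.get 1) (List.ofFn m)
          have h2 := ctr_le_of_mem_run _ _ (start A.pre n) n (fun x => by
            by_cases hx : x = 0 <;> simp [start, Mem.put, Mem.blank, unary, hx]) c hc 1
          have h3 : (c.mem.get 1).length = c.mem.ctr 1 := by simp [Mem.get]
          exact h1.trans (h3.trans_le h2)
        -- The sampling coins are fixed before the average over `y`, so that the plaintext `m` is a
        -- constant in the change of variables.
        rw [Finset.expect_comm, Finset.expect_comm (f := fun (u : Bits n) σ => postProb A φ c.mem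
          c.vec (c.mem.template.message n σ) (List.ofFn (Fin.append r u : Bits (n + n)))),
          ← Finset.expect_sub_distrib]
        refine (Finset.abs_expect_le _ _).trans
          (Finset.expect_le Finset.univ_nonempty fun σ _ => ?_)
        set m := c.mem.template.message n σ
        -- Substituting `y = u ⊕ m` turns the encryption `(r, y ⊕ m)` into `(r, u)`. Only the oracle
        -- of the second phase still depends on the new value at `r`, and it is changed back to `φ`
        -- at small cost.
        have hx : Function.Involutive fun (u : Bits n) i => xor (u i) (m i) := by
          intro u
          funext i
          simp
        rw [← Fintype.expect_equiv hx.toPerm (fun u => postProb A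
          (Function.update φ r fun i => xor (u i) (m i)) c.mem c.vec m
          (List.ofFn (Fin.append r u : Bits (n + n)))) _ (fun u => by
            simp [encFn]), ← Finset.expect_sub_distrib]
        refine (Finset.abs_expect_le _ _).trans
          (Finset.expect_le Finset.univ_nonempty fun u _ => ?_)
        refine (postProb_update_sub_le A φ r _ c.mem c.vec m _).trans ?_
        refine mul_le_mul_of_nonneg_right (mul_le_mul_of_nonneg_right ?_ (by positivity))
          (normSq_nonneg _)
        exact_mod_cast eval_mono A.time (Nat.add_le_add_left (hlen m) n)
    _ = T := by
        rw [Multiset.sum_map_mul_left, sum_normSq_run (isLinear_funCCA φ)]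
        exact (congrArg _ normSq_vacuum).trans (mul_one T)

/-- The two error terms belong to the two hybrids: forgetting the resampled value before the
challenge (`h2`), and then after it, which makes the challenge uniform (`h3`). -/
theorem abs_realValue_sub_idealValue_le {ℓ : ℕ → ℕ} (A : QPTAdversary ℓ) (n : ℕ) :
    |(𝔼 φ : Bits n → Bits n, realValue A φ) - 𝔼 φ : Bits n → Bits n, idealValue A φ| ≤
      4 * A.time.eval n * (Real.sqrt (2 ^ n))⁻¹ +
        A.time.eval (n + (n + A.time.eval n)) * (2 ^ n : ℝ)⁻¹ := by
  -- For each choice of the challenge coins `r`, the value of the random function at `r` is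
  -- resampled; the averages are then reordered so that `φ` and `y` are fixed before `r`.
  have h1 : 𝔼 φ : Bits n → Bits n, realValue A φ = 𝔼 φ : Bits n → Bits n, 𝔼 y : Bits n,
      𝔼 r : Bits n, gameExp A (Function.update φ r y) (Function.update φ r y)
        fun m => List.ofFn (encFn (Function.update φ r y) m r) := by
    simp only [realValue]
    rw [Finset.expect_comm]
    have := fun r : Bits n => expect_resample r fun φ : Bits n → Bits n =>
      gameExp A φ φ fun m => List.ofFn (encFn φ m r)
    simp only [← this]
    rw [Finset.expect_comm]
    exact Finset.expect_congr rfl fun φ _ => Finset.expect_comm _ _ _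
  have h2 : ∀ φ : Bits n → Bits n, |(𝔼 y : Bits n, 𝔼 r : Bits n,
        gameExp A (Function.update φ r y) (Function.update φ r y)
          fun m => List.ofFn (encFn (Function.update φ r y) m r)) -
      𝔼 y : Bits n, 𝔼 r : Bits n, gameExp A φ (Function.update φ r y)
          fun m => List.ofFn (encFn (Function.update φ r y) m r)| ≤
      4 * A.time.eval n * (Real.sqrt (2 ^ n))⁻¹ := by
    intro φ
    rw [← Finset.expect_sub_distrib]
    refine (Finset.abs_expect_le _ _).trans
      (Finset.expect_le Finset.univ_nonempty fun y _ => ?_)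
    rw [← Finset.expect_sub_distrib]
    exact (Finset.abs_expect_le _ _).trans (expect_gameExp_update_pre_sub_le A φ y
      fun r m => List.ofFn (encFn (Function.update φ r y) m r))
  have h3 : ∀ φ : Bits n → Bits n, |(𝔼 y : Bits n, 𝔼 r : Bits n,
        gameExp A φ (Function.update φ r y)
          fun m => List.ofFn (encFn (Function.update φ r y) m r)) - idealValue A φ| ≤
      A.time.eval (n + (n + A.time.eval n)) * (2 ^ n : ℝ)⁻¹ := by
    intro φ
    rw [idealValue, expect_append, Finset.expect_comm, ← Finset.expect_sub_distrib]
    exact (Finset.abs_expect_le _ _).trans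
      (Finset.expect_le Finset.univ_nonempty fun r _ => gameExp_update_post_sub_le A φ r)
  rw [h1, ← Finset.expect_sub_distrib]
  refine (Finset.abs_expect_le _ _).trans
    (Finset.expect_le Finset.univ_nonempty fun φ _ => ?_)
  exact (abs_sub_le _ _ _).trans (add_le_add (h2 φ) (h3 φ))

/-! ### Negligible functions -/

theorem Negligible.mono {ε δ : ℕ → ℝ} (hδ : Negligible δ) (h : ∀ n, ε n ≤ δ n) : Negligible ε :=
  fun p hp => (hδ p hp).imp fun _ hN n hn => (h n).trans_lt (hN n hn)

theorem Negligible.add {ε δ : ℕ → ℝ} (hε : Negligible ε) (hδ : Negligible δ) :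
    Negligible fun n => ε n + δ n := by
  intro p hp
  obtain ⟨N, hN⟩ := hε (2 * p) (mul_ne_zero two_ne_zero hp)
  obtain ⟨M, hM⟩ := hδ (2 * p) (mul_ne_zero two_ne_zero hp)
  refine ⟨max N M, fun n hn => ?_⟩
  have h1 := hN n ((le_max_left _ _).trans_lt hn)
  have h2 := hM n ((le_max_right _ _).trans_lt hn)
  have h3 : (1 : ℝ) / (((2 * p).eval n : ℕ) : ℝ) + 1 / (((2 * p).eval n : ℕ) : ℝ) =
      1 / ((p.eval n : ℕ) : ℝ) := by
    simp only [Polynomial.eval_mul, Polynomial.eval_ofNat, Nat.cast_mul, Nat.cast_ofNat, one_div,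
      mul_inv]
    ring
  linarith

/-- The coefficients are natural numbers, so nothing cancels. -/
theorem eval_pos {p : Polynomial ℕ} (hp : p ≠ 0) {n : ℕ} (hn : 0 < n) : 0 < p.eval n := by
  refine Nat.pos_of_ne_zero fun h => hp ?_
  rw [Polynomial.eval_eq_sum, Polynomial.sum, Finset.sum_eq_zero_iff] at h
  refine Polynomial.support_eq_empty.1 (Finset.eq_empty_of_forall_notMem fun i hi => ?_)
  have := h i hi
  simp only [mul_eq_zero, pow_eq_zero_iff', hn.ne', false_and, or_false] at this
  exact Polynomial.mem_support_iff.1 hi this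

theorem tendsto_eval_mul_pow (p : Polynomial ℕ) {r : ℝ} (h0 : 0 ≤ r) (h1 : r < 1) :
    Filter.Tendsto (fun n => ((p.eval n : ℕ) : ℝ) * r ^ n) Filter.atTop (nhds 0) := by
  have h : ∀ n, ((p.eval n : ℕ) : ℝ) * r ^ n =
      ∑ i ∈ p.support, (p.coeff i : ℝ) * ((n : ℝ) ^ i * r ^ n) := by
    intro n
    rw [Polynomial.eval_eq_sum, Polynomial.sum, Nat.cast_sum, Finset.sum_mul]
    refine Finset.sum_congr rfl fun i _ => ?_
    push_cast
    ring
  simp only [h]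
  rw [← Finset.sum_const_zero (s := p.support)]
  refine tendsto_finsetSum _ fun i _ => ?_
  simpa using (tendsto_pow_const_mul_const_pow_of_lt_one i h0 h1).const_mul (p.coeff i : ℝ)

theorem negligible_eval_mul_pow (q : Polynomial ℕ) {r : ℝ} (h0 : 0 ≤ r) (h1 : r < 1) :
    Negligible fun n => ((q.eval n : ℕ) : ℝ) * r ^ n := by
  intro p hp
  obtain ⟨N, hN⟩ := Filter.eventually_atTop.1
    ((tendsto_eval_mul_pow (q * p) h0 h1).eventually (gt_mem_nhds one_pos))
  refine ⟨N, fun n hn => ?_⟩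
  have h2 : (0 : ℝ) < ((p.eval n : ℕ) : ℝ) := Nat.cast_pos.2 (eval_pos hp (by omega))
  have h3 := hN n hn.le
  rw [Polynomial.eval_mul, Nat.cast_mul] at h3
  rw [lt_div_iff₀ h2]
  linarith

theorem inv_sqrt_two_pow (n : ℕ) : (Real.sqrt (2 ^ n))⁻¹ = (Real.sqrt 2)⁻¹ ^ n := by
  have h : Real.sqrt (2 ^ n) = Real.sqrt 2 ^ n := by
    rw [Real.sqrt_eq_iff_mul_self_eq (by positivity) (by positivity), ← mul_pow,
      Real.mul_self_sqrt (by norm_num)]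
  rw [h, inv_pow]

/-- Both terms are a polynomial times a geometric sequence, with ratios `1/√2` and `1/2`. -/
theorem negligible_hybrid (p : Polynomial ℕ) : Negligible fun n =>
    4 * p.eval n * (Real.sqrt (2 ^ n))⁻¹ + p.eval (n + (n + p.eval n)) * (2 ^ n : ℝ)⁻¹ := by
  refine Negligible.add ?_ ?_
  · refine (negligible_eval_mul_pow (4 * p) (r := (Real.sqrt 2)⁻¹) (by positivity)
      (inv_lt_one_of_one_lt₀ (by
        rw [Real.lt_sqrt (by norm_num)]
        norm_num))).mono fun n => le_of_eq ?_
    rw [inv_sqrt_two_pow]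
    simp
  · refine (negligible_eval_mul_pow (p.comp (Polynomial.X + (Polynomial.X + p))) (r := 2⁻¹)
      (by norm_num) (by norm_num)).mono fun n => le_of_eq ?_
    simp

end QCrypto

theorem mainTheorem8 (F : QCrypto.KeyedFamily) (hF : QCrypto.IsQPRF F) :
    (QCrypto.prfScheme F).IsSEMQCCA1 := by
  open QCrypto in
  intro A
  obtain ⟨B₁, h₁⟩ := A.pre.exists_below
  obtain ⟨B₂, h₂⟩ := A.post.exists_below
  -- The tapes `0`, `1`, `2` carry the inputs and outputs of the game, hence `3 ≤ B`.
  obtain ⟨B, hB, hpre, hpost⟩ : ∃ B, 3 ≤ B ∧ A.pre.Below B ∧ A.post.Below B :=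
    ⟨3 + B₁ + B₂, by omega, h₁.mono (by omega), h₂.mono (by omega)⟩
  have hℓ : ∀ n, (prfScheme F).chalLen true n = n + n := fun _ => rfl
  have hℓ' : ∀ n, (prfScheme F).chalLen false n = n := fun _ => rfl
  refine ⟨simulator A hB hℓ hℓ' hpre, fun n t => ?_, ?_⟩
  · unfold SKES.templateProb
    simp only [preRun_simulator]
  -- Pseudorandomness is used twice, for the game with a true encryption and for the one with a
  -- random challenge; the two random-function games are compared by
  -- `abs_realValue_sub_idealValue_le`, and the triangle inequality concludes.
  obtain ⟨ε₁, hε₁, hreal⟩ := hF.2 (gameDistinguisher A (realChal B hB) hB hℓ hpre hpost)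
  obtain ⟨ε₀, hε₀, hideal⟩ := hF.2 (gameDistinguisher A (uniformChal B hB) hB hℓ hpre hpost)
  refine ⟨_, (hε₁.add hε₀).add (negligible_hybrid A.time), fun n => ?_⟩
  have hr := hreal n
  have hi := hideal n
  simp only [acceptProb_gameDistinguisher, gameValue_eq A _ hpre hpost _ (realChal_yields hB _)] at hr
  simp only [acceptProb_gameDistinguisher,
    gameValue_eq A _ hpre hpost _ (uniformChal_yields hB _)] at hi
  have hh := abs_realValue_sub_idealValue_le A n
  rw [semWinProb_real, semWinProb_simulator]
  simp only [realValue, idealValue] at hh ⊢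
  rw [abs_le] at *
  constructor <;> linarith
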